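/- Let $C_{4\pi}=[0,\infty)_r\times(\mathbb R/4\pi\mathbb Z)_\theta$, with all points $(0,\theta)$ identified to the vertex, be the flat cone with metric $dr^2+r^2\,d\theta^2$ and area measure $dS=r\,dr\,d\theta$, and let $C_{4\pi}^\circ=\{r>0\}$ be the cone without its vertex. Let $\Delta\ge 0$ be the Friedrichs extension on $L^2(C_{4\pi},dS)$ of the nonnegative Laplacian on $C_c^\infty(C_{4\pi}^\circ)$, i.e. the self-adjoint operator associated with the closure of the form $Q(u)=\int|\nabla u|^2\,dS$, $u\in C_c^\infty(C_{4\pi}^\circ)$, and let $\mathbf W(t)=\sin(t\sqrt\Delta)/\sqrt\Delta$, defined by the functional calculus. For $\theta\in\mathbb R$ let $\vec X=\cos\theta\,\partial_x+\sin\theta\,\partial_y$ be the constant unit vector field in the direction $\theta$ on $C_{4\pi}^\circ$, where $x+iy=re^{i\theta'}$ at the point with polar coordinates $(r,\theta')$. Then for every $t>0$ and every $\theta\in\mathbb R$ the Schwartz kernel $\Upsilon_0(t,\cdot\,;\cdot)\in\mathcal D'(C_{4\pi}^\circ\times C_{4\pi}^\circ)$, with respect to $dS$, of the commutator $[\vec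 X,\mathbf W(t)]:C_c^\infty(C_{4\pi}^\circ)\to\mathcal D'(C_{4\pi}^\circ)$ is $$\Upsilon_0(t,r_1,\theta_1;r_2,\theta_2)=\frac1{4\pi\sqrt{r_1r_2}}\;\delta(t-r_1-r_2)\;\cos\!\Big(\frac{\theta_1+\theta_2}{2}-\theta\Big).$$ That is, the right-hand side is a distribution on $C_{4\pi}^\circ\times C_{4\pi}^\circ$, and for all $\varphi,\psi\in C_c^\infty(C_{4\pi}^\circ)$, with the bilinear pairing $\langle u,\varphi\rangle=\int u\,\varphi\,dS$ and $\langle\vec Xu,\varphi\rangle=-\langle u,\vec X\varphi\rangle$, $$\big\langle[\vec X,\mathbf W(t)]\psi,\varphi\big\rangle=\int_0^{4\pi}\!\!\int_0^{4\pi}\!\!\int_0^t\frac{\cos\big(\frac{\theta_1+\theta_2}{2}-\theta\big)}{4\pi\sqrt{r(t-r)}}\,\varphi(r,\theta_1)\,\psi(t-r,\theta_2)\;r(t-r)\,dr\,d\theta_2\,d\theta_1 .$$ -/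

import Mathlib

open MeasureTheory Set
open scoped ContDiff InnerProductSpace

noncomputable section

namespace ConeWave

/-! ### The flat cone of total angle `4π` -/

instance fact_four_pi_pos : Fact (0 < 4 * Real.pi) := ⟨by positivity⟩

/-- Angular variable: the circle `ℝ / 4πℤ`. -/
abbrev Angle : Type := AddCircle (4 * Real.pi)

/-- Polar coordinates `(r, θ) ∈ ℝ × ℝ/4πℤ`. The cone of angle `4π` without its vertex is the
open part `0 < r` (see `punctured`), with the flat metric `dr² + r² dθ²`. -/
abbrev Cone : Type := ℝ × Angle

/-- The cone without its vertex. -/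
def punctured : Set Cone := {q | 0 < q.1}

/-- The area measure `r dr dθ`; it is carried by `0 < r`. -/
def area : Measure Cone :=
  ((volume.restrict (Ioi (0 : ℝ))).withDensity fun r => ENNReal.ofReal r).prod volume

/-- A function on the cone, written in the coordinates `(r, θ) ∈ ℝ × ℝ`. -/
def lift (f : Cone → ℂ) : ℝ × ℝ → ℂ := fun p => f (p.1, (p.2 : Angle))

/-- Membership in `C_c^∞` of the cone without its vertex. -/
structure IsTest (f : Cone → ℂ) : Prop where
  smooth : ContDiff ℝ ∞ (lift f)
  compact : HasCompactSupport f
  support : tsupport f ⊆ punctured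

/-- `∂f/∂r`. -/
def dr (f : Cone → ℂ) : Cone → ℂ := fun q => deriv (fun s : ℝ => f (s, q.2)) q.1

/-- `∂f/∂θ`. -/
def dθ (f : Cone → ℂ) : Cone → ℂ := fun q => deriv (fun s : ℝ => f (q.1, q.2 + (s : Angle))) 0

/-- `cos (θ - α)` as a function of `θ ∈ ℝ/4πℤ`. -/
def cosAngle (α : ℝ) : Angle → ℝ :=
  Function.Periodic.lift (f := fun x : ℝ => Real.cos (x - α)) (c := 4 * Real.pi) (by
    intro x
    have h : x + 4 * Real.pi - α = x - α + 2 * Real.pi + 2 * Real.pi := by ring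
    simp only [h, Real.cos_add_two_pi])

/-- `sin (θ - α)` as a function of `θ ∈ ℝ/4πℤ`. -/
def sinAngle (α : ℝ) : Angle → ℝ :=
  Function.Periodic.lift (f := fun x : ℝ => Real.sin (x - α)) (c := 4 * Real.pi) (by
    intro x
    have h : x + 4 * Real.pi - α = x - α + 2 * Real.pi + 2 * Real.pi := by ring
    simp only [h, Real.sin_add_two_pi])

/-- `cos (θ / 2 - α)` as a function of `θ ∈ ℝ/4πℤ`. -/
def cosHalfAngle (α : ℝ) : Angle → ℝ :=
  Function.Periodic.lift (f := fun x : ℝ => Real.cos (x / 2 - α)) (c := 4 * Real.pi) (by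
    intro x
    have h : (x + 4 * Real.pi) / 2 - α = x / 2 - α + 2 * Real.pi := by ring
    simp only [h, Real.cos_add_two_pi])

/-- The constant unit vector field in the direction `α`, that is `cos α ∂_x + sin α ∂_y` in the
flat coordinates `x + iy = r e^{iθ}`, in polar coordinates. -/
def X (α : ℝ) (f : Cone → ℂ) : Cone → ℂ := fun q =>
  (cosAngle α q.2 : ℂ) * dr f q + ((-(sinAngle α q.2) / q.1 : ℝ) : ℂ) * dθ f q

/-! ### Test functions are square integrable and stable under differentiation -/

instance area_finiteOnCompacts : IsFiniteMeasureOnCompacts area := by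
  have : IsLocallyFiniteMeasure
      ((volume.restrict (Ioi (0 : ℝ))).withDensity fun r => ENNReal.ofReal r) :=
    IsLocallyFiniteMeasure.withDensity_ofReal continuous_id
  unfold area
  infer_instance

theorem isOpenQuotientMap_coords :
    IsOpenQuotientMap (fun p : ℝ × ℝ => ((p.1, (p.2 : Angle)) : Cone)) :=
  IsOpenQuotientMap.id.prodMap QuotientAddGroup.isOpenQuotientMap_mk

theorem IsTest.continuous {f : Cone → ℂ} (hf : IsTest f) : Continuous f :=
  isOpenQuotientMap_coords.isQuotientMap.continuous_iff.2 hf.smooth.continuous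

theorem IsTest.memLp {f : Cone → ℂ} (hf : IsTest f) : MemLp f 2 area :=
  hf.continuous.memLp_of_hasCompactSupport hf.compact

theorem lift_dr {f : Cone → ℂ} (hf : IsTest f) :
    lift (dr f) = fun p => fderiv ℝ (lift f) p (1, 0) := by
  funext p
  have h1 : HasFDerivAt (lift f) (fderiv ℝ (lift f) p) p :=
    (hf.smooth.differentiable (by simp)).differentiableAt.hasFDerivAt
  have h2 : HasDerivAt (fun s : ℝ => ((s, p.2) : ℝ × ℝ)) (1, 0) p.1 :=
    (hasDerivAt_id _).prodMk (hasDerivAt_const _ _)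
  exact (h1.comp_hasDerivAt p.1 h2).deriv

theorem lift_dθ {f : Cone → ℂ} (hf : IsTest f) :
    lift (dθ f) = fun p => fderiv ℝ (lift f) p (0, 1) := by
  funext p
  have h1 : HasFDerivAt (lift f) (fderiv ℝ (lift f) p) (p.1, p.2 + 0) := by
    rw [add_zero]
    exact (hf.smooth.differentiable (by simp)).differentiableAt.hasFDerivAt
  have h2 : HasDerivAt (fun s : ℝ => ((p.1, p.2 + s) : ℝ × ℝ)) (0, 1) 0 :=
    (hasDerivAt_const _ _).prodMk ((hasDerivAt_id _).const_add _)
  exact (h1.comp_hasDerivAt (0 : ℝ) h2).deriv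

theorem isTest_of_support_subset {f g : Cone → ℂ} (hf : IsTest f) (hg : ContDiff ℝ ∞ (lift g))
    (h : Function.support g ⊆ tsupport f) : IsTest g :=
  ⟨hg, hf.compact.mono' h, (closure_minimal h (isClosed_tsupport f)).trans hf.support⟩

theorem IsTest.dr {f : Cone → ℂ} (hf : IsTest f) : IsTest (dr f) := by
  refine isTest_of_support_subset hf ?_ ?_
  · rw [lift_dr hf]
    exact (hf.smooth.fderiv_right (by simp)).clm_apply contDiff_const
  · intro q hq
    by_contra hn
    refine hq ?_
    have h0 : f =ᶠ[nhds q] 0 := notMem_tsupport_iff_eventuallyEq.1 hn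
    have hc : Filter.Tendsto (fun s : ℝ => ((s, q.2) : Cone)) (nhds q.1) (nhds q) :=
      (Continuous.tendsto (by fun_prop) q.1 : _)
    have h1 : (fun s : ℝ => f (s, q.2)) =ᶠ[nhds q.1] fun _ => (0 : ℂ) := hc.eventually h0
    change deriv _ _ = 0
    rw [h1.deriv_eq, deriv_const]

theorem IsTest.dθ {f : Cone → ℂ} (hf : IsTest f) : IsTest (dθ f) := by
  refine isTest_of_support_subset hf ?_ ?_
  · rw [lift_dθ hf]
    exact (hf.smooth.fderiv_right (by simp)).clm_apply contDiff_const
  · intro q hq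
    by_contra hn
    refine hq ?_
    have h0 : f =ᶠ[nhds q] 0 := notMem_tsupport_iff_eventuallyEq.1 hn
    have hcont : Continuous (fun s : ℝ => ((q.1, q.2 + (s : Angle)) : Cone)) :=
      continuous_const.prodMk (continuous_const.add (AddCircle.continuous_mk' _))
    have hc : Filter.Tendsto (fun s : ℝ => ((q.1, q.2 + (s : Angle)) : Cone)) (nhds 0)
        (nhds q) := by
      have := hcont.tendsto 0
      simpa using this
    have h1 : (fun s : ℝ => f (q.1, q.2 + (s : Angle))) =ᶠ[nhds 0] fun _ => (0 : ℂ) :=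
      hc.eventually h0
    change deriv _ _ = 0
    rw [h1.deriv_eq, deriv_const]

theorem IsTest.add {f g : Cone → ℂ} (hf : IsTest f) (hg : IsTest g) :
    IsTest (fun q => f q + g q) :=
  ⟨hf.smooth.add hg.smooth, hf.compact.add hg.compact,
    (tsupport_add f g).trans (union_subset hf.support hg.support)⟩

theorem IsTest.mul {f : Cone → ℂ} (hf : IsTest f) {g : Cone → ℂ}
    (hg : ∀ p : ℝ × ℝ, 0 < p.1 → ContDiffAt ℝ ∞ (lift g) p) : IsTest (fun q => g q * f q) := by
  refine isTest_of_support_subset hf ?_ ?_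
  · refine contDiff_iff_contDiffAt.2 fun p => ?_
    by_cases hp : 0 < p.1
    · exact (hg p hp).mul hf.smooth.contDiffAt
    · have hn : ((p.1, (p.2 : Angle)) : Cone) ∉ tsupport f := fun h => hp (hf.support h)
      have h0 : f =ᶠ[nhds _] 0 := notMem_tsupport_iff_eventuallyEq.1 hn
      have h1 : lift (fun q => g q * f q) =ᶠ[nhds p] fun _ => (0 : ℂ) := by
        have := isOpenQuotientMap_coords.continuous.tendsto p |>.eventually h0
        filter_upwards [this] with x hx
        change g _ * f _ = 0
        rw [hx]
        simp
      exact contDiffAt_const.congr_of_eventuallyEq h1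
  · intro q hq
    refine subset_tsupport f fun h => hq ?_
    simp [h]

/-- `r⁻¹ ∂f/∂θ`. -/
def angularDeriv (f : Cone → ℂ) : Cone → ℂ := fun q => ((1 / q.1 : ℝ) : ℂ) * dθ f q

theorem IsTest.angularDeriv {f : Cone → ℂ} (hf : IsTest f) : IsTest (angularDeriv f) := by
  refine hf.dθ.mul (g := fun q => ((1 / q.1 : ℝ) : ℂ)) fun p hp => ?_
  have h : ContDiffAt ℝ ∞ (fun p : ℝ × ℝ => 1 / p.1) p :=
    contDiffAt_const.div contDiffAt_fst hp.ne'
  exact Complex.ofRealCLM.contDiff.contDiffAt.comp p h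

theorem IsTest.X {f : Cone → ℂ} (hf : IsTest f) (α : ℝ) : IsTest (X α f) := by
  refine (hf.dr.mul (g := fun q => (cosAngle α q.2 : ℂ)) fun p _ => ?_).add
    (hf.dθ.mul (g := fun q => ((-(sinAngle α q.2) / q.1 : ℝ) : ℂ)) fun p hp => ?_)
  · have h : ContDiffAt ℝ ∞ (fun p : ℝ × ℝ => Real.cos (p.2 - α)) p :=
      (Real.contDiff_cos.comp (contDiff_snd.sub contDiff_const)).contDiffAt
    exact Complex.ofRealCLM.contDiff.contDiffAt.comp p h
  · have h : ContDiffAt ℝ ∞ (fun p : ℝ × ℝ => -Real.sin (p.2 - α) / p.1) p :=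
      ((Real.contDiff_sin.comp (contDiff_snd.sub contDiff_const)).neg.contDiffAt).div
        contDiffAt_fst hp.ne'
    exact Complex.ofRealCLM.contDiff.contDiffAt.comp p h

/-! ### The Friedrichs Laplacian and the sine propagator -/

/-- `L²` of the cone. -/
abbrev L2 : Type := Lp ℂ 2 area

/-- A test function as an element of `L²`. -/
def IsTest.toL2 {f : Cone → ℂ} (hf : IsTest f) : L2 := hf.memLp.toLp f

/-- Triples of `L²` functions, with the Hilbert norm. -/
abbrev L2Triple : Type := PiLp 2 fun _ : Fin 3 => L2

/-- The triple `(f, ∂_r f, r⁻¹ ∂_θ f)`; its last two entries are the gradient of `f` in the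
orthonormal frame `∂_r, r⁻¹ ∂_θ`, so its squared norm is `‖f‖² + ∫ |∇f|² dS`. -/
def IsTest.jet {f : Cone → ℂ} (hf : IsTest f) : L2Triple :=
  WithLp.toLp 2 ![hf.toL2, hf.dr.toL2, hf.angularDeriv.toL2]

/-- The domain of the closure of the Dirichlet form `Q(u) = ∫ |∇u|² dS` on `C_c^∞`: the
completion of `C_c^∞` in the norm `(‖u‖² + Q(u))^{1/2}`, each element being recorded
with its gradient. -/
def formDomain : Submodule ℂ L2Triple :=
  (Submodule.span ℂ {U | ∃ (f : Cone → ℂ) (hf : IsTest f), U = hf.jet}).topologicalClosure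

instance formDomain_complete : CompleteSpace formDomain :=
  (Submodule.isClosed_topologicalClosure _).completeSpace_coe

/-- `u` lies in the domain of the Friedrichs extension `Δ` of the (nonnegative) Laplacian on
`C_c^∞`, and `Δ u = f`: the function `u` is in the form domain and
`∫ ⟨∇u, ∇z⟩ dS = ∫ ⟨f, z⟩ dS` for all `z` in the form domain. -/
def IsFriedrichsLaplacian (u f : L2) : Prop :=
  ∃ U ∈ formDomain, U 0 = u ∧
    ∀ Z ∈ formDomain, ⟪U 1, Z 1⟫_ℂ + ⟪U 2, Z 2⟫_ℂ = ⟪f, Z 0⟫_ℂ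

/-- The inclusion of the form domain in `L²`. -/
def formInclusion : formDomain →L[ℂ] L2 :=
  (PiLp.proj 2 (fun _ : Fin 3 => L2) 0).comp formDomain.subtypeL

/-- The resolvent `(1 + Δ)⁻¹` of the Friedrichs Laplacian: the adjoint of the inclusion of the
form domain sends `f` to the `U` with `⟨U, Z⟩ + Q(U, Z) = ⟨f, Z⟩` for all `Z`.
See `isFriedrichsLaplacian_iff`. -/
def resolventOne : L2 →L[ℂ] L2 :=
  formInclusion ∘L ContinuousLinearMap.adjoint formInclusion

/-- `resolventOne` is the inverse of `1 + Δ`. -/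
theorem isFriedrichsLaplacian_iff (u f : L2) :
    IsFriedrichsLaplacian u f ↔ resolventOne (u + f) = u := by
  have key : ∀ U Z : formDomain, ⟪U, Z⟫_ℂ =
      ⟪(U : L2Triple) 0, (Z : L2Triple) 0⟫_ℂ + (⟪(U : L2Triple) 1, (Z : L2Triple) 1⟫_ℂ
        + ⟪(U : L2Triple) 2, (Z : L2Triple) 2⟫_ℂ) := by
    intro U Z
    rw [Submodule.coe_inner, PiLp.inner_apply, Fin.sum_univ_three, add_assoc]
  constructor
  · rintro ⟨U, hU, hu, h⟩
    have h1 : ContinuousLinearMap.adjoint formInclusion (u + f) = ⟨U, hU⟩ := by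
      refine ext_inner_right ℂ fun Z => ?_
      rw [ContinuousLinearMap.adjoint_inner_left, key, h Z Z.2, inner_add_left, hu]
      rfl
    change formInclusion (ContinuousLinearMap.adjoint formInclusion (u + f)) = u
    rw [h1]
    exact hu
  · intro h
    set U := ContinuousLinearMap.adjoint formInclusion (u + f) with hU
    have hu : (U : L2Triple) 0 = u := h
    refine ⟨U, U.2, hu, fun Z hZ => ?_⟩
    have h2 : ⟪U, (⟨Z, hZ⟩ : formDomain)⟫_ℂ = ⟪u + f, Z 0⟫_ℂ := by
      rw [hU, ContinuousLinearMap.adjoint_inner_left]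
      rfl
    rw [key, inner_add_left, hu] at h2
    exact add_left_cancel h2

theorem isPositive_comp_adjoint {H V : Type*} [NormedAddCommGroup H] [InnerProductSpace ℂ H]
    [CompleteSpace H] [NormedAddCommGroup V] [InnerProductSpace ℂ V] [CompleteSpace V]
    (J : V →L[ℂ] H) : (J ∘L ContinuousLinearMap.adjoint J).IsPositive := by
  have := ContinuousLinearMap.IsPositive.adjoint_conj
    (ContinuousLinearMap.isPositive_one (𝕜 := ℂ) (E := V)) (ContinuousLinearMap.adjoint J)
  rw [ContinuousLinearMap.adjoint_adjoint] at this
  exact this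

theorem spectrum_comp_adjoint {H V : Type*} [NormedAddCommGroup H] [InnerProductSpace ℂ H]
    [CompleteSpace H] [NormedAddCommGroup V] [InnerProductSpace ℂ V] [CompleteSpace V]
    (J : V →L[ℂ] H) (hJ : ‖J‖ ≤ 1) :
    spectrum ℝ (J ∘L ContinuousLinearMap.adjoint J) ⊆ Icc 0 1 := by
  intro x hx
  have h0 : 0 ≤ x :=
    (SpectrumRestricts.nnreal_iff.1 (isPositive_comp_adjoint J).spectrumRestricts) x hx
  refine ⟨h0, ?_⟩
  have h1 : ‖J ∘L ContinuousLinearMap.adjoint J‖ ≤ 1 :=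
    calc _ ≤ ‖J‖ * ‖ContinuousLinearMap.adjoint J‖ := ContinuousLinearMap.opNorm_comp_le _ _
      _ ≤ 1 * 1 := by rw [LinearIsometryEquiv.norm_map]; gcongr
      _ = 1 := one_mul 1
  rcases subsingleton_or_nontrivial H with hH | hH
  · exact absurd hx (by simp [spectrum.of_subsingleton])
  · exact (le_abs_self x).trans ((spectrum.norm_le_norm_of_mem hx).trans h1)

theorem norm_formInclusion_le : ‖formInclusion‖ ≤ 1 := by
  refine ContinuousLinearMap.opNorm_le_bound _ zero_le_one fun U => ?_
  rw [one_mul]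
  exact PiLp.norm_apply_le (U : L2Triple) 0

/-- `(1 + Δ)⁻¹` is self-adjoint (indeed positive); by `spectrum_comp_adjoint` and
`norm_formInclusion_le` its spectrum lies in `[0, 1]`. -/
theorem isPositive_resolventOne : resolventOne.IsPositive := isPositive_comp_adjoint formInclusion

/-- The function `x ↦ F(x⁻¹ - 1)` with `F(λ) = sin (t √λ) / √λ` (and `F(0) = t`), extended by its
limit `0` at `x = 0`. It is continuous on `[0, 1]`, which contains the spectrum of `(1 + Δ)⁻¹`. -/
def sineSymbol (t x : ℝ) : ℝ :=
  if x = 0 then 0 else t * Real.sinc (t * Real.sqrt (x⁻¹ - 1))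

theorem continuousOn_sineSymbol (t : ℝ) : ContinuousOn (sineSymbol t) (Icc 0 1) := by
  have hs : ∀ y : ℝ, |sineSymbol t y| ≤ (Real.sqrt (y⁻¹ - 1))⁻¹ ∨ y = 0 ∨ 1 ≤ y ∨ y < 0 := by
    intro y
    by_contra! hy
    obtain ⟨h1, h2, h3, h4⟩ := hy
    have h5 : 0 < Real.sqrt (y⁻¹ - 1) := by
      have : 1 < y⁻¹ := (one_lt_inv₀ (lt_of_le_of_ne h4 h2.symm)).2 h3
      exact Real.sqrt_pos.2 (by linarith)
    refine h1.not_ge ?_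
    rw [sineSymbol, if_neg h2]
    rcases eq_or_ne t 0 with rfl | ht
    · simp
    · rw [Real.sinc_of_ne_zero (mul_ne_zero ht h5.ne')]
      have h6 : t * (Real.sin (t * Real.sqrt (y⁻¹ - 1)) / (t * Real.sqrt (y⁻¹ - 1))) =
          Real.sin (t * Real.sqrt (y⁻¹ - 1)) * (Real.sqrt (y⁻¹ - 1))⁻¹ := by
        field_simp
      rw [h6, abs_mul, abs_of_pos (inv_pos.2 h5)]
      exact mul_le_of_le_one_left (inv_pos.2 h5).le (Real.abs_sin_le_one _)
  intro x hx
  rcases eq_or_lt_of_le hx.1 with h0 | h0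
  · subst h0
    have h1 : sineSymbol t 0 = 0 := by simp [sineSymbol]
    have hl : Filter.Tendsto (fun y : ℝ => (Real.sqrt (y⁻¹ - 1))⁻¹) (nhdsWithin 0 (Ioi 0))
        (nhds 0) :=
      (Real.tendsto_sqrt_atTop.comp
        (Filter.tendsto_atTop_add_const_right _ (-1) tendsto_inv_nhdsGT_zero)).inv_tendsto_atTop
    have hc : ContinuousWithinAt (sineSymbol t) (Ioi 0) 0 := by
      rw [ContinuousWithinAt, h1]
      refine squeeze_zero_norm' ?_ hl
      have : Iio (1 : ℝ) ∈ nhdsWithin (0 : ℝ) (Ioi 0) :=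
        mem_nhdsWithin_of_mem_nhds (Iio_mem_nhds one_pos)
      filter_upwards [this, self_mem_nhdsWithin] with y hy hy0
      have hy0' : (0 : ℝ) < y := hy0
      rcases hs y with h | h | h | h
      · exact h
      · exact absurd h hy0'.ne'
      · exact absurd hy (not_lt.2 h)
      · exact absurd hy0' h.le.not_gt
    exact (continuousWithinAt_Ioi_iff_Ici.1 hc).mono Icc_subset_Ici_self
  · have hc : ContinuousAt (fun y : ℝ => t * Real.sinc (t * Real.sqrt (y⁻¹ - 1))) x := by
      have : ContinuousAt (fun y : ℝ => y⁻¹) x := continuousAt_inv₀ h0.ne'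
      exact continuousAt_const.mul (Real.continuous_sinc.continuousAt.comp
        (continuousAt_const.mul (Real.continuous_sqrt.continuousAt.comp
          (this.sub continuousAt_const))))
    refine (hc.congr ?_).continuousWithinAt
    filter_upwards [Ioi_mem_nhds h0] with y hy
    rw [sineSymbol, if_neg (ne_of_gt hy)]

/-- The continuous functional calculus for bounded self-adjoint operators on a Hilbert space. -/
def functionalCalculus {H : Type*} [NormedAddCommGroup H] [InnerProductSpace ℂ H]
    [CompleteSpace H] (f : ℝ → ℝ) (T : H →L[ℂ] H) : H →L[ℂ] H := cfc f T

/-- The sine propagator `W(t) = F(Δ) = sin (t √Δ) / √Δ`, by the functional calculus: a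
function of `Δ` is a function of the bounded self-adjoint operator `(1 + Δ)⁻¹`. -/
def W (t : ℝ) : L2 →L[ℂ] L2 := functionalCalculus (sineSymbol t) resolventOne

/-! ### Distributions and Schwartz kernels -/

/-- The distribution `φ ↦ ∫ u φ dS` (bilinear pairing) defined by an `L²` function. -/
def toDistribution (u : L2) : (Cone → ℂ) → ℂ := fun φ => ∫ q, u q * φ q ∂area

/-- A constant vector field acting on distributions: `⟨X u, φ⟩ = -⟨u, X φ⟩` (constant vector
fields are divergence free). -/
def distX (α : ℝ) (u : (Cone → ℂ) → ℂ) : (Cone → ℂ) → ℂ := fun φ => -u (X α φ)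

/-- `[X, W(t)] ψ = X (W(t) ψ) - W(t) (X ψ)`, as a distribution on the cone without its vertex. -/
def commutator (α t : ℝ) (ψ : {f : Cone → ℂ // IsTest f}) : (Cone → ℂ) → ℂ := fun φ =>
  distX α (toDistribution (W t ψ.2.toL2)) φ - toDistribution (W t (ψ.2.X α).toL2) φ

/-- A function of two points of the cone, written in polar coordinates in each of them. -/
def lift₂ (Ψ : Cone × Cone → ℂ) : (ℝ × ℝ) × (ℝ × ℝ) → ℂ := fun p =>
  Ψ ((p.1.1, (p.1.2 : Angle)), (p.2.1, (p.2.2 : Angle)))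

/-- Membership in `C_c^∞` of the product of two copies of the cone without its vertex. -/
structure IsTest₂ (Ψ : Cone × Cone → ℂ) : Prop where
  smooth : ContDiff ℝ ∞ (lift₂ Ψ)
  compact : HasCompactSupport Ψ
  support : tsupport Ψ ⊆ punctured ×ˢ punctured

/-- `K` is a distribution on the product of two copies of the cone without its vertex: a linear
functional on `C_c^∞` which, on the functions supported in any given compact set, is bounded by
finitely many derivatives. -/
structure IsDistribution₂ (K : (Cone × Cone → ℂ) → ℂ) : Prop where
  map_add : ∀ Φ Ψ, IsTest₂ Φ → IsTest₂ Ψ → K (Φ + Ψ) = K Φ + K Ψ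
  map_smul : ∀ (c : ℂ) (Ψ), IsTest₂ Ψ → K (c • Ψ) = c * K Ψ
  bound : ∀ S : Set (Cone × Cone), IsCompact S → S ⊆ punctured ×ˢ punctured →
    ∃ (C : ℝ) (N : ℕ), ∀ Ψ, IsTest₂ Ψ → tsupport Ψ ⊆ S → ∀ B : ℝ,
      (∀ n ≤ N, ∀ p, ‖iteratedFDeriv ℝ n (lift₂ Ψ) p‖ ≤ B) → ‖K Ψ‖ ≤ C * B

/-- `K` is the Schwartz kernel (with respect to the area measure) of the operator `A` from test
functions to distributions: `⟨K, φ ⊗ ψ⟩ = ⟨A ψ, φ⟩`. -/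
structure IsSchwartzKernel (K : (Cone × Cone → ℂ) → ℂ)
    (A : {f : Cone → ℂ // IsTest f} → (Cone → ℂ) → ℂ) : Prop where
  isDistribution : IsDistribution₂ K
  apply_tensor : ∀ φ ψ : {f : Cone → ℂ // IsTest f},
    K (fun q => φ.1 q.1 * ψ.1 q.2) = A ψ φ.1

/-- The distribution `a(q₁, q₂) δ(t - r₁ - r₂)`, paired with `Ψ` with respect to the area measure
`r₁ dr₁ dθ₁ r₂ dr₂ dθ₂`: integrating out `r₂` puts `r₂ = t - r₁`. -/
def deltaFront (t : ℝ) (a : Cone × Cone → ℂ) : (Cone × Cone → ℂ) → ℂ := fun Ψ =>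
  ∫ θ₁ : Angle, ∫ θ₂ : Angle, ∫ r in (0 : ℝ)..t,
    a ((r, θ₁), (t - r, θ₂)) * Ψ ((r, θ₁), (t - r, θ₂)) * ((r * (t - r) : ℝ) : ℂ)

/-- The amplitude `(4π √(r₁ r₂))⁻¹ cos ((θ₁ + θ₂) / 2 - α)`. -/
def amplitude (α : ℝ) : Cone × Cone → ℂ := fun q =>
  ((1 / (4 * Real.pi * Real.sqrt (q.1.1 * q.2.1)) * cosHalfAngle α (q.1.2 + q.2.2) : ℝ) : ℂ)

end ConeWave

end

/-!
A Laplace transform in `t` replaces `W(t) = sin(t√Δ)/√Δ` by the resolvent `R = (s² + Δ)⁻¹` and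
`δ(t - r₁ - r₂)` by `e^{-s(r₁ + r₂)}`. After pairing with test functions both sides of the claimed
identity are continuous in `t` and grow at most linearly, so by uniqueness of Laplace transforms
(`eq_zero_of_laplace_eq_zero`) it suffices to show, for every `s > 0`, that `[X, R]` has the
Schwartz kernel

  `e^{-s(r₁ + r₂)} cos((θ₁ + θ₂)/2 - α) / (4π √(r₁ r₂))`.

This kernel has rank two: it is a combination of `v(q₁) v(q₂)` for the two functions
`v = r^{-1/2} e^{-sr} e^{±iθ/2}`, which lie in `L²`.

Since `R` maps `L²` into the form domain, `X R` is bounded on `L²`. Integration by parts against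
test functions, together with the symmetry of `R`, therefore extends `[X, R]` to the bounded
bilinear form `(f, g) ↦ ∫ X(R f) g + ∫ f X(R g)` on `L²`, and the identity needs to be checked only
for `f` and `g` in a set with dense span (`commutatorForm_eq_kernelForm`). Such a set is given by
the functions `(s² + Δ) u` with `u` in the core

  `u = r^m e^{-λr²} e^{ikθ/2}`, `m = |k|/2`, `k ∈ ℤ`, `λ > 0`.

* These `u` are in the form domain because the vertex has zero capacity: logarithmic cutoffs
  approximate them by test functions (`modeJet_mem_formDomain`). Integration by parts then shows
  that `R` applied to the explicit function `(s² + Δ) u` is `u` (`formResolvent_coreSource`).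
* The functions `(s² + Δ) u` are complete (`eq_zero_of_integral_coreLap_eq_zero`): the Gaussian
  transform `λ ↦ ∫ u h dS` of an `h` orthogonal to all of them satisfies a first order linear
  differential equation whose only solution of admissible growth at `λ = 0` is zero, and an `h`
  orthogonal to all `u` vanishes by Weierstrass approximation in `e^{-r²}` and Fourier
  series in `θ`.
* A constant vector field shifts `k` by `±2`, so on a pair of modes the form is zero unless
  `k + l = ±2`. In that case its integrand is an exact derivative, and what is left is a boundary
  term at the vertex (`integral_coreRaise_add`), which is nonzero only for `k = l = ±1`, that is for
  the modes `r^{1/2} e^{±iθ/2}`, whose gradient is unbounded at the vertex. The rank two form takes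
  the same value, because pairing `(s² + Δ) u` with `r^{-1/2} e^{-sr} e^{∓iθ/2}` extracts the
  coefficient of `r^{1/2} e^{±iθ/2}` in `u` (`integral_decay_mul_coreLap`).
-/

noncomputable section

namespace ConeWave

/-! ### Uniqueness for Laplace transforms -/

/-- An integrable function all of whose moments against `e^{-nτ}` vanish is zero. The function
`σ` is the inverse of the phase `τ`, so that `x = e^{-τ(r)} ∈ [0, 1]` may be used as the variable:
the hypothesis kills all polynomials in `x`, and these are uniformly dense by Weierstrass. -/
theorem ae_eq_zero_of_exp_moments {μ : Measure ℝ} {τ σ : ℝ → ℝ} (hτ : Continuous τ)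
    (hτ0 : ∀ r, 0 < r → 0 ≤ τ r) (hσ : Continuous σ)
    (hσ' : Filter.Tendsto σ Filter.atTop Filter.atTop) (hστ : ∀ r, 0 < r → σ (τ r) = r)
    {f : ℝ → ℂ} (hf : IntegrableOn f (Ioi 0) μ)
    (h : ∀ n : ℕ, ∫ r in Ioi 0, (Real.exp (-(n * τ r)) : ℂ) * f r ∂μ = 0) :
    ∀ᵐ r ∂μ.restrict (Ioi 0), f r = 0 := by
  refine ae_eq_zero_of_integral_contDiff_smul_eq_zero hf.locallyIntegrable
    fun η hη hηc => ?_
  -- The test function `η` in the variable `x = e^{-τ(r)}`. Since `η` has compact support and `σ`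
  -- tends to infinity, `Q` vanishes near `x = 0`.
  set Q : ℝ → ℝ := fun x => if x = 0 then 0 else η (σ (-Real.log x)) with hQ
  have hQc : Continuous Q := by
    refine continuous_iff_continuousAt.2 fun x => ?_
    rcases eq_or_ne x 0 with rfl | hx
    · have h1 : Filter.Tendsto (fun x : ℝ => σ (-Real.log x)) (nhdsWithin 0 {0}ᶜ)
          Filter.atTop :=
        hσ'.comp (Filter.tendsto_neg_atBot_atTop.comp Real.tendsto_log_nhdsNE_zero)
      have h2 : ∀ᶠ y in Filter.atTop, η y = 0 := by
        obtain ⟨M, hM⟩ := hηc.isBounded.subset_closedBall 0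
        filter_upwards [Filter.eventually_gt_atTop M] with y hy
        refine image_eq_zero_of_notMem_tsupport fun hy' => ?_
        have := hM hy'
        rw [mem_closedBall_zero_iff, Real.norm_eq_abs] at this
        exact absurd ((le_abs_self y).trans this) (not_le.2 hy)
      have h3 : Q =ᶠ[nhds 0] fun _ => (0 : ℝ) := by
        have := eventually_nhdsWithin_iff.1 (h1.eventually h2)
        filter_upwards [this] with y hy
        by_cases h0 : y = 0
        · simp [hQ, h0]
        · simp only [hQ, if_neg h0]
          exact hy h0
      exact continuousAt_const.congr h3.symm
    · have h1 : Q =ᶠ[nhds x] fun x => η (σ (-Real.log x)) := by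
        filter_upwards [isOpen_ne.mem_nhds hx] with y hy
        simp only [hQ, if_neg hy]
      refine ContinuousAt.congr ?_ h1.symm
      exact hη.continuous.continuousAt.comp (hσ.continuousAt.comp
        (Real.continuousAt_log hx).neg)
  have hQe : ∀ r, 0 < r → Q (Real.exp (-τ r)) = η r := by
    intro r hr
    simp only [hQ, if_neg (Real.exp_pos _).ne', Real.log_exp, neg_neg, hστ r hr]
  have hem : Continuous fun r => Real.exp (-τ r) := by fun_prop
  have hpoly : ∀ p : Polynomial ℝ,
      IntegrableOn (fun r => p.eval (Real.exp (-τ r)) • f r) (Ioi 0) μ ∧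
      ∫ r in Ioi 0, p.eval (Real.exp (-τ r)) • f r ∂μ = 0 := by
    intro p
    induction p using Polynomial.induction_on' with
    | add p q hp hq =>
      simp only [Polynomial.eval_add, add_smul]
      exact ⟨hp.1.add hq.1, by rw [integral_add hp.1 hq.1, hp.2, hq.2, add_zero]⟩
    | monomial n a =>
      have e : ∀ r, (Polynomial.monomial n a).eval (Real.exp (-τ r)) • f r =
          (a : ℂ) * ((Real.exp (-(n * τ r)) : ℂ) * f r) := by
        intro r
        rw [Polynomial.eval_monomial, ← Real.exp_nat_mul, Complex.real_smul]
        push_cast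
        rw [mul_neg, mul_assoc]
      simp only [e]
      refine ⟨Integrable.const_mul ?_ _, by rw [integral_const_mul, h n, mul_zero]⟩
      refine Integrable.bdd_mul (c := 1) hf ?_ ?_
      · exact (Complex.continuous_ofReal.comp (by fun_prop)).aestronglyMeasurable
      · filter_upwards [ae_restrict_mem measurableSet_Ioi] with r hr
        rw [Complex.norm_real, Real.norm_eq_abs, Real.abs_exp]
        refine Real.exp_le_one_iff.2 ?_
        have := mul_nonneg (Nat.cast_nonneg (α := ℝ) n) (hτ0 r hr)
        linarith
  have hη0 : IntegrableOn (fun r => η r • f r) (Ioi 0) μ := by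
    obtain ⟨M, hM⟩ := hηc.exists_bound_of_continuous hη.continuous
    exact Integrable.bdd_smul hf M hη.continuous.aestronglyMeasurable
      (Filter.Eventually.of_forall hM)
  refine norm_le_zero_iff.1 (le_of_forall_pos_le_add fun ε hε => ?_)
  set I := ∫ r in Ioi 0, ‖f r‖ ∂μ with hI
  have hI0 : 0 ≤ I := integral_nonneg fun _ => norm_nonneg _
  obtain ⟨p, hp⟩ := exists_polynomial_near_of_continuousOn 0 1 Q hQc.continuousOn (ε / (I + 1))
    (by positivity)
  have h1 : ∫ r in Ioi 0, η r • f r ∂μ =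
      ∫ r in Ioi 0, (η r • f r - p.eval (Real.exp (-τ r)) • f r) ∂μ := by
    rw [integral_sub hη0 (hpoly p).1, (hpoly p).2, sub_zero]
  calc _ ≤ ∫ r in Ioi 0, ε / (I + 1) * ‖f r‖ ∂μ := by
        rw [h1]
        refine norm_integral_le_of_norm_le (hf.norm.const_mul _) ?_
        filter_upwards [ae_restrict_mem measurableSet_Ioi] with r hr
        rw [← sub_smul, norm_smul, ← hQe r hr, Real.norm_eq_abs, abs_sub_comm]
        refine mul_le_mul_of_nonneg_right (hp _ ⟨(Real.exp_pos _).le, ?_⟩).le (norm_nonneg _)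
        exact Real.exp_le_one_iff.2 (neg_nonpos.2 (hτ0 r hr))
    _ = ε * (I / (I + 1)) := by rw [integral_const_mul]; ring
    _ ≤ 0 + ε := by
        rw [zero_add]
        refine mul_le_of_le_one_right hε.le ((div_le_one (by positivity)).2 (by linarith))

theorem integrableOn_exp_mul_of_linear_growth {D : ℝ → ℂ} (hD : Continuous D) {C : ℝ}
    (hC : ∀ t, 0 < t → ‖D t‖ ≤ C * (1 + t)) {s : ℝ} (hs : 0 < s) :
    IntegrableOn (fun t => (Real.exp (-(s * t)) : ℂ) * D t) (Ioi 0) := by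
  have h1 : IntegrableOn
      (fun t : ℝ => C * (Real.exp (-(s * t)) + t * Real.exp (-(s * t)))) (Ioi 0) := by
    refine Integrable.const_mul (Integrable.add ?_ ?_) _
    · have := integrableOn_rpow_mul_exp_neg_mul_rpow (s := 0) (p := 1) (b := s) (by norm_num)
        (by norm_num) hs
      simpa [IntegrableOn] using this
    · have := integrableOn_rpow_mul_exp_neg_mul_rpow (s := 1) (p := 1) (b := s) (by norm_num)
        (by norm_num) hs
      simpa [IntegrableOn] using this
  refine Integrable.mono' h1 (Continuous.aestronglyMeasurable (by fun_prop)) ?_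
  filter_upwards [ae_restrict_mem measurableSet_Ioi] with r hr
  rw [norm_mul, Complex.norm_real, Real.norm_eq_abs, Real.abs_exp]
  calc _ ≤ Real.exp (-(s * r)) * (C * (1 + r)) :=
        mul_le_mul_of_nonneg_left (hC r hr) (Real.exp_pos _).le
    _ = _ := by ring

/-- A function that is continuous on `ℝ`, of at most linear growth, and whose Laplace transform
vanishes on `(0, ∞)` is zero on `(0, ∞)`. -/
theorem eq_zero_of_laplace_eq_zero {D : ℝ → ℂ} (hD : Continuous D) {C : ℝ}
    (hC : ∀ t, 0 < t → ‖D t‖ ≤ C * (1 + t))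
    (h : ∀ s : ℝ, 0 < s → ∫ t in Ioi 0, (Real.exp (-(s * t)) : ℂ) * D t = 0) {t : ℝ}
    (ht : 0 < t) : D t = 0 := by
  have hint : IntegrableOn (fun t => (Real.exp (-t) : ℂ) * D t) (Ioi 0) := by
    simpa only [one_mul] using integrableOn_exp_mul_of_linear_growth hD hC one_pos
  -- The transform at `s = n + 1` is the `n`-th moment of `e^{-t} D(t)`.
  have h0 := ae_eq_zero_of_exp_moments (μ := volume) (τ := id) (σ := id) continuous_id
    (fun r hr => hr.le) continuous_id Filter.tendsto_id (fun _ _ => rfl) hint (fun n => by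
      rw [← h (n + 1) (by positivity)]
      refine integral_congr_ae (Filter.Eventually.of_forall fun r => ?_)
      change (Real.exp (-(n * r)) : ℂ) * ((Real.exp (-r) : ℂ) * D r) = _
      rw [← mul_assoc, ← Complex.ofReal_mul, ← Real.exp_add]
      congr 3
      ring)
  have h1 : ∀ᵐ r ∂volume.restrict (Ioi (0 : ℝ)), D r = 0 := by
    filter_upwards [h0] with r hr
    have h2 : (Real.exp (-r) : ℂ) ≠ 0 := by exact_mod_cast (Real.exp_pos (-r)).ne'
    exact (mul_eq_zero.1 hr).resolve_left h2
  have h2 := Measure.eqOn_open_of_ae_eq (g := fun _ => (0 : ℂ)) h1 isOpen_Ioi hD.continuousOn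
    continuousOn_const
  exact h2 ht

/-! ### The scalar sine propagator and its Laplace transform -/

theorem hasDerivAt_mul_sinc (w t : ℝ) :
    HasDerivAt (fun t => t * Real.sinc (t * w)) (Real.cos (t * w)) t := by
  rcases eq_or_ne w 0 with rfl | hw
  · simpa using hasDerivAt_id' t
  · have e : (fun t => t * Real.sinc (t * w)) = fun t => Real.sin (t * w) / w := by
      funext t
      rcases eq_or_ne t 0 with rfl | ht
      · simp
      · rw [Real.sinc_of_ne_zero (mul_ne_zero ht hw)]
        field_simp
    rw [e]
    have := (((hasDerivAt_id t).mul_const w).sin).div_const w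
    simpa [hw] using this

theorem abs_mul_sinc_sub_le (w t t' : ℝ) :
    |t * Real.sinc (t * w) - t' * Real.sinc (t' * w)| ≤ |t - t'| := by
  have := Convex.norm_image_sub_le_of_norm_hasDerivWithin_le (s := univ) (x := t') (y := t)
    (fun x _ => (hasDerivAt_mul_sinc w x).hasDerivWithinAt) (C := 1)
    (fun x _ => by simpa using Real.abs_cos_le_one (x * w)) convex_univ (mem_univ _) (mem_univ _)
  simpa using this

/-- The Laplace transform of `sin(wt)/w` is `1/(s² + w²)`, including `w = 0`. -/
theorem integral_exp_mul_sinc (w : ℝ) {s : ℝ} (hs : 0 < s) :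
    ∫ t in Ioi (0 : ℝ), Real.exp (-(s * t)) * (t * Real.sinc (t * w)) = 1 / (s ^ 2 + w ^ 2) := by
  have hpos : 0 < s ^ 2 + w ^ 2 := by positivity
  have hb : ∀ t, |t * Real.sinc (t * w)| ≤ |t| := fun t => by
    simpa using abs_mul_sinc_sub_le w t 0
  have hE1 : IntegrableOn (fun t : ℝ => t * Real.exp (-(s * t))) (Ioi 0) := by
    have := integrableOn_rpow_mul_exp_neg_mul_rpow (s := 1) (p := 1) (b := s) (by norm_num)
      (by norm_num) hs
    simpa using this
  have hc : Continuous fun t : ℝ => t * Real.sinc (t * w) := by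
    have := Real.continuous_sinc
    fun_prop
  have hi : IntegrableOn (fun t => Real.exp (-(s * t)) * (t * Real.sinc (t * w))) (Ioi 0) := by
    refine Integrable.mono' hE1 (by fun_prop) ?_
    filter_upwards [ae_restrict_mem measurableSet_Ioi] with t ht
    rw [norm_mul, Real.norm_eq_abs, Real.abs_exp, mul_comm]
    have := hb t
    rw [abs_of_pos (show (0 : ℝ) < t from ht)] at this
    exact mul_le_mul_of_nonneg_right this (Real.exp_pos _).le
  -- A primitive of the integrand.
  set F : ℝ → ℝ := fun t => Real.exp (-(s * t)) *
    (-(s * (t * Real.sinc (t * w))) - Real.cos (t * w)) / (s ^ 2 + w ^ 2) with hF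
  have hsin : ∀ t, w * (t * Real.sinc (t * w)) = Real.sin (t * w) := by
    intro t
    rcases eq_or_ne (t * w) 0 with h | h
    · rw [h]
      simp only [Real.sinc_zero, mul_one, Real.sin_zero]
      rw [mul_comm, h]
    · rw [Real.sinc_of_ne_zero h]
      obtain ⟨h1, h2⟩ := mul_ne_zero_iff.1 h
      field_simp
  have hd : ∀ t ∈ Ioi (0 : ℝ), HasDerivAt F (Real.exp (-(s * t)) * (t * Real.sinc (t * w))) t := by
    intro t _
    have h1 : HasDerivAt (fun t => Real.exp (-(s * t))) (Real.exp (-(s * t)) * (-(s * 1))) t :=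
      (((hasDerivAt_id t).const_mul s).neg).exp
    have h2 := ((hasDerivAt_mul_sinc w t).const_mul s).neg
    have h3 : HasDerivAt (fun t => Real.cos (t * w)) (-Real.sin (t * w) * (1 * w)) t :=
      ((hasDerivAt_id t).mul_const w).cos
    refine ((h1.mul (h2.sub h3)).div_const (s ^ 2 + w ^ 2)).congr_deriv ?_
    rw [← hsin t, div_eq_iff hpos.ne']
    simp only [Pi.neg_apply, Pi.sub_apply]
    ring
  have hF0 : ContinuousWithinAt F (Ici 0) 0 := by
    have : Continuous F := by fun_prop
    exact this.continuousWithinAt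
  have hFl : Filter.Tendsto F Filter.atTop (nhds 0) := by
    have e1 : Filter.Tendsto (fun t : ℝ => t * Real.exp (-(s * t))) Filter.atTop (nhds 0) := by
      have := tendsto_rpow_mul_exp_neg_mul_atTop_nhds_zero 1 s hs
      simpa using this
    have e2 : Filter.Tendsto (fun t : ℝ => Real.exp (-(s * t))) Filter.atTop (nhds 0) := by
      have := tendsto_rpow_mul_exp_neg_mul_atTop_nhds_zero 0 s hs
      simpa using this
    have e3 : Filter.Tendsto (fun t : ℝ => (s * (t * Real.exp (-(s * t))) + Real.exp (-(s * t))) /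
        (s ^ 2 + w ^ 2)) Filter.atTop (nhds 0) := by
      simpa using ((e1.const_mul s).add e2).div_const (s ^ 2 + w ^ 2)
    refine squeeze_zero_norm' ?_ e3
    filter_upwards [Filter.eventually_gt_atTop 0] with t ht
    rw [hF, Real.norm_eq_abs, abs_div, abs_of_pos hpos, abs_mul, Real.abs_exp]
    refine div_le_div_of_nonneg_right ?_ hpos.le
    have h4 := hb t
    rw [abs_of_pos ht] at h4
    have h5 : |-(s * (t * Real.sinc (t * w))) - Real.cos (t * w)| ≤ s * t + 1 := by
      refine (abs_sub _ _).trans ?_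
      rw [abs_neg, abs_mul, abs_of_pos hs]
      exact add_le_add (mul_le_mul_of_nonneg_left h4 hs.le) (Real.abs_cos_le_one _)
    calc _ ≤ Real.exp (-(s * t)) * (s * t + 1) := mul_le_mul_of_nonneg_left h5 (Real.exp_pos _).le
      _ = _ := by ring
  rw [integral_Ioi_of_hasDerivAt_of_tendsto hF0 hd hi hFl]
  simp only [hF]
  simp
  ring

theorem abs_sineSymbol_sub_le (t t' x : ℝ) : |sineSymbol t x - sineSymbol t' x| ≤ |t - t'| := by
  unfold sineSymbol
  split_ifs
  · simp
  · exact abs_mul_sinc_sub_le _ t t'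

theorem abs_sineSymbol_le (t x : ℝ) : |sineSymbol t x| ≤ |t| := by
  have h0 : sineSymbol 0 x = 0 := by simp [sineSymbol]
  simpa [h0] using abs_sineSymbol_sub_le t 0 x

/-- The Laplace transform of the symbol of `W(t)` is that of `(s² + Δ)⁻¹`, written in terms of
`x = (1 + Δ)⁻¹`. -/
theorem integral_exp_mul_sineSymbol {s x : ℝ} (hs : 0 < s) (hx : x ∈ Icc (0 : ℝ) 1) :
    ∫ t in Ioi (0 : ℝ), Real.exp (-(s * t)) * sineSymbol t x = x / (1 + (s ^ 2 - 1) * x) := by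
  rcases eq_or_lt_of_le hx.1 with rfl | h0
  · simp [sineSymbol]
  · simp only [sineSymbol, if_neg h0.ne']
    rw [integral_exp_mul_sinc _ hs, Real.sq_sqrt]
    · field_simp
      congr 1
      ring
    · have := (one_le_inv₀ h0).2 hx.2
      linarith

/-! ### Integration in polar coordinates -/

/-- The measure `r dr` on the half-line, the radial factor of `area`. -/
def radialMeasure : Measure ℝ :=
  (volume.restrict (Ioi (0 : ℝ))).withDensity fun r => ENNReal.ofReal r

instance : IsLocallyFiniteMeasure radialMeasure :=
  IsLocallyFiniteMeasure.withDensity_ofReal continuous_id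

theorem area_eq : area = radialMeasure.prod volume := rfl

theorem integral_radialMeasure {E : Type*} [NormedAddCommGroup E] [NormedSpace ℝ E] (F : ℝ → E) :
    ∫ r, F r ∂radialMeasure = ∫ r in Ioi 0, r • F r := by
  rw [radialMeasure, integral_withDensity_eq_integral_toReal_smul₀ (by fun_prop)
    (Filter.Eventually.of_forall fun _ => ENNReal.ofReal_lt_top)]
  refine setIntegral_congr_fun measurableSet_Ioi fun r hr => ?_
  simp only [ENNReal.toReal_ofReal (le_of_lt hr)]

theorem integrable_radialMeasure_iff {E : Type*} [NormedAddCommGroup E] [NormedSpace ℝ E]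
    {F : ℝ → E} :
    Integrable F radialMeasure ↔ IntegrableOn (fun r => r • F r) (Ioi 0) := by
  rw [radialMeasure, integrable_withDensity_iff_integrable_smul₀' (by fun_prop)
    (Filter.Eventually.of_forall fun _ => ENNReal.ofReal_lt_top)]
  refine integrable_congr ?_
  filter_upwards [ae_restrict_mem measurableSet_Ioi] with r hr
  rw [ENNReal.toReal_ofReal (le_of_lt hr)]

theorem ae_radialMeasure_pos : ∀ᵐ r ∂radialMeasure, 0 < r :=
  (withDensity_absolutelyContinuous _ _).ae_le (ae_restrict_mem measurableSet_Ioi)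

theorem radialMeasure_restrict : radialMeasure.restrict (Ioi 0) = radialMeasure :=
  Measure.restrict_eq_self_of_ae_mem ae_radialMeasure_pos

theorem ae_area_pos : ∀ᵐ q ∂area, 0 < q.1 :=
  Measure.quasiMeasurePreserving_fst.ae ae_radialMeasure_pos

theorem integral_area {F : Cone → ℂ} (hF : Integrable F area) :
    ∫ q, F q ∂area = ∫ θ : Angle, ∫ r in Ioi 0, r • F (r, θ) := by
  refine (integral_prod_symm F hF).trans ?_
  change ∫ θ : Angle, ∫ r, F (r, θ) ∂radialMeasure = _
  simp only [integral_radialMeasure]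

theorem integral_area_symm {F : Cone → ℂ} (hF : Integrable F area) :
    ∫ q, F q ∂area = ∫ r, (∫ θ : Angle, F (r, θ)) ∂radialMeasure :=
  integral_prod F hF

theorem IsTest.integrable {f : Cone → ℂ} (hf : IsTest f) : Integrable f area :=
  hf.continuous.integrable_of_hasCompactSupport hf.compact

theorem IsTest.eq_zero {f : Cone → ℂ} (hf : IsTest f) {q : Cone} (hq : q.1 ≤ 0) : f q = 0 :=
  image_eq_zero_of_notMem_tsupport fun h => absurd (hf.support h) (not_lt.2 hq)

theorem IsTest.hasDerivAt_dr {f : Cone → ℂ} (hf : IsTest f) (q : Cone) :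
    HasDerivAt (fun s : ℝ => f (s, q.2)) (ConeWave.dr f q) q.1 := by
  obtain ⟨r, θ⟩ := q
  obtain ⟨θ, rfl⟩ := QuotientAddGroup.mk_surjective θ
  have h1 : DifferentiableAt ℝ (fun s : ℝ => lift f (s, θ)) r :=
    ((hf.smooth.differentiable (by simp)).comp (by fun_prop : Differentiable ℝ
      fun s : ℝ => (s, θ))).differentiableAt
  exact h1.hasDerivAt

theorem IsTest.hasDerivAt_dθ {f : Cone → ℂ} (hf : IsTest f) (q : Cone) :
    HasDerivAt (fun s : ℝ => f (q.1, q.2 + (s : Angle))) (ConeWave.dθ f q) 0 := by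
  obtain ⟨r, θ⟩ := q
  obtain ⟨θ, rfl⟩ := QuotientAddGroup.mk_surjective θ
  have h1 : DifferentiableAt ℝ (fun s : ℝ => lift f (r, θ + s)) 0 :=
    ((hf.smooth.differentiable (by simp)).comp (by fun_prop : Differentiable ℝ
      fun s : ℝ => (r, θ + s))).differentiableAt
  exact h1.hasDerivAt

/-- The divergence theorem in the radial direction. -/
theorem IsTest.integral_dr_add {f : Cone → ℂ} (hf : IsTest f) :
    ∫ q, (ConeWave.dr f q + ((1 / q.1 : ℝ) : ℂ) * f q) ∂area = 0 := by
  have hf' : IsTest fun q => ((1 / q.1 : ℝ) : ℂ) * f q := by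
    refine hf.mul (g := fun q => ((1 / q.1 : ℝ) : ℂ)) fun p hp => ?_
    have h : ContDiffAt ℝ ∞ (fun p : ℝ × ℝ => 1 / p.1) p :=
      contDiffAt_const.div contDiffAt_fst hp.ne'
    exact Complex.ofRealCLM.contDiff.contDiffAt.comp p h
  rw [integral_area (hf.dr.integrable.fun_add hf'.integrable)]
  refine integral_eq_zero_of_ae (Filter.Eventually.of_forall fun θ => ?_)
  have hc : HasCompactSupport fun r : ℝ => f (r, θ) := by
    refine HasCompactSupport.intro (hf.compact.image continuous_fst) fun r hr => ?_
    exact image_eq_zero_of_notMem_tsupport fun h => hr ⟨_, h, rfl⟩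
  have hc' : HasCompactSupport fun r : ℝ => ConeWave.dr f (r, θ) := by
    refine HasCompactSupport.intro (hf.dr.compact.image continuous_fst) fun r hr => ?_
    exact image_eq_zero_of_notMem_tsupport fun h => hr ⟨_, h, rfl⟩
  have hcf := hf.continuous
  have hcd := hf.dr.continuous
  have hd : ∀ r : ℝ, HasDerivAt (fun r : ℝ => (r : ℂ) * f (r, θ))
      (f (r, θ) + r * ConeWave.dr f (r, θ)) r := by
    intro r
    have := (hasDerivAt_id' r).ofReal_comp.fun_mul (hf.hasDerivAt_dr (r, θ))
    simpa only [Complex.ofReal_one, one_mul] using this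
  have hi1 : Integrable fun r : ℝ => f (r, θ) :=
    Continuous.integrable_of_hasCompactSupport (by fun_prop) hc
  have hi2 : Integrable fun r : ℝ => (r : ℂ) * f (r, θ) :=
    Continuous.integrable_of_hasCompactSupport (by fun_prop) hc.mul_left
  have hi3 : Integrable fun r : ℝ => (r : ℂ) * ConeWave.dr f (r, θ) :=
    Continuous.integrable_of_hasCompactSupport (by fun_prop) hc'.mul_left
  have h0 := integral_eq_zero_of_hasDerivAt_of_integrable hd (hi1.add hi3) hi2
  have h1 : ∫ r in Ioi (0 : ℝ), (f (r, θ) + r * ConeWave.dr f (r, θ)) = 0 := by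
    rw [← h0]
    refine setIntegral_eq_integral_of_forall_compl_eq_zero fun r hr => ?_
    have hr' : ((r, θ) : Cone).1 ≤ 0 := not_lt.1 hr
    rw [hf.eq_zero hr', hf.dr.eq_zero hr', mul_zero, add_zero]
  refine Eq.trans ?_ h1
  refine setIntegral_congr_fun measurableSet_Ioi fun r hr => ?_
  have hr' : (r : ℂ) ≠ 0 := by exact_mod_cast (ne_of_gt hr)
  simp only [Complex.real_smul]
  push_cast
  field_simp
  ring

/-- The divergence theorem in the angular direction. -/
theorem IsTest.integral_dθ {f : Cone → ℂ} (hf : IsTest f) :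
    ∫ q, ConeWave.dθ f q ∂area = 0 := by
  rw [integral_area_symm hf.dθ.integrable]
  refine integral_eq_zero_of_ae (Filter.Eventually.of_forall fun r => ?_)
  have hd : ∀ x : ℝ, HasDerivAt (fun s : ℝ => f (r, (s : Angle)))
      (ConeWave.dθ f (r, (x : Angle))) x := by
    intro x
    have h1 := hf.hasDerivAt_dθ (r, (x : Angle))
    rw [← sub_self x] at h1
    have h2 := h1.comp_sub_const x x
    refine h2.congr_of_eventuallyEq (Filter.Eventually.of_forall fun s => ?_)
    change f (r, _) = f (r, _)
    rw [← AddCircle.coe_add]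
    simp
  have hcd := hf.dθ.continuous
  have hc : Continuous fun s : ℝ => ConeWave.dθ f (r, (s : Angle)) :=
    hcd.comp (continuous_const.prodMk (AddCircle.continuous_mk' _))
  change ∫ b : Angle, ConeWave.dθ f (r, b) = 0
  rw [← AddCircle.intervalIntegral_preimage (4 * Real.pi) 0,
    intervalIntegral.integral_eq_sub_of_hasDerivAt (fun x _ => hd x) (hc.intervalIntegrable _ _)]
  simp only [AddCircle.coe_add, AddCircle.coe_period, add_zero, sub_self]

/-! ### Angular modes -/

/-- The function `a(r) e^{ikθ/2}` on the cone. -/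
def mode (k : ℤ) (a : ℝ → ℝ) : Cone → ℂ := fun q => (a q.1 : ℂ) * fourier k q.2

theorem norm_mode (k : ℤ) (a : ℝ → ℝ) (q : Cone) : ‖mode k a q‖ = |a q.1| := by
  rw [mode, norm_mul, Complex.norm_real, Real.norm_eq_abs, fourier_apply, Circle.norm_coe, mul_one]

theorem mode_mul_mode (k l : ℤ) (a b : ℝ → ℝ) (q : Cone) :
    mode k a q * mode l b q = mode (k + l) (fun r => a r * b r) q := by
  simp only [mode, fourier_add]
  push_cast
  ring

theorem conj_mode (k : ℤ) (a : ℝ → ℝ) (q : Cone) :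
    (starRingEnd ℂ) (mode k a q) = mode (-k) a q := by
  simp only [mode, map_mul, Complex.conj_ofReal, fourier_neg]

theorem integral_fourier (k : ℤ) :
    ∫ θ : Angle, fourier k θ = if k = 0 then ((4 * Real.pi : ℝ) : ℂ) else 0 := by
  split_ifs with hk
  · subst hk
    simp [Measure.real, AddCircle.measure_univ, Real.pi_pos.le]
  · exact integral_eq_zero_of_add_right_eq_neg
      (fourier_add_half_inv_index hk (by positivity : 0 < 4 * Real.pi))

theorem integral_mode (k : ℤ) (a : ℝ → ℝ) :
    ∫ q, mode k a q ∂area =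
      if k = 0 then ((4 * Real.pi * ∫ r in Ioi 0, r * a r : ℝ) : ℂ) else 0 := by
  have h := integral_prod_mul (μ := radialMeasure) (ν := (volume : Measure Angle))
    (fun r => (a r : ℂ)) (fun θ => fourier k θ)
  rw [← area_eq, integral_fourier] at h
  refine h.trans ?_
  split_ifs
  · have : ∫ r, (a r : ℂ) ∂radialMeasure = ((∫ r, a r ∂radialMeasure : ℝ) : ℂ) := integral_ofReal
    rw [this, integral_radialMeasure]
    push_cast
    simp only [smul_eq_mul]
    ring
  · rw [mul_zero]

theorem integral_mode_mul_mode (k l : ℤ) (a b : ℝ → ℝ) :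
    ∫ q, mode k a q * mode l b q ∂area =
      if k + l = 0 then ((4 * Real.pi * ∫ r in Ioi 0, r * (a r * b r) : ℝ) : ℂ) else 0 := by
  simp only [mode_mul_mode, integral_mode]

theorem aestronglyMeasurable_mode (k : ℤ) {a : ℝ → ℝ} (ha : Measurable a) :
    AEStronglyMeasurable (mode k a) area := by
  have h1 : Measurable fun q : Cone => (a q.1 : ℂ) :=
    Complex.measurable_ofReal.comp (ha.comp measurable_fst)
  have h2 : Measurable fun q : Cone => fourier k q.2 :=
    (fourier k).continuous.measurable.comp measurable_snd
  exact (h1.mul h2).aestronglyMeasurable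

theorem memLp_mode (k : ℤ) {a : ℝ → ℝ} (ha : Measurable a)
    (h : IntegrableOn (fun r => r * a r ^ 2) (Ioi 0)) : MemLp (mode k a) 2 area := by
  rw [memLp_two_iff_integrable_sq_norm (aestronglyMeasurable_mode k ha)]
  simp only [norm_mode, sq_abs]
  have h1 : Integrable (fun r => a r ^ 2) radialMeasure := integrable_radialMeasure_iff.2 h
  exact h1.comp_fst volume

theorem contDiffAt_lift_mode (k : ℤ) {a : ℝ → ℝ} {p : ℝ × ℝ} (ha : ContDiffAt ℝ ∞ a p.1) :
    ContDiffAt ℝ ∞ (lift (mode k a)) p := by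
  have h1 : ContDiffAt ℝ ∞ (fun p : ℝ × ℝ => (a p.1 : ℂ)) p :=
    Complex.ofRealCLM.contDiff.contDiffAt.comp p (ha.comp p contDiffAt_fst)
  have h2 : ContDiff ℝ ∞ (fun p : ℝ × ℝ => fourier k (p.2 : Angle)) := by
    simp only [fourier_coe_apply]
    have : ContDiff ℝ ∞ fun p : ℝ × ℝ => (p.2 : ℂ) :=
      Complex.ofRealCLM.contDiff.comp contDiff_snd
    exact ((contDiff_const.mul this).div_const _).cexp
  exact h1.mul h2.contDiffAt

theorem hasDerivAt_fourier_add (k : ℤ) (θ : Angle) :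
    HasDerivAt (fun s : ℝ => fourier k (θ + (s : Angle)))
      (Complex.I * (k / 2 : ℝ) * fourier k θ) 0 := by
  have e : ∀ s : ℝ, fourier k (θ + (s : Angle)) = fourier k θ * fourier k (s : Angle) := by
    intro s
    simp only [fourier_apply, zsmul_add, AddCircle.toCircle_add, Circle.coe_mul]
  simp only [e]
  have h := (hasDerivAt_fourier (4 * Real.pi) k 0).const_mul (fourier k θ)
  refine h.congr_deriv ?_
  have hpi : (Real.pi : ℂ) ≠ 0 := by exact_mod_cast Real.pi_ne_zero
  have e0 : fourier k ((0 : ℝ) : Angle) = 1 := by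
    rw [AddCircle.coe_zero, fourier_eval_zero]
  rw [e0]
  push_cast
  field_simp
  ring

theorem dr_mode_mul {z : Cone → ℂ} (hz : IsTest z) (k : ℤ) {a : ℝ → ℝ} {a' : ℝ} {q : Cone}
    (ha : HasDerivAt a a' q.1) :
    dr (fun q => mode k a q * z q) q =
      mode k (fun _ => a') q * z q + mode k a q * dr z q := by
  have h1 : HasDerivAt (fun s : ℝ => mode k a (s, q.2)) (mode k (fun _ => a') q) q.1 :=
    ha.ofReal_comp.mul_const (fourier k q.2)
  exact (h1.mul (hz.hasDerivAt_dr q)).deriv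

theorem dθ_mode_mul {z : Cone → ℂ} (hz : IsTest z) (k : ℤ) (a : ℝ → ℝ) (q : Cone) :
    dθ (fun q => mode k a q * z q) q =
      Complex.I * (k / 2 : ℝ) * mode k a q * z q + mode k a q * dθ z q := by
  have h1 : HasDerivAt (fun s : ℝ => mode k a (q.1, q.2 + (s : Angle)))
      (Complex.I * (k / 2 : ℝ) * mode k a q) 0 := by
    refine ((hasDerivAt_fourier_add k q.2).const_mul (a q.1 : ℂ)).congr_deriv ?_
    rw [mode]
    ring
  refine (h1.mul (hz.hasDerivAt_dθ q)).deriv.trans ?_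
  simp

theorem IsTest.mode_mul {z : Cone → ℂ} (hz : IsTest z) (k : ℤ) {a : ℝ → ℝ}
    (ha : ContDiffOn ℝ ∞ a (Ioi 0)) : IsTest fun q => mode k a q * z q :=
  hz.mul fun _ hp => contDiffAt_lift_mode k (ha.contDiffAt (Ioi_mem_nhds hp))

/-- Integration by parts in `r` of a mode against a test function. -/
theorem integral_mode_mul_dr {z : Cone → ℂ} (hz : IsTest z) (k : ℤ) {a a' : ℝ → ℝ}
    (ha : ContDiffOn ℝ ∞ a (Ioi 0)) (ha' : ContDiffOn ℝ ∞ a' (Ioi 0))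
    (hd : ∀ r, 0 < r → HasDerivAt a (a' r) r) :
    ∫ q, mode k a q * dr z q ∂area =
      -∫ q, mode k (fun r => a' r + a r / r) q * z q ∂area := by
  have hb : ContDiffOn ℝ ∞ (fun r => a' r + a r / r) (Ioi 0) :=
    ha'.add (ha.div contDiffOn_id fun r hr => ne_of_gt hr)
  have h0 := (hz.mode_mul k ha).integral_dr_add
  rw [eq_neg_iff_add_eq_zero, ← integral_add (hz.dr.mode_mul k ha).integrable
    (hz.mode_mul k hb).integrable, ← h0]
  refine integral_congr_ae ?_
  filter_upwards [ae_area_pos] with q hq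
  rw [dr_mode_mul hz k (hd q.1 hq)]
  simp only [mode]
  push_cast
  ring

/-- Integration by parts in `θ` of a mode against a test function. -/
theorem integral_mode_mul_dθ {z : Cone → ℂ} (hz : IsTest z) (k : ℤ) {a : ℝ → ℝ}
    (ha : ContDiffOn ℝ ∞ a (Ioi 0)) :
    ∫ q, mode k a q * dθ z q ∂area =
      -(Complex.I * (k / 2 : ℝ) * ∫ q, mode k a q * z q ∂area) := by
  have h0 := (hz.mode_mul k ha).integral_dθ
  rw [eq_neg_iff_add_eq_zero, ← integral_const_mul,
    ← integral_add (hz.dθ.mode_mul k ha).integrable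
      ((hz.mode_mul k ha).integrable.const_mul _), ← h0]
  refine integral_congr_ae (Filter.Eventually.of_forall fun q => ?_)
  simp only
  rw [dθ_mode_mul hz k a]
  ring

/-! ### The constant vector fields in terms of modes -/

theorem cosAngle_eq (α : ℝ) (θ : Angle) : (cosAngle α θ : ℂ) =
    (Complex.exp (-(Complex.I * α)) * fourier 2 θ + Complex.exp (Complex.I * α) * fourier (-2) θ)
      / 2 := by
  obtain ⟨x, rfl⟩ := QuotientAddGroup.mk_surjective θ
  have h : cosAngle α (x : Angle) = Real.cos (x - α) := rfl
  change (cosAngle α (x : Angle) : ℂ) =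
    (_ * fourier 2 (x : Angle) + _ * fourier (-2) (x : Angle)) / 2
  have hpi : (Real.pi : ℂ) ≠ 0 := by exact_mod_cast Real.pi_ne_zero
  rw [h, fourier_coe_apply, fourier_coe_apply, ← Complex.exp_add, ← Complex.exp_add,
    Complex.ofReal_cos, Complex.cos]
  congr 3
  · push_cast; field_simp; ring_nf
  · push_cast; field_simp; ring_nf

theorem sinAngle_eq (α : ℝ) (θ : Angle) : (sinAngle α θ : ℂ) =
    (Complex.exp (-(Complex.I * α)) * fourier 2 θ - Complex.exp (Complex.I * α) * fourier (-2) θ)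
      / (2 * Complex.I) := by
  obtain ⟨x, rfl⟩ := QuotientAddGroup.mk_surjective θ
  have h : sinAngle α (x : Angle) = Real.sin (x - α) := rfl
  change (sinAngle α (x : Angle) : ℂ) =
    (_ * fourier 2 (x : Angle) - _ * fourier (-2) (x : Angle)) / _
  have hpi : (Real.pi : ℂ) ≠ 0 := by exact_mod_cast Real.pi_ne_zero
  have e1 : Complex.exp (-(Complex.I * α)) * fourier 2 (x : Angle) =
      Complex.exp (((x - α : ℝ) : ℂ) * Complex.I) := by
    rw [fourier_coe_apply, ← Complex.exp_add]
    congr 1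
    push_cast; field_simp; ring_nf
  have e2 : Complex.exp (Complex.I * α) * fourier (-2) (x : Angle) =
      Complex.exp (-((x - α : ℝ) : ℂ) * Complex.I) := by
    rw [fourier_coe_apply, ← Complex.exp_add]
    congr 1
    push_cast; field_simp; ring_nf
  rw [h, e1, e2, Complex.ofReal_sin, Complex.sin]
  field_simp
  ring_nf
  simp only [Complex.I_sq]
  ring

theorem cosHalfAngle_eq (α : ℝ) (θ : Angle) : (cosHalfAngle α θ : ℂ) =
    (Complex.exp (-(Complex.I * α)) * fourier 1 θ + Complex.exp (Complex.I * α) * fourier (-1) θ)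
      / 2 := by
  obtain ⟨x, rfl⟩ := QuotientAddGroup.mk_surjective θ
  have h : cosHalfAngle α (x : Angle) = Real.cos (x / 2 - α) := rfl
  change (cosHalfAngle α (x : Angle) : ℂ) =
    (_ * fourier 1 (x : Angle) + _ * fourier (-1) (x : Angle)) / 2
  have hpi : (Real.pi : ℂ) ≠ 0 := by exact_mod_cast Real.pi_ne_zero
  rw [h, fourier_coe_apply, fourier_coe_apply, ← Complex.exp_add, ← Complex.exp_add,
    Complex.ofReal_cos, Complex.cos]
  congr 3
  · push_cast; field_simp; ring_nf
  · push_cast; field_simp; ring_nf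

/-- Constant vector fields are divergence free. -/
theorem IsTest.integral_X {f : Cone → ℂ} (hf : IsTest f) (α : ℝ) :
    ∫ q, ConeWave.X α f q ∂area = 0 := by
  have h1 : ContDiffOn ℝ ∞ (fun _ : ℝ => (1 : ℝ)) (Ioi 0) := contDiffOn_const
  have h2 : ContDiffOn ℝ ∞ (fun r : ℝ => 1 / r) (Ioi 0) :=
    contDiffOn_const.div contDiffOn_id fun r hr => ne_of_gt hr
  have hr : ∀ k : ℤ, ∫ q, mode k (fun _ => 1) q * ConeWave.dr f q ∂area =
      -∫ q, mode k (fun r => 1 / r) q * f q ∂area := by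
    intro k
    have := integral_mode_mul_dr hf k h1 (a' := fun _ => 0) contDiffOn_const
      (fun r _ => hasDerivAt_const r 1)
    simpa only [zero_add] using this
  have hθ := fun k : ℤ => integral_mode_mul_dθ hf k h2
  have e : ∀ q, ConeWave.X α f q =
      Complex.exp (-(Complex.I * α)) / 2 * (mode 2 (fun _ => 1) q * ConeWave.dr f q) +
      Complex.exp (Complex.I * α) / 2 * (mode (-2) (fun _ => 1) q * ConeWave.dr f q) +
      (Complex.I * Complex.exp (-(Complex.I * α)) / 2 *
        (mode 2 (fun r => 1 / r) q * ConeWave.dθ f q) +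
      -(Complex.I * Complex.exp (Complex.I * α)) / 2 *
        (mode (-2) (fun r => 1 / r) q * ConeWave.dθ f q)) := by
    intro q
    simp only [ConeWave.X, mode]
    push_cast
    rw [cosAngle_eq, sinAngle_eq]
    have hI : (1 : ℂ) / Complex.I = -Complex.I := by simp
    rw [show ∀ a : ℂ, a / (2 * Complex.I) = a / 2 * (1 / Complex.I) by intro a; ring, hI]
    ring
  simp only [e]
  have i1 := fun k => (hf.dr.mode_mul k h1).integrable
  have i2 := fun k => (hf.dθ.mode_mul k h2).integrable
  rw [integral_add (((i1 2).const_mul _).fun_add ((i1 (-2)).const_mul _))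
      (((i2 2).const_mul _).fun_add ((i2 (-2)).const_mul _)),
    integral_add ((i1 2).const_mul _) ((i1 (-2)).const_mul _),
    integral_add ((i2 2).const_mul _) ((i2 (-2)).const_mul _)]
  simp only [integral_const_mul, hr, hθ]
  push_cast
  ring_nf
  simp only [Complex.I_sq]
  ring

theorem IsTest.mul_test {f g : Cone → ℂ} (hf : IsTest f) (hg : IsTest g) :
    IsTest fun q => f q * g q :=
  hg.mul fun _ _ => hf.smooth.contDiffAt

/-- Integration by parts for a constant vector field. -/
theorem IsTest.integral_X_mul {f g : Cone → ℂ} (hf : IsTest f) (hg : IsTest g) (α : ℝ) :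
    ∫ q, ConeWave.X α f q * g q ∂area = -∫ q, f q * ConeWave.X α g q ∂area := by
  rw [eq_neg_iff_add_eq_zero, ← integral_add ((hf.X α).mul_test hg).integrable
    (hf.mul_test (hg.X α)).integrable, ← (hf.mul_test hg).integral_X α]
  refine integral_congr_ae (Filter.Eventually.of_forall fun q => ?_)
  have h1 : ConeWave.dr (fun q => f q * g q) q = ConeWave.dr f q * g q + f q * ConeWave.dr g q :=
    ((hf.hasDerivAt_dr q).mul (hg.hasDerivAt_dr q)).deriv
  have h2 : ConeWave.dθ (fun q => f q * g q) q =
      ConeWave.dθ f q * g q + f q * ConeWave.dθ g q := by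
    have := ((hf.hasDerivAt_dθ q).mul (hg.hasDerivAt_dθ q)).deriv
    refine this.trans ?_
    simp
  simp only [ConeWave.X, h1, h2]
  ring

/-! ### Logarithmic cutoffs -/

/-- Dominated convergence in `L²`. -/
theorem tendsto_toLp_of_dominated {F : ℕ → Cone → ℂ} {f : Cone → ℂ} {G : Cone → ℝ}
    (hF : ∀ n, MemLp (F n) 2 area) (hf : MemLp f 2 area) (hG : MemLp G 2 area)
    (hb : ∀ n, ∀ᵐ q ∂area, ‖F n q‖ ≤ G q)
    (hl : ∀ᵐ q ∂area, Filter.Tendsto (fun n => F n q) Filter.atTop (nhds (f q))) :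
    Filter.Tendsto (fun n => (hF n).toLp (F n)) Filter.atTop (nhds (hf.toLp f)) := by
  rw [Lp.tendsto_Lp_iff_tendsto_eLpNorm'']
  have e : ∀ n, eLpNorm (F n - f) 2 area =
      (∫⁻ q, ‖F n q - f q‖ₑ ^ (2 : ℝ) ∂area) ^ (1 / (2 : ℝ)) := by
    intro n
    rw [eLpNorm_eq_lintegral_rpow_enorm_toReal (by norm_num) (by norm_num)]
    simp
  simp only [e]
  have h0 : Filter.Tendsto (fun n => ∫⁻ q, ‖F n q - f q‖ₑ ^ (2 : ℝ) ∂area) Filter.atTop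
      (nhds (∫⁻ _, 0 ∂area)) := by
    have hGf : MemLp (fun q => G q + ‖f q‖) 2 area := hG.add hf.norm
    refine tendsto_lintegral_of_dominated_convergence'
      (fun q => ‖G q + ‖f q‖‖ₑ ^ (2 : ℝ)) (fun n => ?_) (fun n => ?_) ?_ ?_
    · exact (((hF n).1.sub hf.1).enorm).pow_const _
    · filter_upwards [hb n] with q hq
      refine ENNReal.rpow_le_rpow ?_ (by norm_num)
      refine enorm_le_iff_norm_le.2 ((norm_sub_le _ _).trans ?_)
      exact (add_le_add_left hq _).trans (Real.le_norm_self _)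
    · have := lintegral_rpow_enorm_lt_top_of_eLpNorm_lt_top (by norm_num) (by norm_num) hGf.2
      simpa using this.ne
    · filter_upwards [hl] with q hq
      have h1 : Filter.Tendsto (fun n => F n q - f q) Filter.atTop (nhds 0) := by
        simpa using hq.sub_const (f q)
      have h2 : Filter.Tendsto (fun n => ‖F n q - f q‖ₑ) Filter.atTop (nhds 0) := by
        simpa using h1.enorm
      have h3 := (ENNReal.continuous_rpow_const (y := 2)).tendsto 0 |>.comp h2
      simpa [Function.comp_def] using h3
  rw [lintegral_zero] at h0
  have h3 := (ENNReal.continuous_rpow_const (y := 1 / 2)).tendsto 0 |>.comp h0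
  simpa [Function.comp_def] using h3

/-- A smooth bump equal to `1` on `[-1, 1]` and supported in `[-2, 2]`. -/
def bump : ContDiffBump (0 : ℝ) := ⟨1, 2, by norm_num, by norm_num⟩

/-- The cutoff `ρ(log r / (n + 1))`. The logarithm makes its Dirichlet energy tend to zero, which
reflects that a point of a surface has zero capacity. -/
def logCutoff (n : ℕ) : ℝ → ℝ := fun r => if 0 < r then bump (Real.log r / (n + 1)) else 0

/-- The derivative of `logCutoff n` on `(0, ∞)`. -/
def logCutoff' (n : ℕ) : ℝ → ℝ := fun r => deriv bump (Real.log r / (n + 1)) * (1 / r / (n + 1))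

theorem logCutoff_eq_zero {n : ℕ} {r : ℝ}
    (hr : r ∉ Icc (Real.exp (-(2 * (n + 1)))) (Real.exp (2 * (n + 1)))) : logCutoff n r = 0 := by
  unfold logCutoff
  split_ifs with h
  · refine bump.zero_of_le_dist ?_
    rw [Real.dist_0_eq_abs, abs_div, abs_of_pos (by positivity : (0 : ℝ) < n + 1),
      le_div_iff₀ (by positivity), le_abs]
    change 2 * ((n : ℝ) + 1) ≤ _ ∨ 2 * ((n : ℝ) + 1) ≤ _
    rw [mem_Icc, not_and_or, not_le, not_le] at hr
    rcases hr with hr | hr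
    · right
      have := (Real.log_lt_log h hr).le
      rw [Real.log_exp] at this
      linarith
    · left
      have := (Real.log_lt_log (Real.exp_pos _) hr).le
      rwa [Real.log_exp] at this
  · rfl

theorem abs_logCutoff_le (n : ℕ) (r : ℝ) : |logCutoff n r| ≤ 1 := by
  unfold logCutoff
  split_ifs
  · rw [abs_of_nonneg bump.nonneg]
    exact bump.le_one
  · simp

theorem contDiff_logCutoff (n : ℕ) : ContDiff ℝ ∞ (logCutoff n) := by
  refine contDiff_iff_contDiffAt.2 fun r => ?_
  rcases lt_or_ge 0 r with hr | hr
  · have h1 : ContDiffAt ℝ ∞ (fun r => bump (Real.log r / (n + 1))) r :=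
      bump.contDiff.contDiffAt.comp r ((Real.contDiffAt_log.2 hr.ne').div_const _)
    refine h1.congr_of_eventuallyEq ?_
    filter_upwards [Ioi_mem_nhds hr] with x hx
    exact if_pos hx
  · refine (contDiffAt_const (c := (0 : ℝ))).congr_of_eventuallyEq ?_
    filter_upwards [Iio_mem_nhds (hr.trans_lt (Real.exp_pos (-(2 * (n + 1)))))] with x hx
    exact logCutoff_eq_zero fun h => absurd h.1 (not_le.2 hx)

theorem hasDerivAt_logCutoff (n : ℕ) {r : ℝ} (hr : 0 < r) :
    HasDerivAt (logCutoff n) (logCutoff' n r) r := by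
  have h1 : HasDerivAt bump (deriv bump (Real.log r / (n + 1))) (Real.log r / (n + 1)) :=
    ((bump.contDiff (n := 1)).differentiable (by simp)).differentiableAt.hasDerivAt
  have h2 : HasDerivAt (fun r => Real.log r / ((n : ℝ) + 1)) (1 / r / (n + 1)) r := by
    simpa using (Real.hasDerivAt_log hr.ne').div_const ((n : ℝ) + 1)
  refine (h1.comp r h2).congr_of_eventuallyEq ?_
  filter_upwards [Ioi_mem_nhds hr] with x hx
  exact if_pos hx

/-- The derivatives of the cutoffs have a common majorant: on the support of `logCutoff' n`,
`n + 1` is at least a multiple of `√(1 + log² r)`. -/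
theorem exists_abs_logCutoff'_le : ∃ M : ℝ, 0 ≤ M ∧ ∀ (n : ℕ) (r : ℝ), 0 < r →
    |logCutoff' n r| ≤ M * (1 / (r * Real.sqrt (1 + Real.log r ^ 2))) := by
  have hb : Continuous (deriv bump) := (bump.contDiff (n := 1)).continuous_deriv (by simp)
  have hs : HasCompactSupport (deriv bump) := bump.hasCompactSupport.deriv
  obtain ⟨M, hM⟩ := hs.exists_bound_of_continuous hb
  have hM0 : 0 ≤ M := (norm_nonneg _).trans (hM 0)
  refine ⟨3 * M, by positivity, fun n r hr => ?_⟩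
  set N : ℝ := n + 1 with hN
  have hN1 : 1 ≤ N := by simp [hN]
  have hsq : 0 < Real.sqrt (1 + Real.log r ^ 2) := Real.sqrt_pos.2 (by positivity)
  unfold logCutoff'
  rw [← hN]
  by_cases h : |Real.log r| ≤ 2 * N
  · have h1 : Real.sqrt (1 + Real.log r ^ 2) ≤ 3 * N := by
      refine (Real.sqrt_le_left (by positivity)).2 ?_
      have := sq_le_sq' (by linarith [abs_nonneg (Real.log r)]) h
      rw [sq_abs] at this
      nlinarith
    rw [abs_mul, abs_of_pos (by positivity : 0 < 1 / r / N)]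
    calc _ ≤ M * (1 / r / N) := mul_le_mul_of_nonneg_right (hM _) (by positivity)
      _ = 3 * M * (1 / (r * (3 * N))) := by field_simp
      _ ≤ _ := by gcongr
  · have h0 : deriv bump (Real.log r / N) = 0 := by
      refine image_eq_zero_of_notMem_tsupport fun h' => h ?_
      have h1 := closure_minimal (support_deriv_subset (f := bump)) isClosed_closure h'
      rw [bump.tsupport_eq, Metric.mem_closedBall, Real.dist_0_eq_abs, abs_div,
        abs_of_pos (by positivity : 0 < N), div_le_iff₀ (by positivity)] at h1
      exact h1
    rw [h0, zero_mul, abs_zero]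
    positivity

theorem eventually_logCutoff {r : ℝ} (hr : 0 < r) :
    ∀ᶠ n : ℕ in Filter.atTop, logCutoff n r = 1 ∧ logCutoff' n r = 0 := by
  filter_upwards [Filter.eventually_ge_atTop ⌈|Real.log r|⌉₊] with n hn
  have h1 : |Real.log r| ≤ n := Nat.ceil_le.1 hn
  have h2 : Real.log r / (n + 1) ∈ Metric.ball (0 : ℝ) bump.rIn := by
    rw [Metric.mem_ball, Real.dist_0_eq_abs, abs_div,
      abs_of_pos (by positivity : (0 : ℝ) < n + 1), div_lt_iff₀ (by positivity)]
    change _ < 1 * _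
    linarith
  constructor
  · rw [logCutoff, if_pos hr]
    exact bump.one_of_mem_closedBall (Metric.ball_subset_closedBall h2)
  · rw [logCutoff', (bump.eventuallyEq_one_of_mem_ball h2).deriv_eq]
    simp

/-- The function `1 / (r √(1 + log² r))`, which dominates all `logCutoff' n` up to a constant, is
square integrable for `r dr`. -/
theorem integrableOn_inv_mul_log :
    IntegrableOn (fun r : ℝ => r * (1 / (r * Real.sqrt (1 + Real.log r ^ 2))) ^ 2) (Ioi 0) := by
  have h := integrableOn_image_iff_integrableOn_abs_deriv_smul (s := univ) MeasurableSet.univ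
    (fun x _ => (Real.hasDerivAt_exp x).hasDerivWithinAt) Real.exp_injective.injOn
    (fun r : ℝ => r * (1 / (r * Real.sqrt (1 + Real.log r ^ 2))) ^ 2)
  rw [image_univ, Real.range_exp] at h
  rw [h, integrableOn_univ]
  refine integrable_inv_one_add_sq.congr (Filter.Eventually.of_forall fun x => ?_)
  simp only [Real.log_exp, Real.abs_exp, smul_eq_mul]
  rw [div_pow, mul_pow, Real.sq_sqrt (by positivity)]
  have := (Real.exp_pos x).ne'
  field_simp

/-- The cutoff as a test function. -/
theorem isTest_logCutoff (n : ℕ) : IsTest (mode 0 (logCutoff n)) := by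
  set K : Set Cone := Icc (Real.exp (-(2 * (n + 1)))) (Real.exp (2 * (n + 1))) ×ˢ univ with hK
  have hKc : IsCompact K := isCompact_Icc.prod isCompact_univ
  have h0 : ∀ q, q ∉ K → mode 0 (logCutoff n) q = 0 := by
    intro q hq
    have : q.1 ∉ Icc (Real.exp (-(2 * (n + 1)))) (Real.exp (2 * ((n : ℝ) + 1))) :=
      fun h => hq ⟨h, mem_univ _⟩
    rw [mode, logCutoff_eq_zero this]
    simp
  refine ⟨contDiff_iff_contDiffAt.2 fun p =>
    contDiffAt_lift_mode 0 (contDiff_logCutoff n).contDiffAt, HasCompactSupport.intro hKc h0, ?_⟩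
  refine (closure_minimal (fun q hq => ?_) hKc.isClosed).trans
    (fun q hq => (Real.exp_pos _).trans_le hq.1.1)
  by_contra hn
  exact hq (h0 q hn)

/-! ### Single modes in the form domain -/

theorem inner_toLp {f g : Cone → ℂ} (hf : MemLp f 2 area) (hg : MemLp g 2 area) :
    ⟪hf.toLp f, hg.toLp g⟫_ℂ = ∫ q, (starRingEnd ℂ) (f q) * g q ∂area := by
  rw [L2.inner_def]
  refine integral_congr_ae ?_
  filter_upwards [hf.coeFn_toLp, hg.coeFn_toLp] with q h1 h2
  rw [h1, h2, RCLike.inner_apply']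

/-- The data `(u, ∂_r u, r⁻¹ ∂_θ u)` of `u = a(r) e^{ikθ/2}`, where `a'` is the derivative
of `a`. -/
def modeJet {k : ℤ} {a a' : ℝ → ℝ} (h0 : MemLp (mode k a) 2 area) (h1 : MemLp (mode k a') 2 area)
    (h2 : MemLp (fun q => Complex.I * mode k (fun r => k / 2 * (a r / r)) q) 2 area) : L2Triple :=
  WithLp.toLp 2 ![h0.toLp _, h1.toLp _, h2.toLp _]

theorem dr_mode_mul_logCutoff (k : ℤ) (n : ℕ) {a : ℝ → ℝ} {a' : ℝ} {q : Cone}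
    (hq : 0 < q.1) (ha : HasDerivAt a a' q.1) :
    dr (fun q => mode k a q * mode 0 (logCutoff n) q) q =
      mode k (fun _ => a') q * logCutoff n q.1 + mode k a q * logCutoff' n q.1 := by
  rw [dr_mode_mul (isTest_logCutoff n) k ha]
  have h : dr (mode 0 (logCutoff n)) q = logCutoff' n q.1 := by
    have h1 : HasDerivAt (fun s : ℝ => mode 0 (logCutoff n) (s, q.2)) (logCutoff' n q.1 : ℂ)
        q.1 := by
      simpa only [mode, fourier_zero, mul_one] using (hasDerivAt_logCutoff n hq).ofReal_comp
    exact h1.deriv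
  rw [h]
  simp only [mode, fourier_zero, mul_one]

theorem dθ_mode_mul_logCutoff (k : ℤ) (n : ℕ) (a : ℝ → ℝ) (q : Cone) :
    dθ (fun q => mode k a q * mode 0 (logCutoff n) q) q =
      Complex.I * (k / 2 : ℝ) * mode k a q * logCutoff n q.1 := by
  rw [dθ_mode_mul (isTest_logCutoff n) k]
  have h : dθ (mode 0 (logCutoff n)) q = 0 := by
    simp only [dθ, mode, fourier_zero, deriv_const]
  rw [h]
  simp only [mode, fourier_zero, mul_one, mul_zero, add_zero]

/-- A bounded single mode with square integrable gradient is in the form domain. -/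
theorem modeJet_mem_formDomain {k : ℤ} {a a' : ℝ → ℝ} (ha : ContDiffOn ℝ ∞ a (Ioi 0))
    (hd : ∀ r, 0 < r → HasDerivAt a (a' r) r) {B : ℝ} (hB : ∀ r, 0 < r → |a r| ≤ B)
    (h0 : MemLp (mode k a) 2 area) (h1 : MemLp (mode k a') 2 area)
    (h2 : MemLp (fun q => Complex.I * mode k (fun r => k / 2 * (a r / r)) q) 2 area) :
    modeJet h0 h1 h2 ∈ formDomain := by
  have ht : ∀ n, IsTest fun q => mode k a q * mode 0 (logCutoff n) q := fun n =>
    (isTest_logCutoff n).mode_mul k ha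
  obtain ⟨M, hM0, hM⟩ := exists_abs_logCutoff'_le
  have hB0 : 0 ≤ B := (abs_nonneg _).trans (hB 1 one_pos)
  refine mem_closure_of_tendsto (f := fun n => (ht n).jet) (b := Filter.atTop) ?_
    (Filter.Eventually.of_forall fun n => Submodule.subset_span ⟨_, ht n, rfl⟩)
  refine ((PiLp.continuous_toLp 2 fun _ : Fin 3 => L2).tendsto _).comp (tendsto_pi_nhds.2 ?_)
  have hle : ∀ (z : ℂ) (n : ℕ) (r : ℝ), ‖z * (logCutoff n r : ℂ)‖ ≤ ‖z‖ := by
    intro z n r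
    rw [norm_mul, Complex.norm_real, Real.norm_eq_abs]
    exact mul_le_of_le_one_right (norm_nonneg _) (abs_logCutoff_le n r)
  have hlim : ∀ (z : ℂ) (r : ℝ), 0 < r →
      Filter.Tendsto (fun n => z * (logCutoff n r : ℂ)) Filter.atTop (nhds z) := by
    intro z r hr
    refine tendsto_const_nhds.congr' ?_
    filter_upwards [eventually_logCutoff hr] with n hn
    rw [hn.1, Complex.ofReal_one, mul_one]
  intro i
  fin_cases i
  · refine tendsto_toLp_of_dominated (fun n => (ht n).memLp) h0 h0.norm
      (fun n => Filter.Eventually.of_forall fun q => ?_) ?_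
    · have := hle (mode k a q) n q.1
      simpa only [mode, fourier_zero, mul_one] using this
    · filter_upwards [ae_area_pos] with q hq
      have := hlim (mode k a q) q.1 hq
      simpa only [mode, fourier_zero, mul_one] using this
  · -- The derivative of the cutoff contributes a term which tends to zero pointwise.
    have hG : MemLp (fun q : Cone => ‖mode k a' q‖ + B * M *
        ‖mode 0 (fun r => 1 / (r * Real.sqrt (1 + Real.log r ^ 2))) q‖) 2 area :=
      h1.norm.add ((memLp_mode 0 (by fun_prop) integrableOn_inv_mul_log).norm.const_mul _)
    refine tendsto_toLp_of_dominated (fun n => (ht n).dr.memLp) h1 hG (fun n => ?_) ?_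
    · filter_upwards [ae_area_pos] with q hq
      rw [dr_mode_mul_logCutoff k n hq (hd _ hq)]
      refine (norm_add_le _ _).trans (add_le_add (hle (mode k a' q) n q.1) ?_)
      rw [norm_mul, norm_mode, norm_mode, Complex.norm_real, Real.norm_eq_abs, mul_assoc]
      refine mul_le_mul (hB _ hq) ((hM n _ hq).trans ?_) (abs_nonneg _) hB0
      exact mul_le_mul_of_nonneg_left (le_abs_self _) hM0
    · filter_upwards [ae_area_pos] with q hq
      refine tendsto_const_nhds.congr' ?_
      filter_upwards [eventually_logCutoff hq] with n hn
      rw [dr_mode_mul_logCutoff k n hq (hd _ hq), hn.1, hn.2]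
      simp [mode]
  · have e : ∀ n q, angularDeriv (fun q => mode k a q * mode 0 (logCutoff n) q) q =
        (Complex.I * mode k (fun r => k / 2 * (a r / r)) q) * logCutoff n q.1 := by
      intro n q
      rw [angularDeriv, dθ_mode_mul_logCutoff]
      simp only [mode]
      push_cast
      ring
    refine tendsto_toLp_of_dominated (fun n => (ht n).angularDeriv.memLp) h2 h2.norm
      (fun n => Filter.Eventually.of_forall fun q => ?_) ?_
    · rw [e]
      exact hle _ _ _
    · filter_upwards [ae_area_pos] with q hq
      simp only [e]
      exact hlim _ _ hq

/-- The weak form of `Δ(a e^{ikθ/2}) = D e^{ikθ/2}`. -/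
theorem modeJet_inner {k : ℤ} {a a' a'' D : ℝ → ℝ} (ha : ContDiffOn ℝ ∞ a (Ioi 0))
    (ha' : ContDiffOn ℝ ∞ a' (Ioi 0)) (ha'' : ContDiffOn ℝ ∞ a'' (Ioi 0))
    (hd' : ∀ r, 0 < r → HasDerivAt a' (a'' r) r)
    (hD : ∀ r, 0 < r → D r = -(a'' r + a' r / r) + (k / 2) ^ 2 * (a r / r ^ 2))
    (h0 : MemLp (mode k a) 2 area) (h1 : MemLp (mode k a') 2 area)
    (h2 : MemLp (fun q => Complex.I * mode k (fun r => k / 2 * (a r / r)) q) 2 area)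
    (h3 : MemLp (mode k D) 2 area) {Z : L2Triple} (hZ : Z ∈ formDomain) :
    ⟪modeJet h0 h1 h2 1, Z 1⟫_ℂ + ⟪modeJet h0 h1 h2 2, Z 2⟫_ℂ = ⟪h3.toLp _, Z 0⟫_ℂ := by
  set U := modeJet h0 h1 h2 with hU
  -- The set of `Z` for which the identity holds is a closed subspace.
  set S : Submodule ℂ L2Triple :=
    LinearMap.ker (((innerSL ℂ (U 1)).comp (PiLp.proj 2 (fun _ : Fin 3 => L2) 1) +
      (innerSL ℂ (U 2)).comp (PiLp.proj 2 (fun _ : Fin 3 => L2) 2) -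
      (innerSL ℂ (h3.toLp _)).comp (PiLp.proj 2 (fun _ : Fin 3 => L2) 0) :
        L2Triple →L[ℂ] ℂ) : L2Triple →ₗ[ℂ] ℂ) with hS
  have hmem : ∀ Z : L2Triple, Z ∈ S ↔
      ⟪U 1, Z 1⟫_ℂ + ⟪U 2, Z 2⟫_ℂ = ⟪h3.toLp _, Z 0⟫_ℂ := by
    intro Z
    rw [← sub_eq_zero]
    rfl
  have hcl : IsClosed (S : Set L2Triple) := ContinuousLinearMap.isClosed_ker _
  refine (hmem Z).1 (Submodule.topologicalClosure_minimal _ (Submodule.span_le.2 ?_) hcl hZ)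
  rintro _ ⟨z, hz, rfl⟩
  refine (hmem _).2 ?_
  have e1 : ⟪U 1, hz.jet 1⟫_ℂ = ∫ q, (starRingEnd ℂ) (mode k a' q) * dr z q ∂area :=
    inner_toLp h1 hz.dr.memLp
  have e2 : ⟪U 2, hz.jet 2⟫_ℂ = ∫ q, (starRingEnd ℂ)
      (Complex.I * mode k (fun r => k / 2 * (a r / r)) q) * angularDeriv z q ∂area :=
    inner_toLp h2 hz.angularDeriv.memLp
  have e3 : ⟪h3.toLp _, hz.jet 0⟫_ℂ = ∫ q, (starRingEnd ℂ) (mode k D q) * z q ∂area :=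
    inner_toLp h3 hz.memLp
  have hb : ContDiffOn ℝ ∞ (fun r => k / 2 * (a r / r ^ 2)) (Ioi 0) :=
    contDiffOn_const.mul (ha.div (contDiffOn_id.pow 2) fun r hr => pow_ne_zero 2 (ne_of_gt hr))
  have hc : ContDiffOn ℝ ∞ (fun r => a'' r + a' r / r) (Ioi 0) :=
    ha''.add (ha'.div contDiffOn_id fun r hr => ne_of_gt hr)
  have e2' : ∀ q, (starRingEnd ℂ) (Complex.I * mode k (fun r => k / 2 * (a r / r)) q) *
      angularDeriv z q = -Complex.I * (mode (-k) (fun r => k / 2 * (a r / r ^ 2)) q * dθ z q) := by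
    intro q
    rw [map_mul, conj_mode, Complex.conj_I, angularDeriv]
    simp only [mode]
    push_cast
    ring
  rw [e1, e2, e3]
  simp only [e2', conj_mode, integral_const_mul]
  rw [integral_mode_mul_dr hz (-k) ha' ha'' hd', integral_mode_mul_dθ hz (-k) hb]
  have e4 : ∫ q, mode (-k) D q * z q ∂area =
      ∫ q, (-(mode (-k) (fun r => a'' r + a' r / r) q * z q) +
        (k / 2 : ℝ) * (mode (-k) (fun r => k / 2 * (a r / r ^ 2)) q * z q)) ∂area := by
    refine integral_congr_ae ?_
    filter_upwards [ae_area_pos] with q hq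
    simp only [mode, hD _ hq]
    push_cast
    ring
  rw [e4, integral_add (hz.mode_mul _ hc).integrable.fun_neg
    ((hz.mode_mul _ hb).integrable.const_mul _), integral_neg, integral_const_mul]
  push_cast
  ring_nf
  simp only [Complex.I_sq]
  ring

/-! ### The core of Gaussian modes -/

/-- The function `r^p e^{-λ r²}`. -/
def gau (p lam : ℝ) : ℝ → ℝ := fun r => r ^ p * Real.exp (-(lam * r ^ 2))

/-- The Bessel index `|k| / 2` of the mode `e^{ikθ/2}` on the cone of angle `4π`. -/
def index (k : ℤ) : ℝ := |(k : ℝ)| / 2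

theorem index_nonneg (k : ℤ) : 0 ≤ index k := by unfold index; positivity

theorem index_neg (k : ℤ) : index (-k) = index k := by simp [index]

theorem index_sq (k : ℤ) : index k ^ 2 = ((k : ℝ) / 2) ^ 2 := by
  rw [index, div_pow, sq_abs, div_pow]

theorem index_eq_zero_or (k : ℤ) : index k = 0 ∨ -1 < index k - 1 := by
  rcases eq_or_ne k 0 with rfl | hk
  · left; simp [index]
  · right
    have h1 : 0 < |(k : ℝ)| := abs_pos.2 (by exact_mod_cast hk)
    unfold index
    linarith

theorem gau_pos {p lam r : ℝ} (hr : 0 < r) : 0 < gau p lam r :=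
  mul_pos (Real.rpow_pos_of_pos hr p) (Real.exp_pos _)

theorem measurable_gau (p lam : ℝ) : Measurable (gau p lam) := by
  unfold gau
  fun_prop

theorem contDiffOn_gau (p lam : ℝ) : ContDiffOn ℝ ∞ (gau p lam) (Ioi 0) := by
  intro r hr
  have h1 : ContDiffAt ℝ ∞ (fun r : ℝ => r ^ p) r :=
    contDiffAt_id.rpow_const_of_ne (ne_of_gt hr)
  have h2 : ContDiffAt ℝ ∞ (fun r : ℝ => Real.exp (-(lam * r ^ 2))) r := by fun_prop
  exact (h1.mul h2).contDiffWithinAt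

theorem gau_mul_gau {p q lam mu r : ℝ} (hr : 0 < r) :
    gau p lam r * gau q mu r = gau (p + q) (lam + mu) r := by
  unfold gau
  rw [Real.rpow_add hr, show -((lam + mu) * r ^ 2) = -(lam * r ^ 2) + -(mu * r ^ 2) by ring,
    Real.exp_add]
  ring

theorem mul_gau {p lam r : ℝ} (hr : 0 < r) : r * gau p lam r = gau (p + 1) lam r := by
  unfold gau
  rw [Real.rpow_add_one hr.ne']
  ring

theorem gau_div {p lam r : ℝ} (hr : 0 < r) : gau p lam r / r = gau (p - 1) lam r := by
  unfold gau
  rw [Real.rpow_sub_one hr.ne']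
  ring

theorem hasDerivAt_gau (p lam : ℝ) {r : ℝ} (hr : 0 < r) :
    HasDerivAt (gau p lam) (p * gau (p - 1) lam r + -(2 * lam) * gau (p + 1) lam r) r := by
  have h1 := Real.hasDerivAt_rpow_const (x := r) (p := p) (Or.inl hr.ne')
  have h2 : HasDerivAt (fun r => Real.exp (-(lam * r ^ 2)))
      (Real.exp (-(lam * r ^ 2)) * -(lam * (2 * r))) r := by
    have := (((hasDerivAt_id' r).fun_pow 2).const_mul lam).fun_neg.exp
    simpa using this
  refine (h1.mul h2).congr_deriv ?_
  rw [← mul_gau hr]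
  unfold gau
  ring

theorem integrableOn_gau {p lam : ℝ} (hp : -1 < p) (hl : 0 < lam) :
    IntegrableOn (gau p lam) (Ioi 0) := by
  have := integrableOn_rpow_mul_exp_neg_mul_sq hl hp
  simp only [neg_mul] at this
  exact this

theorem memLp_mode_gau (k : ℤ) {p lam : ℝ} (hp : -1 < p) (hl : 0 < lam) :
    MemLp (mode k (gau p lam)) 2 area := by
  refine memLp_mode k (measurable_gau _ _) ?_
  have h := integrableOn_gau (p := p + p + 1) (lam := lam + lam) (by linarith) (by linarith)
  refine h.congr_fun (fun r hr => ?_) measurableSet_Ioi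
  rw [sq, gau_mul_gau hr, mul_gau hr]

theorem memLp_mode_gau_add (k : ℤ) {c p d q lam : ℝ} (hp : c = 0 ∨ -1 < p) (hq : -1 < q)
    (hl : 0 < lam) :
    MemLp (mode k fun r => c * gau p lam r + d * gau q lam r) 2 area := by
  have e : (mode k fun r => c * gau p lam r + d * gau q lam r) =
      (fun x => (c : ℂ) * mode k (gau p lam) x) + fun x => (d : ℂ) * mode k (gau q lam) x := by
    funext x
    simp only [mode, Pi.add_apply]
    push_cast
    ring
  rw [e]
  refine MemLp.add ?_ ((memLp_mode_gau k hq hl).const_mul _)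
  rcases hp with rfl | hp
  · simp
  · exact (memLp_mode_gau k hp hl).const_mul _

theorem abs_gau_le {p lam : ℝ} (hp : 0 ≤ p) (hl : 0 < lam) {r : ℝ} (hr : 0 < r) :
    |gau p lam r| ≤ Real.exp (p ^ 2 / (4 * lam)) := by
  rw [abs_of_pos (gau_pos hr), gau, Real.rpow_def_of_pos hr, ← Real.exp_add]
  refine Real.exp_le_exp.2 ?_
  have h1 : Real.log r * p ≤ r * p :=
    mul_le_mul_of_nonneg_right ((Real.log_le_sub_one_of_pos hr).trans (by linarith)) hp
  have h2 : p ^ 2 / (4 * lam) - (r * p - lam * r ^ 2) = (p - 2 * lam * r) ^ 2 / (4 * lam) := by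
    field_simp
    ring
  have h3 : 0 ≤ (p - 2 * lam * r) ^ 2 / (4 * lam) := by positivity
  linarith

/-- The radial part of `∂_r u` for `u = r^m e^{-λr²} e^{ikθ/2}`, `m = |k|/2`. -/
def coreDeriv (k : ℤ) (lam : ℝ) : ℝ → ℝ := fun r =>
  index k * gau (index k - 1) lam r + -(2 * lam) * gau (index k + 1) lam r

/-- The radial part of `(c + Δ) u` for `u = r^m e^{-λr²} e^{ikθ/2}`, `m = |k|/2`. -/
def coreLap (c : ℝ) (k : ℤ) (lam : ℝ) : ℝ → ℝ := fun r =>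
  (c + 4 * lam * (index k + 1)) * gau (index k) lam r + -(4 * lam ^ 2) * gau (index k + 2) lam r

theorem memLp_core (k : ℤ) {lam : ℝ} (hl : 0 < lam) :
    MemLp (mode k (gau (index k) lam)) 2 area :=
  memLp_mode_gau k (by linarith [index_nonneg k]) hl

theorem memLp_coreDeriv (k : ℤ) {lam : ℝ} (hl : 0 < lam) :
    MemLp (mode k (coreDeriv k lam)) 2 area :=
  memLp_mode_gau_add k (index_eq_zero_or k) (by linarith [index_nonneg k]) hl

theorem memLp_coreAngular (k : ℤ) {lam : ℝ} (hl : 0 < lam) :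
    MemLp (fun q => Complex.I * mode k (fun r => k / 2 * (gau (index k) lam r / r)) q) 2 area := by
  have hk : (k : ℝ) / 2 = 0 ∨ -1 < index k - 1 := by
    rcases index_eq_zero_or k with h | h
    · left
      have := index_sq k
      rw [h] at this
      exact pow_eq_zero_iff (two_ne_zero) |>.1 (by rw [← this]; norm_num)
    · exact Or.inr h
  have h := (memLp_mode_gau_add k (d := 0) (q := 0) hk (by norm_num) hl).const_mul Complex.I
  refine h.ae_eq ?_
  filter_upwards [ae_area_pos] with q hq
  simp only [mode, gau_div hq, zero_mul, add_zero]

theorem memLp_coreLap (c : ℝ) (k : ℤ) {lam : ℝ} (hl : 0 < lam) :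
    MemLp (mode k (coreLap c k lam)) 2 area :=
  memLp_mode_gau_add k (Or.inr (by linarith [index_nonneg k])) (by linarith [index_nonneg k]) hl

/-- The core function `u = r^m e^{-λr²} e^{ikθ/2}` with its gradient. -/
def coreJet (k : ℤ) {lam : ℝ} (hl : 0 < lam) : L2Triple :=
  modeJet (memLp_core k hl) (memLp_coreDeriv k hl) (memLp_coreAngular k hl)

theorem coreJet_mem (k : ℤ) {lam : ℝ} (hl : 0 < lam) : coreJet k hl ∈ formDomain :=
  modeJet_mem_formDomain (contDiffOn_gau _ _) (fun _ hr => hasDerivAt_gau _ _ hr)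
    (fun _ hr => abs_gau_le (index_nonneg k) hl hr) _ _ _

theorem coreJet_inner (k : ℤ) {lam : ℝ} (hl : 0 < lam) {Z : L2Triple} (hZ : Z ∈ formDomain) :
    ⟪coreJet k hl 1, Z 1⟫_ℂ + ⟪coreJet k hl 2, Z 2⟫_ℂ =
      ⟪(memLp_coreLap 0 k hl).toLp _, Z 0⟫_ℂ := by
  refine modeJet_inner (a' := coreDeriv k lam) (contDiffOn_gau _ _) ?_ ?_ (fun r hr =>
    ((hasDerivAt_gau (index k - 1) lam hr).const_mul (index k)).fun_add
      ((hasDerivAt_gau (index k + 1) lam hr).const_mul (-(2 * lam)))) ?_ _ _ _ _ hZ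
  · exact (contDiffOn_const.mul (contDiffOn_gau _ _)).add
      (contDiffOn_const.mul (contDiffOn_gau _ _))
  · exact (contDiffOn_const.mul ((contDiffOn_const.mul (contDiffOn_gau _ _)).add
      (contDiffOn_const.mul (contDiffOn_gau _ _)))).add
      (contDiffOn_const.mul ((contDiffOn_const.mul (contDiffOn_gau _ _)).add
      (contDiffOn_const.mul (contDiffOn_gau _ _))))
  · intro r hr
    have e1 : gau (index k - 1) lam r = r * gau (index k - 2) lam r := by
      rw [mul_gau hr]; congr 1; ring
    have e2 : gau (index k) lam r = r ^ 2 * gau (index k - 2) lam r := by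
      rw [sq, mul_assoc, mul_gau hr, mul_gau hr]; congr 1; ring
    have e3 : gau (index k + 1) lam r = r ^ 3 * gau (index k - 2) lam r := by
      rw [← mul_gau hr, e2]; ring
    have e4 : gau (index k + 2) lam r = r ^ 4 * gau (index k - 2) lam r := by
      rw [show index k + 2 = index k + 1 + 1 by ring, ← mul_gau hr, e3]; ring
    have s1 : index k - 1 - 1 = index k - 2 := by ring
    have s2 : index k - 1 + 1 = index k := by ring
    have s3 : index k + 1 - 1 = index k := by ring
    have s4 : index k + 1 + 1 = index k + 2 := by ring
    simp only [coreLap, coreDeriv, s1, s2, s3, s4, e1, e2, e3, e4, ← index_sq]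
    field_simp
    ring

/-! ### Density of the range of `s² + Δ` on the core -/

theorem ae_eq_zero_of_integral_fourier_eq_zero {g : Angle → ℂ} (hg : MemLp g 2 volume)
    (h : ∀ k : ℤ, ∫ θ, fourier k θ * g θ = 0) : ∀ᵐ θ, g θ = 0 := by
  have hg' : MemLp g 2 AddCircle.haarAddCircle := memLp_haarAddCircle_iff.2 hg
  have h0 : hg'.toLp g = 0 := by
    refine fourierBasis.repr.map_eq_zero_iff.1 ?_
    ext k
    rw [fourierBasis_repr, fourierCoeff_congr_ae hg'.coeFn_toLp, fourierCoeff,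
      AddCircle.integral_haarAddCircle]
    simp only [smul_eq_mul, h]
    simp
  have h1 := (Lp.eq_zero_iff_ae_eq_zero.1 h0)
  have h2 : ∀ᵐ θ ∂AddCircle.haarAddCircle, g θ = 0 := by
    filter_upwards [hg'.coeFn_toLp, h1] with θ h3 h4
    rw [← h3, h4, Pi.zero_apply]
  rw [AddCircle.volume_eq_smul_haarAddCircle]
  exact Measure.ae_smul_measure h2 _

/-- The products of the Gaussians `r^m e^{-λr²}`, `λ > 0`, with `e^{ikθ/2}` are complete. -/
theorem eq_zero_of_integral_core_eq_zero {h : L2}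
    (H : ∀ (k : ℤ) (lam : ℝ), 0 < lam → ∫ q, mode k (gau (index k) lam) q * h q ∂area = 0) :
    h = 0 := by
  have hh : MemLp h 2 area := Lp.memLp h
  set c : ℤ → ℝ → ℂ := fun k r => ∫ θ : Angle, fourier k θ * h (r, θ) with hc
  have hint : ∀ (k : ℤ) {lam : ℝ}, 0 < lam →
      Integrable (fun q => mode k (gau (index k) lam) q * h q) area := fun k lam hl =>
    (memLp_core k hl).integrable_mul hh
  have hck : ∀ k : ℤ, ∀ᵐ r ∂radialMeasure, c k r = 0 := by
    intro k
    have hF : ∀ (lam r : ℝ), ∫ θ : Angle, mode k (gau (index k) lam) (r, θ) * h (r, θ) =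
        (gau (index k) lam r : ℂ) * c k r := by
      intro lam r
      rw [hc, ← integral_const_mul]
      refine integral_congr_ae (Filter.Eventually.of_forall fun θ => ?_)
      simp only [mode]
      ring
    have hi : Integrable (fun r => (gau (index k) 1 r : ℂ) * c k r) radialMeasure := by
      have := (hint k one_pos).integral_prod_left
      simp only [hF] at this
      exact this
    -- The values `λ = n + 1` suffice: they give the moments in `x = e^{-r²}`.
    have h0 := ae_eq_zero_of_exp_moments (μ := radialMeasure) (τ := fun r => r ^ 2)
      (σ := Real.sqrt) (by fun_prop) (fun r _ => sq_nonneg r) Real.continuous_sqrt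
      Real.tendsto_sqrt_atTop (fun r hr => Real.sqrt_sq hr.le) hi.integrableOn (fun n => by
        have hn : (0 : ℝ) < n + 1 := by positivity
        have e := H k (n + 1) hn
        rw [integral_area_symm (hint k hn)] at e
        simp only [hF] at e
        rw [radialMeasure_restrict, ← e]
        refine integral_congr_ae (Filter.Eventually.of_forall fun r => ?_)
        simp only
        rw [← mul_assoc, ← Complex.ofReal_mul]
        congr 2
        unfold gau
        rw [mul_left_comm, ← Real.exp_add]
        congr 2
        ring)
    rw [radialMeasure_restrict] at h0
    filter_upwards [h0, ae_radialMeasure_pos] with r h1 h2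
    exact (mul_eq_zero.1 h1).resolve_left (by exact_mod_cast (gau_pos h2).ne')
  have hsq : Integrable (fun q => ‖h q‖ ^ 2) area :=
    (memLp_two_iff_integrable_sq_norm hh.1).1 hh
  have hz : ∀ᵐ r ∂radialMeasure, ∀ᵐ θ : Angle, h (r, θ) = 0 := by
    have hm : AEStronglyMeasurable h (radialMeasure.prod (volume : Measure Angle)) := hh.1
    have hsq' : Integrable (fun q : ℝ × Angle => ‖h q‖ ^ 2)
      (radialMeasure.prod (volume : Measure Angle)) := hsq
    filter_upwards [ae_all_iff.2 hck, hm.prodMk_left, hsq'.prod_right_ae] with r h1 h2 h3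
    exact ae_eq_zero_of_integral_fourier_eq_zero
      ((memLp_two_iff_integrable_sq_norm h2).2 h3) h1
  have h0 : ∫ q, ‖h q‖ ^ 2 ∂area = 0 := by
    refine (integral_prod (fun q : ℝ × Angle => ‖h q‖ ^ 2) hsq).trans ?_
    refine integral_eq_zero_of_ae ?_
    filter_upwards [hz] with r hr
    refine integral_eq_zero_of_ae ?_
    filter_upwards [hr] with θ hθ
    simp [hθ]
  rw [integral_eq_zero_iff_of_nonneg (fun q => by positivity) hsq] at h0
  refine Lp.eq_zero_iff_ae_eq_zero.2 ?_
  filter_upwards [h0] with q hq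
  simpa using hq

theorem hasDerivAt_integral_core (h : L2) (k : ℤ) {lam : ℝ} (hl : 0 < lam) :
    HasDerivAt (fun lam => ∫ q, mode k (gau (index k) lam) q * h q ∂area)
      (-∫ q, mode k (gau (index k + 2) lam) q * h q ∂area) lam := by
  have hh : MemLp h 2 area := Lp.memLp h
  have hi := index_nonneg k
  have hm : ∀ p lam, AEStronglyMeasurable (fun q => mode k (gau p lam) q * h q) area :=
    fun p lam => (aestronglyMeasurable_mode k (measurable_gau _ _)).mul hh.1
  have := (hasDerivAt_integral_of_dominated_loc_of_deriv_le (μ := area)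
    (F := fun lam q => mode k (gau (index k) lam) q * h q)
    (F' := fun lam q => -(mode k (gau (index k + 2) lam) q * h q)) (x₀ := lam)
    (s := Ioi (lam / 2)) (bound := fun q => ‖mode k (gau (index k + 2) (lam / 2)) q * h q‖)
    (Ioi_mem_nhds (by linarith)) (Filter.Eventually.of_forall fun _ => hm _ _)
    ((memLp_core k hl).integrable_mul hh) (hm _ _).neg ?_ ?_ ?_).2
  · rwa [integral_neg] at this
  · filter_upwards [ae_area_pos] with q hq x hx
    rw [norm_neg, norm_mul, norm_mul, norm_mode, norm_mode, abs_of_pos (gau_pos hq),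
      abs_of_pos (gau_pos hq)]
    refine mul_le_mul_of_nonneg_right ?_ (norm_nonneg _)
    refine mul_le_mul_of_nonneg_left (Real.exp_le_exp.2 ?_) (Real.rpow_nonneg hq.le _)
    have := mul_le_mul_of_nonneg_right (le_of_lt hx) (sq_nonneg q.1)
    linarith
  · exact ((memLp_mode_gau k (p := index k + 2) (by linarith) (half_pos hl)).integrable_mul
      hh).norm
  · filter_upwards [ae_area_pos] with q hq x _
    have e : ∀ x, mode k (gau (index k) x) q * h q =
        (((q.1 ^ index k : ℝ) : ℂ) * fourier k q.2 * h q) *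
          (Real.exp (-(x * q.1 ^ 2)) : ℂ) := by
      intro x
      simp only [mode, gau]
      push_cast
      ring
    simp only [e]
    have h1 : HasDerivAt (fun x => Real.exp (-(x * q.1 ^ 2)))
        (Real.exp (-(x * q.1 ^ 2)) * -(1 * q.1 ^ 2)) x :=
      ((hasDerivAt_id' x).mul_const (q.1 ^ 2)).fun_neg.exp
    refine (h1.ofReal_comp.const_mul _).congr_deriv ?_
    rw [mode, show index k + 2 = index k + 1 + 1 by ring, ← mul_gau hq, ← mul_gau hq, gau]
    push_cast
    ring

/-- The size of a Gaussian mode, by Cauchy-Schwarz and the Gamma integral. -/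
theorem exists_norm_integral_core_le (h : L2) (k : ℤ) : ∃ C : ℝ, ∀ lam : ℝ, 0 < lam →
    (lam ^ (index k + 1) * ‖∫ q, mode k (gau (index k) lam) q * h q ∂area‖) ^ 2 ≤
      C * lam ^ (index k + 1) := by
  set m := index k with hm
  have hm0 : 0 ≤ m := index_nonneg k
  refine ⟨4 * Real.pi * ((2 : ℝ) ^ (-(m + 1)) * (1 / 2) * Real.Gamma (m + 1)) * ‖h‖ ^ 2,
    fun lam hl => ?_⟩
  have hu := memLp_mode_gau (-k) (p := m) (by linarith) hl
  have e1 : ∫ q, mode k (gau m lam) q * h q ∂area = ⟪hu.toLp _, h⟫_ℂ := by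
    rw [L2.inner_def]
    refine integral_congr_ae ?_
    filter_upwards [hu.coeFn_toLp] with q hq
    rw [hq, RCLike.inner_apply', conj_mode, neg_neg]
  have e2 : ‖hu.toLp _‖ ^ 2 =
      4 * Real.pi * (lam ^ (-(m + 1)) * ((2 : ℝ) ^ (-(m + 1)) * (1 / 2) * Real.Gamma (m + 1))) := by
    have h1 : ((‖hu.toLp _‖ ^ 2 : ℝ) : ℂ) = ⟪hu.toLp _, hu.toLp _⟫_ℂ := by
      rw [inner_self_eq_norm_sq_to_K]
      simp
    rw [inner_toLp] at h1
    simp only [conj_mode] at h1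
    rw [integral_mode_mul_mode, if_pos (by ring)] at h1
    rw [Complex.ofReal_injective h1]
    congr 1
    have h2 := integral_rpow_mul_exp_neg_mul_rpow (p := 2) (q := 2 * m + 1) (b := 2 * lam)
      (by norm_num) (by linarith) (by linarith)
    rw [show -(2 * m + 1 + 1) / 2 = -(m + 1) by ring, show (2 * m + 1 + 1) / 2 = m + 1 by ring,
      Real.mul_rpow (by norm_num) hl.le] at h2
    rw [show lam ^ (-(m + 1)) * ((2 : ℝ) ^ (-(m + 1)) * (1 / 2) * Real.Gamma (m + 1)) =
      (2 : ℝ) ^ (-(m + 1)) * lam ^ (-(m + 1)) * (1 / 2) * Real.Gamma (m + 1) by ring, ← h2]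
    refine setIntegral_congr_fun measurableSet_Ioi fun r hr => ?_
    rw [gau_mul_gau hr, mul_gau hr, gau, Real.rpow_two]
    congr 2
    · ring
    · ring
  have h3 : ‖∫ q, mode k (gau m lam) q * h q ∂area‖ ^ 2 ≤ ‖hu.toLp _‖ ^ 2 * ‖h‖ ^ 2 := by
    rw [e1, ← mul_pow]
    exact pow_le_pow_left₀ (norm_nonneg _) (norm_inner_le_norm _ _) 2
  have h4 : lam ^ (m + 1) * lam ^ (-(m + 1)) = 1 := by
    rw [← Real.rpow_add hl, add_neg_cancel, Real.rpow_zero]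
  rw [mul_pow]
  calc _ ≤ (lam ^ (m + 1)) ^ 2 * (‖hu.toLp _‖ ^ 2 * ‖h‖ ^ 2) :=
        mul_le_mul_of_nonneg_left h3 (sq_nonneg _)
    _ = (lam ^ (m + 1) * lam ^ (-(m + 1))) * (4 * Real.pi * ((2 : ℝ) ^ (-(m + 1)) * (1 / 2) *
          Real.Gamma (m + 1)) * ‖h‖ ^ 2 * lam ^ (m + 1)) := by
        rw [e2]
        ring
    _ = _ := by rw [h4, one_mul]

/-- The functions `(s² + Δ) u`, with `u` in the core, are complete: if `h` is orthogonal to them,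
then its Gaussian transform `H(λ)` solves `4λ²H' + (s² + 4λ(m + 1))H = 0`, so that
`λ^{m+1} e^{-s²/4λ} H(λ)` is constant, and this constant is its limit `0` at `λ = 0`. -/
theorem eq_zero_of_integral_coreLap_eq_zero {s : ℝ} {h : L2}
    (H : ∀ (k : ℤ) (lam : ℝ), 0 < lam →
      ∫ q, mode k (coreLap (s ^ 2) k lam) q * h q ∂area = 0) : h = 0 := by
  have hh : MemLp h 2 area := Lp.memLp h
  refine eq_zero_of_integral_core_eq_zero fun k lam₀ hl₀ => ?_
  set m := index k with hm
  have hm0 : 0 ≤ m := index_nonneg k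
  set I : ℝ → ℂ := fun lam => ∫ q, mode k (gau m lam) q * h q ∂area with hI
  set J : ℝ → ℂ := fun lam => ∫ q, mode k (gau (m + 2) lam) q * h q ∂area with hJ
  have hode : ∀ lam, 0 < lam →
      ((s ^ 2 + 4 * lam * (m + 1) : ℝ) : ℂ) * I lam - ((4 * lam ^ 2 : ℝ) : ℂ) * J lam = 0 := by
    intro lam hl
    have h1 : Integrable (fun q => mode k (gau m lam) q * h q) area :=
      (memLp_core k hl).integrable_mul hh
    have h2 : Integrable (fun q => mode k (gau (m + 2) lam) q * h q) area :=
      (memLp_mode_gau k (by linarith) hl).integrable_mul hh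
    rw [← H k lam hl, hI, hJ]
    simp only
    rw [← integral_const_mul, ← integral_const_mul,
      ← integral_sub (h1.const_mul _) (h2.const_mul _)]
    refine integral_congr_ae (Filter.Eventually.of_forall fun q => ?_)
    simp only [mode, coreLap]
    push_cast
    ring
  -- The integrating factor of the differential equation.
  set w : ℝ → ℝ := fun lam => lam ^ (m + 1) * Real.exp (-(s ^ 2 / 4) * lam⁻¹) with hw
  have hwd : ∀ lam, 0 < lam → HasDerivAt w
      (w lam * ((m + 1) / lam + s ^ 2 / (4 * lam ^ 2))) lam := by
    intro lam hl
    have h1 := Real.hasDerivAt_rpow_const (x := lam) (p := m + 1) (Or.inl hl.ne')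
    have h2 := ((hasDerivAt_inv hl.ne').const_mul (-(s ^ 2 / 4))).exp
    refine (h1.mul h2).congr_deriv ?_
    rw [hw, Real.rpow_sub_one hl.ne']
    field_simp
  have hG : ∀ lam, 0 < lam → HasDerivAt (fun lam => (w lam : ℂ) * I lam) 0 lam := by
    intro lam hl
    refine ((hwd lam hl).ofReal_comp.mul (hasDerivAt_integral_core h k hl)).congr_deriv ?_
    have h1 := hode lam hl
    have h2 : (lam : ℂ) ≠ 0 := by exact_mod_cast hl.ne'
    change ((w lam * ((m + 1) / lam + s ^ 2 / (4 * lam ^ 2)) : ℝ) : ℂ) * I lam +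
      (w lam : ℂ) * -(J lam) = 0
    have h3 : ((w lam * ((m + 1) / lam + s ^ 2 / (4 * lam ^ 2)) : ℝ) : ℂ) * I lam +
      (w lam : ℂ) * -(J lam) = (w lam : ℂ) / (4 * lam ^ 2) *
        (((s ^ 2 + 4 * lam * (m + 1) : ℝ) : ℂ) * I lam - ((4 * lam ^ 2 : ℝ) : ℂ) * J lam) := by
      push_cast
      field_simp
      ring
    rw [h3, h1, mul_zero]
  have hconst : ∀ lam, 0 < lam → (w lam : ℂ) * I lam = (w lam₀ : ℂ) * I lam₀ := by
    intro lam hl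
    have := Convex.norm_image_sub_le_of_norm_hasDerivWithin_le (s := Ioi (0 : ℝ)) (C := 0)
      (fun x hx => (hG x hx).hasDerivWithinAt) (fun x _ => by simp) (convex_Ioi 0) hl₀ hl
    rw [zero_mul, norm_le_zero_iff, sub_eq_zero] at this
    exact this
  obtain ⟨C, hC⟩ := exists_norm_integral_core_le h k
  have hlim : Filter.Tendsto (fun lam : ℝ => C * lam ^ (m + 1)) (nhdsWithin 0 (Ioi 0))
      (nhds 0) := by
    have h1 : ContinuousAt (fun lam : ℝ => C * lam ^ (m + 1)) 0 :=
      continuousAt_const.mul (Real.continuousAt_rpow_const _ _ (Or.inr (by linarith)))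
    have h2 := h1.tendsto
    rw [Real.zero_rpow (by linarith), mul_zero] at h2
    exact h2.mono_left nhdsWithin_le_nhds
  have hle : ∀ lam ∈ Ioi (0 : ℝ), ‖(w lam₀ : ℂ) * I lam₀‖ ^ 2 ≤ C * lam ^ (m + 1) := by
    intro lam hl
    rw [← hconst lam hl]
    refine le_trans ?_ (hC lam hl)
    refine pow_le_pow_left₀ (norm_nonneg _) ?_ 2
    rw [norm_mul, Complex.norm_real, Real.norm_eq_abs, hw, abs_mul, Real.abs_exp,
      abs_of_nonneg (Real.rpow_nonneg (le_of_lt hl) _)]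
    refine mul_le_mul_of_nonneg_right ?_ (norm_nonneg _)
    refine mul_le_of_le_one_right (Real.rpow_nonneg (le_of_lt hl) _) (Real.exp_le_one_iff.2 ?_)
    have h1 : 0 ≤ s ^ 2 / 4 * lam⁻¹ := mul_nonneg (by positivity) (inv_nonneg.2 (le_of_lt hl))
    linarith
  have h0 : ‖(w lam₀ : ℂ) * I lam₀‖ ^ 2 ≤ 0 :=
    ge_of_tendsto hlim (by filter_upwards [self_mem_nhdsWithin] with lam hl using hle lam hl)
  have h1 : (w lam₀ : ℂ) * I lam₀ = 0 := by
    rw [← norm_eq_zero]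
    exact pow_eq_zero_iff two_ne_zero |>.1 (le_antisymm h0 (sq_nonneg _))
  refine (mul_eq_zero.1 h1).resolve_left ?_
  have : 0 < w lam₀ := mul_pos (Real.rpow_pos_of_pos hl₀ _) (Real.exp_pos _)
  exact_mod_cast this.ne'

/-- The element `(s² + Δ) u` of `L²`, for `u` in the core. -/
def coreSource (s : ℝ) (p : ℤ × Ioi (0 : ℝ)) : L2 :=
  (memLp_coreLap (s ^ 2) p.1 (lam := p.2) p.2.2).toLp _

theorem dense_span_coreSource (s : ℝ) :
    Dense (Submodule.span ℂ (range (coreSource s)) : Set L2) := by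
  rw [Submodule.dense_iff_topologicalClosure_eq_top, Submodule.topologicalClosure_eq_top_iff,
    Submodule.eq_bot_iff]
  intro h hh
  refine eq_zero_of_integral_coreLap_eq_zero (s := s) fun k lam hl => ?_
  have h1 := hh _ (Submodule.subset_span ⟨(-k, ⟨lam, hl⟩), rfl⟩)
  rw [L2.inner_def] at h1
  rw [← h1]
  refine integral_congr_ae ?_
  filter_upwards [(memLp_coreLap (s ^ 2) (-k) hl).coeFn_toLp] with q hq
  change _ = ⟪(memLp_coreLap (s ^ 2) (-k) hl).toLp _ q, h q⟫_ℂ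
  rw [hq, RCLike.inner_apply', conj_mode, neg_neg]
  unfold coreLap
  rw [index_neg]

/-! ### The resolvents `(s² + Δ)⁻¹` -/

theorem denominator_pos {s x : ℝ} (hs : 0 < s) (hx : x ∈ Icc (0 : ℝ) 1) :
    0 < 1 + (s ^ 2 - 1) * x := by
  have h1 : 0 < s ^ 2 := by positivity
  rcases eq_or_lt_of_le hx.1 with h | h
  · rw [← h]; norm_num
  · nlinarith [hx.2, mul_pos h1 h]

theorem continuousOn_inv_denominator {s : ℝ} (hs : 0 < s) :
    ContinuousOn (fun x : ℝ => (1 + (s ^ 2 - 1) * x)⁻¹) (Icc 0 1) :=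
  ContinuousOn.inv₀ (by fun_prop) fun _ hx => (denominator_pos hs hx).ne'

section FunctionalCalculus

variable {H : Type*} [NormedAddCommGroup H] [InnerProductSpace ℂ H] [CompleteSpace H]

theorem functionalCalculus_inv_apply {s : ℝ} (hs : 0 < s) {T : H →L[ℂ] H} (ha : IsSelfAdjoint T)
    (hT : spectrum ℝ T ⊆ Icc 0 1) (g : H) :
    functionalCalculus (fun x => (1 + (s ^ 2 - 1) * x)⁻¹) T
      (g + ((s ^ 2 - 1 : ℝ) : ℂ) • T g) = g := by
  have h1 : cfc (fun x : ℝ => 1 + (s ^ 2 - 1) * x) T = 1 + (s ^ 2 - 1) • T := by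
    rw [cfc_add T (fun _ => (1 : ℝ)) (fun x : ℝ => (s ^ 2 - 1) * x), cfc_const_one ℝ T,
      cfc_const_mul (s ^ 2 - 1) (fun x : ℝ => x) T, cfc_id' ℝ T]
  have h2 : cfc (fun x : ℝ => (1 + (s ^ 2 - 1) * x)⁻¹) T *
      cfc (fun x : ℝ => 1 + (s ^ 2 - 1) * x) T = 1 := by
    rw [← cfc_mul _ _ T ((continuousOn_inv_denominator hs).mono hT) (by fun_prop),
      ← cfc_const_one ℝ T]
    refine cfc_congr fun x hx => ?_
    exact inv_mul_cancel₀ (denominator_pos hs (hT hx)).ne'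
  rw [h1] at h2
  rw [Complex.coe_smul]
  exact DFunLike.congr_fun h2 g

theorem functionalCalculus_div {s : ℝ} (hs : 0 < s) {T : H →L[ℂ] H} (ha : IsSelfAdjoint T)
    (hT : spectrum ℝ T ⊆ Icc 0 1) :
    functionalCalculus (fun x => x / (1 + (s ^ 2 - 1) * x)) T =
      T ∘L functionalCalculus (fun x => (1 + (s ^ 2 - 1) * x)⁻¹) T := by
  change cfc _ T = T * cfc _ T
  nth_rw 2 [← cfc_id' ℝ T]
  rw [← cfc_mul _ _ T (by fun_prop) ((continuousOn_inv_denominator hs).mono hT)]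
  rfl

theorem functionalCalculus_inner (f : ℝ → ℝ) (T : H →L[ℂ] H) (x y : H) :
    ⟪functionalCalculus f T x, y⟫_ℂ = ⟪x, functionalCalculus f T y⟫_ℂ := by
  have h : IsSelfAdjoint (functionalCalculus f T) := cfc_predicate f T
  have h1 := ContinuousLinearMap.adjoint_inner_left (functionalCalculus f T) y x
  rwa [h.adjoint_eq] at h1

end FunctionalCalculus

theorem spectrum_resolventOne : spectrum ℝ resolventOne ⊆ Icc 0 1 :=
  spectrum_comp_adjoint formInclusion norm_formInclusion_le

theorem isSelfAdjoint_resolventOne : IsSelfAdjoint resolventOne :=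
  isPositive_resolventOne.isSelfAdjoint

/-- The resolvent `(s² + Δ)⁻¹`, as a function of `x = (1 + Δ)⁻¹`. -/
def resolvent (s : ℝ) : L2 →L[ℂ] L2 :=
  functionalCalculus (fun x => x / (1 + (s ^ 2 - 1) * x)) resolventOne

/-- The resolvent `(s² + Δ)⁻¹` as an operator with values in the form domain. -/
def formResolvent (s : ℝ) : L2 →L[ℂ] formDomain :=
  ContinuousLinearMap.adjoint formInclusion ∘L
    functionalCalculus (fun x => (1 + (s ^ 2 - 1) * x)⁻¹) resolventOne

theorem formInclusion_formResolvent {s : ℝ} (hs : 0 < s) (f : L2) :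
    (formResolvent s f : L2Triple) 0 = resolvent s f := by
  rw [resolvent, functionalCalculus_div hs isSelfAdjoint_resolventOne spectrum_resolventOne]
  rfl

theorem adjoint_formInclusion_eq {U : L2Triple} (hU : U ∈ formDomain) {f : L2}
    (h : ∀ Z ∈ formDomain, ⟪U 1, Z 1⟫_ℂ + ⟪U 2, Z 2⟫_ℂ = ⟪f, Z 0⟫_ℂ) :
    ContinuousLinearMap.adjoint formInclusion (U 0 + f) = ⟨U, hU⟩ := by
  refine ext_inner_right ℂ fun Z => ?_
  rw [ContinuousLinearMap.adjoint_inner_left, Submodule.coe_inner, PiLp.inner_apply,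
    Fin.sum_univ_three, add_assoc, h Z Z.2, inner_add_left]
  rfl

theorem toLp_coreLap (c : ℝ) (k : ℤ) {lam : ℝ} (hl : 0 < lam) :
    (memLp_coreLap c k hl).toLp _ =
      (c : ℂ) • (memLp_core k hl).toLp _ + (memLp_coreLap 0 k hl).toLp _ := by
  rw [← MemLp.toLp_const_smul, ← MemLp.toLp_add]
  refine MemLp.toLp_congr _ _ (Filter.Eventually.of_forall fun q => ?_)
  simp only [mode, coreLap, Pi.add_apply, Pi.smul_apply, smul_eq_mul]
  push_cast
  ring

/-- On `(s² + Δ) u`, with `u` in the core, the resolvent returns `u` with its gradient. -/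
theorem formResolvent_coreSource {s : ℝ} (hs : 0 < s) (p : ℤ × Ioi (0 : ℝ)) :
    (formResolvent s (coreSource s p) : L2Triple) = coreJet p.1 (lam := p.2) p.2.2 := by
  obtain ⟨k, lam, hl⟩ := p
  set u : L2 := (memLp_core k hl).toLp _ with hu
  set f : L2 := (memLp_coreLap 0 k hl).toLp _ with hf
  have h1 : ContinuousLinearMap.adjoint formInclusion (u + f) = ⟨coreJet k hl, coreJet_mem k hl⟩ :=
    adjoint_formInclusion_eq (coreJet_mem k hl) fun Z hZ => coreJet_inner k hl hZ
  have h2 : resolventOne (u + f) = u := by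
    change formInclusion (ContinuousLinearMap.adjoint formInclusion (u + f)) = u
    rw [h1]
    rfl
  have h3 : coreSource s (k, ⟨lam, hl⟩) =
      (u + f) + ((s ^ 2 - 1 : ℝ) : ℂ) • resolventOne (u + f) := by
    rw [h2]
    refine (toLp_coreLap (s ^ 2) k hl).trans ?_
    push_cast
    rw [sub_smul, one_smul, ← hu, ← hf]
    abel
  have h4 := functionalCalculus_inv_apply hs isSelfAdjoint_resolventOne spectrum_resolventOne
    (u + f)
  rw [← h3] at h4
  change ((ContinuousLinearMap.adjoint formInclusion (functionalCalculus _ resolventOne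
    (coreSource s (k, ⟨lam, hl⟩))) : formDomain) : L2Triple) = _
  rw [h4, h1]

theorem resolvent_coreSource {s : ℝ} (hs : 0 < s) (p : ℤ × Ioi (0 : ℝ)) :
    resolvent s (coreSource s p) = (memLp_core p.1 (lam := p.2) p.2.2).toLp _ := by
  rw [← formInclusion_formResolvent hs, formResolvent_coreSource hs]
  rfl

/-! ### The bilinear pairing and vector fields on the form domain -/

/-- The bilinear pairing `∫ f g dS` on `L²`. -/
def pair : L2 →L[ℂ] L2 →L[ℂ] ℂ := (ContinuousLinearMap.mul ℂ ℂ).lpPairing area 2 2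

theorem pair_apply (f g : L2) : pair f g = ∫ q, f q * g q ∂area :=
  ContinuousLinearMap.lpPairing_eq_integral _ f g

theorem pair_comm (f g : L2) : pair f g = pair g f := by
  simp only [pair_apply, mul_comm]

theorem pair_eq_of_ae {f g : L2} {F G : Cone → ℂ} (hf : f =ᵐ[area] F) (hg : g =ᵐ[area] G) :
    pair f g = ∫ q, F q * G q ∂area := by
  rw [pair_apply]
  refine integral_congr_ae ?_
  filter_upwards [hf, hg] with q h1 h2
  rw [h1, h2]

/-- The resolvent is symmetric for the bilinear pairing: it is self-adjoint, and the core is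
invariant under complex conjugation. -/
theorem pair_resolvent {s : ℝ} (hs : 0 < s) (f g : L2) :
    pair (resolvent s f) g = pair (resolvent s g) f := by
  have h : pair (resolvent s f) = (pair.flip f) ∘L resolvent s := by
    refine ContinuousLinearMap.ext_on (dense_span_coreSource s) ?_
    rintro _ ⟨⟨l, mu⟩, rfl⟩
    set p : ℤ × Ioi (0 : ℝ) := (-l, mu) with hp
    have e1 : ∀ y, pair (coreSource s (l, mu)) y = ⟪coreSource s p, y⟫_ℂ := by
      intro y
      rw [coreSource, coreSource, pair_apply, L2.inner_def]
      refine integral_congr_ae ?_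
      filter_upwards [(memLp_coreLap (s ^ 2) l (lam := mu) mu.2).coeFn_toLp,
        (memLp_coreLap (s ^ 2) (-l) (lam := mu) mu.2).coeFn_toLp] with q h1 h2
      rw [h1, h2, RCLike.inner_apply', conj_mode, neg_neg]
      unfold coreLap
      rw [index_neg]
    have e2 : ∀ y, pair (resolvent s (coreSource s (l, mu))) y =
        ⟪resolvent s (coreSource s p), y⟫_ℂ := by
      intro y
      rw [resolvent_coreSource hs, resolvent_coreSource hs, pair_apply, L2.inner_def]
      refine integral_congr_ae ?_
      filter_upwards [(memLp_core l (lam := mu) mu.2).coeFn_toLp,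
        (memLp_core (-l) (lam := mu) mu.2).coeFn_toLp] with q h1 h2
      rw [h1, h2, RCLike.inner_apply', conj_mode, neg_neg, index_neg]
    change pair (resolvent s f) (coreSource s (l, mu)) =
      pair (resolvent s (coreSource s (l, mu))) f
    rw [pair_comm, e1, e2, resolvent, functionalCalculus_inner]
  exact DFunLike.congr_fun h g

theorem continuous_cosAngle (α : ℝ) : Continuous fun θ => (cosAngle α θ : ℂ) := by
  simp only [cosAngle_eq]
  fun_prop

theorem continuous_sinAngle (α : ℝ) : Continuous fun θ => (sinAngle α θ : ℂ) := by
  simp only [sinAngle_eq]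
  fun_prop

theorem memLp_top_of_continuous {c : Angle → ℂ} (hc : Continuous c) :
    MemLp (fun q : Cone => c q.2) ⊤ area := by
  obtain ⟨M, hM⟩ := isCompact_univ.exists_bound_of_continuousOn hc.continuousOn
  exact memLp_top_of_bound (hc.comp continuous_snd).aestronglyMeasurable M
    (Filter.Eventually.of_forall fun q => hM _ (mem_univ _))

/-- Multiplication by a continuous function of the angle, as an operator on `L²`. -/
def angularMul {c : Angle → ℂ} (hc : Continuous c) : L2 →L[ℂ] L2 :=
  (ContinuousLinearMap.mul ℂ ℂ).holderL area ⊤ 2 2 ((memLp_top_of_continuous hc).toLp _)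

theorem coeFn_angularMul {c : Angle → ℂ} (hc : Continuous c) (f : L2) :
    angularMul hc f =ᵐ[area] fun q => c q.2 * f q := by
  have h := (ContinuousLinearMap.mul ℂ ℂ).coeFn_holder (r := 2)
    ((memLp_top_of_continuous hc).toLp _) f
  filter_upwards [h, (memLp_top_of_continuous hc).coeFn_toLp] with q h1 h2
  refine h1.trans ?_
  rw [h2, ContinuousLinearMap.mul_apply']

/-- The constant vector field acting on the form domain. -/
def formX (α : ℝ) : formDomain →L[ℂ] L2 :=
  (angularMul (continuous_cosAngle α) ∘L PiLp.proj 2 (fun _ : Fin 3 => L2) 1 -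
    angularMul (continuous_sinAngle α) ∘L PiLp.proj 2 (fun _ : Fin 3 => L2) 2) ∘L
      formDomain.subtypeL

theorem coeFn_formX (α : ℝ) (U : formDomain) : formX α U =ᵐ[area] fun q =>
    (cosAngle α q.2 : ℂ) * (U : L2Triple) 1 q - (sinAngle α q.2 : ℂ) * (U : L2Triple) 2 q := by
  have h : formX α U = angularMul (continuous_cosAngle α) ((U : L2Triple) 1) -
    angularMul (continuous_sinAngle α) ((U : L2Triple) 2) := rfl
  rw [h]
  filter_upwards [Lp.coeFn_sub (angularMul (continuous_cosAngle α) ((U : L2Triple) 1))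
    (angularMul (continuous_sinAngle α) ((U : L2Triple) 2)),
    coeFn_angularMul (continuous_cosAngle α) ((U : L2Triple) 1),
    coeFn_angularMul (continuous_sinAngle α) ((U : L2Triple) 2)] with q h1 h2 h3
  rw [h1, Pi.sub_apply, h2, h3]

/-- Integration by parts for a constant vector field, against a function in the form domain. -/
theorem pair_formX (α : ℝ) (U : formDomain) {φ : Cone → ℂ} (hφ : IsTest φ) :
    pair (formX α U) hφ.toL2 = -pair ((U : L2Triple) 0) (hφ.X α).toL2 := by
  rw [eq_neg_iff_add_eq_zero]
  set T : L2Triple →L[ℂ] ℂ := (pair.flip hφ.toL2) ∘L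
    (angularMul (continuous_cosAngle α) ∘L PiLp.proj 2 (fun _ : Fin 3 => L2) 1 -
    angularMul (continuous_sinAngle α) ∘L PiLp.proj 2 (fun _ : Fin 3 => L2) 2) +
    (pair.flip (hφ.X α).toL2) ∘L PiLp.proj 2 (fun _ : Fin 3 => L2) 0 with hT
  have hle : formDomain ≤ LinearMap.ker (T : L2Triple →ₗ[ℂ] ℂ) := by
    refine Submodule.topologicalClosure_minimal _ (Submodule.span_le.2 ?_)
      (ContinuousLinearMap.isClosed_ker T)
    rintro _ ⟨f, hf, rfl⟩
    have hmem : hf.jet ∈ formDomain :=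
      Submodule.le_topologicalClosure _ (Submodule.subset_span ⟨f, hf, rfl⟩)
    have h1 : formX α ⟨hf.jet, hmem⟩ =ᵐ[area] ConeWave.X α f := by
      have e1 : hf.jet 1 =ᵐ[area] ConeWave.dr f := hf.dr.memLp.coeFn_toLp
      have e2 : hf.jet 2 =ᵐ[area] ConeWave.angularDeriv f := hf.angularDeriv.memLp.coeFn_toLp
      filter_upwards [coeFn_formX α ⟨hf.jet, hmem⟩, e1, e2] with q h1 h2 h3
      rw [h1, h2, h3, ConeWave.X, ConeWave.angularDeriv]
      push_cast
      ring
    have h2 : pair (formX α ⟨hf.jet, hmem⟩) hφ.toL2 + pair (hf.jet 0) (hφ.X α).toL2 = 0 := by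
      have e0 : hf.jet 0 =ᵐ[area] f := hf.memLp.coeFn_toLp
      have e1 : hφ.toL2 =ᵐ[area] φ := hφ.memLp.coeFn_toLp
      have e2 : (hφ.X α).toL2 =ᵐ[area] ConeWave.X α φ := (hφ.X α).memLp.coeFn_toLp
      rw [pair_eq_of_ae h1 e1, pair_eq_of_ae e0 e2, hf.integral_X_mul hφ, neg_add_cancel]
    exact h2
  exact hle U.2

/-! ### Two radial integrals -/

theorem tendsto_gau (p : ℝ) {lam : ℝ} (hl : 0 < lam) :
    Filter.Tendsto (gau p lam) Filter.atTop (nhds 0) := by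
  have h1 := (rpow_mul_exp_neg_mul_sq_isLittleO_exp_neg hl p).isBigO
  have h2 : Filter.Tendsto (fun x : ℝ => Real.exp (-(1 / 2) * x)) Filter.atTop (nhds 0) := by
    have := tendsto_rpow_mul_exp_neg_mul_atTop_nhds_zero 0 (1 / 2) (by norm_num)
    simpa using this
  have h3 := h1.trans_tendsto h2
  simp only [neg_mul] at h3
  exact h3

/-- The radial part of the component of `X u` in the mode `k + 2`, for `u` in the core. -/
def coreRaise (k : ℤ) (lam : ℝ) : ℝ → ℝ := fun r =>
  coreDeriv k lam r - k / 2 * (gau (index k) lam r / r)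

theorem coreRaise_mul_coreLap (c : ℝ) (k l : ℤ) (lam mu : ℝ) {r : ℝ} (hr : 0 < r) :
    r * (coreRaise k lam r * coreLap c l mu r) =
      ((index k - k / 2) - 2 * lam * r ^ 2) * (c + 4 * mu * (index l + 1) - 4 * mu ^ 2 * r ^ 2) *
        gau (index k + index l) (lam + mu) r := by
  have e1 : gau (index k) lam r / r = gau (index k - 1) lam r := gau_div hr
  have e2 : gau (index k + 1) lam r = r ^ 2 * gau (index k - 1) lam r := by
    rw [sq, mul_assoc, mul_gau hr, mul_gau hr]; congr 1; ring
  have e3 : gau (index l + 2) mu r = r ^ 2 * gau (index l) mu r := by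
    rw [sq, mul_assoc, mul_gau hr, mul_gau hr]; congr 1; ring
  have e4 : gau (index k + index l) (lam + mu) r =
      r * (gau (index k - 1) lam r * gau (index l) mu r) := by
    rw [gau_mul_gau hr, mul_gau hr]; congr 1; ring
  simp only [coreRaise, coreDeriv, coreLap, e1, e2, e3, e4]
  ring

theorem integrableOn_coreRaise_mul_coreLap (c : ℝ) (k l : ℤ) {lam mu : ℝ} (hl : 0 < lam)
    (hm : 0 < mu) :
    IntegrableOn (fun r => r * (coreRaise k lam r * coreLap c l mu r)) (Ioi 0) := by
  have hk := index_nonneg k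
  have hl' := index_nonneg l
  have hlm : 0 < lam + mu := add_pos hl hm
  have hi := fun (j : ℝ) (hj : 0 ≤ j) =>
    integrableOn_gau (p := index k + index l + j) (by linarith) hlm
  set A := index k - k / 2
  set B := c + 4 * mu * (index l + 1)
  have := (((hi 0 le_rfl).const_mul (A * B)).add
    ((hi 2 (by norm_num)).const_mul (-(A * (4 * mu ^ 2) + 2 * lam * B)))).add
    ((hi 4 (by norm_num)).const_mul (8 * lam * mu ^ 2))
  refine IntegrableOn.congr_fun this (fun r hr => ?_) measurableSet_Ioi
  have hr' : 0 < r := hr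
  rw [coreRaise_mul_coreLap c k l lam mu hr']
  have e2 : gau (index k + index l + 2) (lam + mu) r =
      r ^ 2 * gau (index k + index l) (lam + mu) r := by
    rw [sq, mul_assoc, mul_gau hr', mul_gau hr']; congr 1; ring
  have e4 : gau (index k + index l + 4) (lam + mu) r =
      r ^ 4 * gau (index k + index l) (lam + mu) r := by
    rw [show r ^ 4 * gau (index k + index l) (lam + mu) r =
      r * (r * (r * (r * gau (index k + index l) (lam + mu) r))) by ring, mul_gau hr', mul_gau hr',
      mul_gau hr', mul_gau hr']
    congr 1
    ring
  simp only [Pi.add_apply, add_zero, e2, e4]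
  ring

/-- The boundary term of Green's formula at the vertex. For `k + l = -2` the integrand is an exact
derivative; its primitive vanishes at infinity, and at the vertex unless `k = l = -1`, that is
unless both functions have a term `r^{1/2} e^{-iθ/2}`. -/
theorem integral_coreRaise_add (c : ℝ) {k l : ℤ} (hkl : k + l = -2) {lam mu : ℝ} (hl : 0 < lam)
    (hm : 0 < mu) :
    (∫ r in Ioi 0, r * (coreRaise k lam r * coreLap c l mu r)) +
      (∫ r in Ioi 0, r * (coreRaise l mu r * coreLap c k lam r)) = if k = -1 then 1 else 0 := by
  have hlm : 0 < lam + mu := add_pos hl hm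
  have hkl' : (l : ℝ) = -2 - k := by
    have : (k : ℝ) + l = -2 := by exact_mod_cast hkl
    linarith
  set m := index k with hmk
  set n := index l with hnl
  have hm0 : 0 ≤ m := index_nonneg k
  have hn0 : 0 ≤ n := index_nonneg l
  have hm2 : m ^ 2 = (k / 2) ^ 2 := index_sq k
  have hn2 : n ^ 2 = (l / 2) ^ 2 := index_sq l
  have hp : 0 ≤ m + n - 1 := by
    have h1 := abs_add_le (k : ℝ) l
    rw [hkl', show (k : ℝ) + (-2 - k) = -2 by ring, ← hkl'] at h1
    have : |(-2 : ℝ)| = 2 := by norm_num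
    rw [hmk, hnl, index, index]
    linarith
  set A := m - k / 2 with hA
  set B := n - l / 2 with hB
  set G : ℝ → ℝ := fun r => (-(A - 2 * lam * r ^ 2) * (B - 2 * mu * r ^ 2) + c * r ^ 2) *
    gau (m + n - 1) (lam + mu) r with hG
  rw [← integral_add (integrableOn_coreRaise_mul_coreLap c k l hl hm)
    (integrableOn_coreRaise_mul_coreLap c l k hm hl)]
  have hGc : ContinuousWithinAt G (Ici 0) 0 := by
    have h1 : Continuous (gau (m + n - 1) (lam + mu)) :=
      (Real.continuous_rpow_const hp).mul (by fun_prop)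
    exact Continuous.continuousWithinAt (by fun_prop)
  have hGl : Filter.Tendsto G Filter.atTop (nhds 0) := by
    have h1 := ((tendsto_gau (m + n - 1) hlm).const_mul (-(A * B))).add
      (((tendsto_gau (m + n + 1) hlm).const_mul (2 * mu * A + 2 * lam * B + c)).add
        ((tendsto_gau (m + n + 3) hlm).const_mul (-(4 * lam * mu))))
    simp only [mul_zero, add_zero] at h1
    refine h1.congr' ?_
    filter_upwards [Filter.eventually_gt_atTop 0] with r hr
    have e1 : gau (m + n + 1) (lam + mu) r = r ^ 2 * gau (m + n - 1) (lam + mu) r := by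
      rw [sq, mul_assoc, mul_gau hr, mul_gau hr]; congr 1; ring
    have e2 : gau (m + n + 3) (lam + mu) r = r ^ 2 * gau (m + n + 1) (lam + mu) r := by
      rw [sq, mul_assoc, mul_gau hr, mul_gau hr]; congr 1; ring
    simp only [hG, e1, e2]
    ring
  have hGd : ∀ r ∈ Ioi (0 : ℝ), HasDerivAt G (r * (coreRaise k lam r * coreLap c l mu r) +
      r * (coreRaise l mu r * coreLap c k lam r)) r := by
    intro r hr
    have hr' : 0 < r := hr
    have h2 : HasDerivAt (fun r : ℝ => r ^ 2) (2 * r) r := by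
      simpa using (hasDerivAt_id' r).fun_pow 2
    have h3 := (((h2.const_mul (2 * lam)).const_sub A).fun_neg.fun_mul
      ((h2.const_mul (2 * mu)).const_sub B)).fun_add (h2.const_mul c)
    refine (h3.fun_mul (hasDerivAt_gau (m + n - 1) (lam + mu) hr')).congr_deriv ?_
    rw [coreRaise_mul_coreLap c k l lam mu hr', coreRaise_mul_coreLap c l k mu lam hr',
      ← hmk, ← hnl, ← hA, ← hB, add_comm n m, add_comm mu lam]
    have e0 : gau (m + n - 1) (lam + mu) r = r * gau (m + n - 1 - 1) (lam + mu) r := by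
      rw [mul_gau hr']; congr 1; ring
    have e1 : gau (m + n) (lam + mu) r = r ^ 2 * gau (m + n - 1 - 1) (lam + mu) r := by
      rw [sq, mul_assoc, mul_gau hr', mul_gau hr']; congr 1; ring
    have e2 : gau (m + n - 1 + 1) (lam + mu) r =
        r ^ 2 * gau (m + n - 1 - 1) (lam + mu) r := by
      rw [sq, mul_assoc, mul_gau hr', mul_gau hr']; congr 1; ring
    rw [e0, e1, e2]
    -- The term of order `r ^ (m + n - 2)`, which the integrand does not have, vanishes in the
    -- derivative of `G`:
    -- if `A` and `B` are nonzero, then `m = -k/2` and `n = -l/2`, so that `m + n = 1`.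
    have key : (m + n - 1) * (A * B) = 0 := by
      rw [hA, hB]
      rw [hkl'] at hn2 ⊢
      rcases sq_eq_sq_iff_eq_or_eq_neg.1 hm2 with h | h
      · rw [h]; ring
      · rcases sq_eq_sq_iff_eq_or_eq_neg.1 hn2 with h' | h'
        · rw [h']; ring
        · rw [h, h']; ring
    have key2 : (m + n - 1 + 2) * (2 * mu * A + 2 * lam * B) + 2 * (lam + mu) * (A * B) =
        4 * mu * (n + 1) * A + 4 * lam * (m + 1) * B := by
      rw [hkl'] at hn2
      rw [hA, hB, hkl']
      linear_combination (2 * mu) * hm2 + (2 * lam) * hn2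
    have hAB : A + B = m + n + 1 := by rw [hA, hB, hkl']; ring
    linear_combination gau (m + n - 1 - 1) (lam + mu) r * (-key + r ^ 2 * key2 -
      (c * r ^ 2 + 4 * lam * mu * r ^ 4) * hAB)
  rw [integral_Ioi_of_hasDerivAt_of_tendsto hGc hGd (by
    exact (integrableOn_coreRaise_mul_coreLap c k l hl hm).add
      (integrableOn_coreRaise_mul_coreLap c l k hm hl)) hGl]
  -- At the vertex `0 ^ (m + n - 1)` is `1` if `m + n = 1` and `0` otherwise.
  have hG0 : G 0 = -(A * B * (0 : ℝ) ^ (m + n - 1)) := by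
    simp only [hG, gau]
    norm_num
  rw [hG0]
  split_ifs with h
  · have hl1 : l = -1 := by omega
    have e1 : m = 1 / 2 := by rw [hmk, h, index]; norm_num
    have e2 : n = 1 / 2 := by rw [hnl, hl1, index]; norm_num
    rw [hA, hB, e1, e2, h, hl1]
    norm_num
  · -- If `k ≥ 0` or `l ≥ 0`, then `A = 0` or `B = 0`; otherwise `k = l = -1`.
    have hAB : A * B = 0 := by
      rcases le_or_gt 0 k with hk | hk
      · have : (0 : ℝ) ≤ k := by exact_mod_cast hk
        rw [hA, hmk, index, abs_of_nonneg this, sub_self, zero_mul]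
      · have : (0 : ℝ) ≤ l := by exact_mod_cast (by omega : 0 ≤ l)
        rw [hB, hnl, index, abs_of_nonneg this, sub_self, mul_zero]
    rw [hAB]
    norm_num

/-- The radial part of the `L²` solutions `r^{-1/2} e^{-sr} e^{±iθ/2}` of `(s² + Δ) v = 0`. -/
def decay (s : ℝ) : ℝ → ℝ := fun r => r ^ (-(1 / 2) : ℝ) * Real.exp (-(s * r))

theorem memLp_mode_decay (k : ℤ) {s : ℝ} (hs : 0 < s) : MemLp (mode k (decay s)) 2 area := by
  refine memLp_mode k (by unfold decay; fun_prop) ?_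
  have h := integrableOn_exp_mul_Ioi (a := -(2 * s)) (by linarith) 0
  refine h.congr_fun (fun r hr => ?_) measurableSet_Ioi
  have hr' : (0 : ℝ) < r := hr
  have e : r * (r ^ (-(1 / 2) : ℝ) * r ^ (-(1 / 2) : ℝ)) = 1 := by
    rw [← Real.rpow_add hr', show (-(1 / 2) : ℝ) + -(1 / 2) = -1 by norm_num, Real.rpow_neg_one,
      mul_inv_cancel₀ hr'.ne']
  have e2 : Real.exp (-(2 * s) * r) = Real.exp (-(s * r)) * Real.exp (-(s * r)) := by
    rw [← Real.exp_add]; congr 1; ring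
  change Real.exp (-(2 * s) * r) = _
  rw [decay, e2]
  linear_combination (-(Real.exp (-(s * r))) ^ 2) * e

/-- The coefficient of `r^{1/2} e^{±iθ/2}` in `u` is recovered from `(s² + Δ) u`. -/
theorem integral_decay_mul_coreLap {s : ℝ} (hs : 0 < s) {k : ℤ} (hk : index k = 1 / 2) {lam : ℝ}
    (hl : 0 < lam) :
    ∫ r in Ioi 0, r * (decay s r * coreLap (s ^ 2) k lam r) = 1 := by
  set E : ℝ → ℝ := fun r => Real.exp (-(lam * r ^ 2)) * Real.exp (-(s * r)) with hE
  -- The radial Wronskian `r (v u' - u v')` of `v = decay s` and `u = r^{1/2} e^{-λr²}`, up to sign.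
  set G : ℝ → ℝ := fun r => (-(1 - 2 * lam * r ^ 2) - s * r) * E r with hG
  have e : ∀ r ∈ Ioi (0 : ℝ), r * (decay s r * coreLap (s ^ 2) k lam r) =
      (s ^ 2 * r + 6 * lam * r - 4 * lam ^ 2 * r ^ 3) * E r := by
    intro r hr
    have hr' : (0 : ℝ) < r := hr
    have e1 : r ^ (-(1 / 2) : ℝ) * r ^ (1 / 2 : ℝ) = 1 := by
      rw [← Real.rpow_add hr']; norm_num
    have e2 : gau (1 / 2 + 2) lam r = r ^ 2 * gau (1 / 2) lam r := by
      rw [sq, mul_assoc, mul_gau hr', mul_gau hr']; congr 1; ring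
    simp only [coreLap, hk, decay, e2, hE]
    unfold gau
    linear_combination (r * (s ^ 2 + 6 * lam - 4 * lam ^ 2 * r ^ 2) *
      Real.exp (-(lam * r ^ 2)) * Real.exp (-(s * r))) * e1
  rw [setIntegral_congr_fun measurableSet_Ioi e]
  have hEc : Continuous E := by fun_prop
  have hEle : ∀ r, 0 < r → |E r| ≤ Real.exp (-(lam * r ^ 2)) := by
    intro r hr
    rw [hE, abs_mul, Real.abs_exp, Real.abs_exp]
    refine mul_le_of_le_one_right (Real.exp_pos _).le (Real.exp_le_one_iff.2 ?_)
    have := mul_pos hs hr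
    linarith
  have hEd : ∀ r, HasDerivAt E ((-(2 * lam * r) - s) * E r) r := by
    intro r
    have h1 : HasDerivAt (fun r : ℝ => Real.exp (-(lam * r ^ 2)))
        (Real.exp (-(lam * r ^ 2)) * -(lam * (2 * r))) r := by
      have := (((hasDerivAt_id' r).fun_pow 2).const_mul lam).fun_neg.exp
      simpa using this
    have h2 : HasDerivAt (fun r : ℝ => Real.exp (-(s * r)))
        (Real.exp (-(s * r)) * -(s * 1)) r :=
      (((hasDerivAt_id' r).const_mul s).fun_neg).exp
    refine (h1.mul h2).congr_deriv ?_
    rw [hE]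
    ring
  have hGd : ∀ r ∈ Ioi (0 : ℝ), HasDerivAt G
      ((s ^ 2 * r + 6 * lam * r - 4 * lam ^ 2 * r ^ 3) * E r) r := by
    intro r _
    have h2 : HasDerivAt (fun r : ℝ => r ^ 2) (2 * r) r := by
      simpa using (hasDerivAt_id' r).fun_pow 2
    have h3 := ((h2.const_mul (2 * lam)).const_sub 1).fun_neg.fun_sub
      ((hasDerivAt_id' r).const_mul s)
    refine (h3.fun_mul (hEd r)).congr_deriv ?_
    ring
  have hpow : ∀ j : ℕ, ∀ r : ℝ, r ^ j * Real.exp (-(lam * r ^ 2)) = gau j lam r := by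
    intro j r
    rw [gau, Real.rpow_natCast]
  have hmaj : ∀ a b d : ℝ, ∀ r ∈ Ioi (0 : ℝ), ∀ x : ℝ, |x| ≤ a + b * r + d * r ^ 2 →
      |x * E r| ≤ a * gau (0 : ℕ) lam r + b * gau (1 : ℕ) lam r + d * gau (2 : ℕ) lam r := by
    intro a b d r hr x hx
    rw [abs_mul]
    calc _ ≤ (a + b * r + d * r ^ 2) * Real.exp (-(lam * r ^ 2)) :=
          mul_le_mul hx (hEle r hr) (abs_nonneg _) ((abs_nonneg x).trans hx)
      _ = _ := by simp only [← hpow]; ring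
  have hint : IntegrableOn (fun r => (s ^ 2 * r + 6 * lam * r - 4 * lam ^ 2 * r ^ 3) * E r)
      (Ioi 0) := by
    have h1 := ((integrableOn_gau (p := (1 : ℕ)) (by norm_num) hl).const_mul
      (s ^ 2 + 6 * lam)).add ((integrableOn_gau (p := (3 : ℕ)) (by norm_num) hl).const_mul
      (4 * lam ^ 2))
    refine Integrable.mono' h1 (Continuous.aestronglyMeasurable (by fun_prop)) ?_
    filter_upwards [ae_restrict_mem measurableSet_Ioi] with r hr
    have hr' : (0 : ℝ) < r := hr
    have h2 : |s ^ 2 * r + 6 * lam * r - 4 * lam ^ 2 * r ^ 3| ≤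
        (s ^ 2 + 6 * lam) * r + 4 * lam ^ 2 * r ^ 3 := by
      refine (abs_sub _ _).trans (add_le_add (le_of_eq ?_) (le_of_eq ?_))
      · rw [← add_mul]; exact abs_of_pos (by positivity)
      · exact abs_of_pos (by positivity)
    rw [Real.norm_eq_abs, abs_mul]
    calc _ ≤ ((s ^ 2 + 6 * lam) * r + 4 * lam ^ 2 * r ^ 3) * Real.exp (-(lam * r ^ 2)) :=
          mul_le_mul h2 (hEle r hr) (abs_nonneg _) ((abs_nonneg _).trans h2)
      _ = _ := by
        simp only [Pi.add_apply, ← hpow]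
        ring
  have hGl : Filter.Tendsto G Filter.atTop (nhds 0) := by
    have h1 := (((tendsto_gau (0 : ℕ) hl).const_mul 1).add
      ((tendsto_gau (1 : ℕ) hl).const_mul s)).add ((tendsto_gau (2 : ℕ) hl).const_mul (2 * lam))
    simp only [mul_zero, add_zero] at h1
    refine squeeze_zero_norm' ?_ h1
    filter_upwards [Filter.eventually_gt_atTop 0] with r hr
    refine hmaj 1 s (2 * lam) r hr _ (abs_le.2 ⟨?_, ?_⟩)
    · have := mul_pos hl (pow_pos hr 2); linarith
    · have := mul_pos hs hr; linarith
  have hGc : ContinuousWithinAt G (Ici 0) 0 := Continuous.continuousWithinAt (by fun_prop)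
  rw [integral_Ioi_of_hasDerivAt_of_tendsto hGc hGd hint hGl]
  simp [hG, hE]

/-! ### The commutator of a constant vector field with the resolvent -/

/-- The form `(f, g) ↦ ∫ X(R f) g + ∫ f X(R g)`, `R = (s² + Δ)⁻¹`, which is bounded on `L²`. On
test functions it is the commutator `[X, R]`. -/
def commutatorForm (s α : ℝ) : L2 →L[ℂ] L2 →L[ℂ] ℂ :=
  pair ∘L (formX α ∘L formResolvent s) + (pair ∘L (formX α ∘L formResolvent s)).flip

theorem commutatorForm_apply (s α : ℝ) (f g : L2) : commutatorForm s α f g =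
    pair (formX α (formResolvent s f)) g + pair (formX α (formResolvent s g)) f := rfl

/-- The form with kernel `e^{-s(r₁ + r₂)} cos((θ₁ + θ₂)/2 - α) / (4π √(r₁ r₂))`, a sum of two
products. -/
def kernelForm {s : ℝ} (hs : 0 < s) (α : ℝ) : L2 →L[ℂ] L2 →L[ℂ] ℂ :=
  (Complex.exp (-(Complex.I * α)) / (8 * Real.pi)) •
      (ContinuousLinearMap.mul ℂ ℂ).bilinearComp (pair ((memLp_mode_decay 1 hs).toLp _))
        (pair ((memLp_mode_decay 1 hs).toLp _)) +
    (Complex.exp (Complex.I * α) / (8 * Real.pi)) •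
      (ContinuousLinearMap.mul ℂ ℂ).bilinearComp (pair ((memLp_mode_decay (-1) hs).toLp _))
        (pair ((memLp_mode_decay (-1) hs).toLp _))

theorem kernelForm_apply {s : ℝ} (hs : 0 < s) (α : ℝ) (f g : L2) : kernelForm hs α f g =
    Complex.exp (-(Complex.I * α)) / (8 * Real.pi) *
      (pair ((memLp_mode_decay 1 hs).toLp _) f * pair ((memLp_mode_decay 1 hs).toLp _) g) +
    Complex.exp (Complex.I * α) / (8 * Real.pi) *
      (pair ((memLp_mode_decay (-1) hs).toLp _) f *
        pair ((memLp_mode_decay (-1) hs).toLp _) g) := rfl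

theorem coreDeriv_neg (k : ℤ) (lam : ℝ) : coreDeriv (-k) lam = coreDeriv k lam := by
  unfold coreDeriv
  rw [index_neg]

theorem coreLap_neg (c : ℝ) (k : ℤ) (lam : ℝ) : coreLap c (-k) lam = coreLap c k lam := by
  unfold coreLap
  rw [index_neg]

/-- A constant vector field shifts the angular momentum `k/2` by `±1`. -/
theorem coeFn_formX_coreJet (α : ℝ) (k : ℤ) {lam : ℝ} (hl : 0 < lam) :
    formX α ⟨coreJet k hl, coreJet_mem k hl⟩ =ᵐ[area] fun q =>
      Complex.exp (-(Complex.I * α)) / 2 * mode (k + 2) (coreRaise k lam) q +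
      Complex.exp (Complex.I * α) / 2 * mode (k - 2) (coreRaise (-k) lam) q := by
  have e1 : coreJet k hl 1 =ᵐ[area] mode k (coreDeriv k lam) := (memLp_coreDeriv k hl).coeFn_toLp
  have e2 : coreJet k hl 2 =ᵐ[area] fun q =>
      Complex.I * mode k (fun r => k / 2 * (gau (index k) lam r / r)) q :=
    (memLp_coreAngular k hl).coeFn_toLp
  filter_upwards [coeFn_formX α ⟨coreJet k hl, coreJet_mem k hl⟩, e1, e2] with q h1 h2 h3
  rw [h1, h2, h3, cosAngle_eq, sinAngle_eq]
  have hI : (1 : ℂ) / Complex.I = -Complex.I := by simp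
  rw [show ∀ a : ℂ, a / (2 * Complex.I) = a / 2 * (1 / Complex.I) by intro a; ring, hI]
  unfold mode coreRaise
  rw [coreDeriv_neg, index_neg, sub_eq_add_neg k 2, fourier_add, fourier_add]
  push_cast
  linear_combination ((Complex.exp (-(Complex.I * α)) * fourier 2 q.2 -
    Complex.exp (Complex.I * α) * fourier (-2) q.2) / 2 *
    ((k : ℂ) / 2 * ((gau (index k) lam q.1 : ℂ) / q.1)) * fourier k q.2) * Complex.I_sq

theorem pair_mode_mode {k l : ℤ} {a b : ℝ → ℝ} (ha : MemLp (mode k a) 2 area)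
    (hb : MemLp (mode l b) 2 area) : pair (ha.toLp _) (hb.toLp _) =
      if k + l = 0 then ((4 * Real.pi * ∫ r in Ioi 0, r * (a r * b r) : ℝ) : ℂ) else 0 := by
  rw [pair_eq_of_ae ha.coeFn_toLp hb.coeFn_toLp, integral_mode_mul_mode]

theorem pair_formX_coreSource {s : ℝ} (hs : 0 < s) (α : ℝ) (k l : ℤ) {lam mu : ℝ}
    (hl : 0 < lam) (hm : 0 < mu) :
    pair (formX α (formResolvent s (coreSource s (k, ⟨lam, hl⟩)))) (coreSource s (l, ⟨mu, hm⟩)) =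
      Complex.exp (-(Complex.I * α)) / 2 * (if k + l = -2 then
        ((4 * Real.pi * ∫ r in Ioi 0,
          r * (coreRaise k lam r * coreLap (s ^ 2) l mu r) : ℝ) : ℂ) else 0) +
      Complex.exp (Complex.I * α) / 2 * (if k + l = 2 then
        ((4 * Real.pi * ∫ r in Ioi 0,
          r * (coreRaise (-k) lam r * coreLap (s ^ 2) (-l) mu r) : ℝ) : ℂ) else 0) := by
  have e0 : formResolvent s (coreSource s (k, ⟨lam, hl⟩)) =
      ⟨coreJet k hl, coreJet_mem k hl⟩ := Subtype.ext (formResolvent_coreSource hs _)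
  have e1 : coreSource s (l, ⟨mu, hm⟩) =ᵐ[area] mode l (coreLap (s ^ 2) l mu) :=
    (memLp_coreLap _ l hm).coeFn_toLp
  rw [e0, pair_eq_of_ae (coeFn_formX_coreJet α k hl) e1]
  have hint : ∀ j i : ℤ, (i = k ∨ i = -k) →
      Integrable (fun q => mode j (coreRaise i lam) q * mode l (coreLap (s ^ 2) l mu) q) area := by
    intro j i hi
    simp only [mode_mul_mode]
    have h1 := (integrable_radialMeasure_iff.2
      (integrableOn_coreRaise_mul_coreLap (s ^ 2) i l hl hm)).ofReal (𝕜 := ℂ)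
    have h2 : Integrable (fun θ : Angle => fourier (j + l) θ) :=
      (fourier (j + l)).continuous.integrable_of_hasCompactSupport
        (HasCompactSupport.of_compactSpace _)
    exact h1.mul_prod h2
  have e2 : ∀ q, (Complex.exp (-(Complex.I * α)) / 2 * mode (k + 2) (coreRaise k lam) q +
      Complex.exp (Complex.I * α) / 2 * mode (k - 2) (coreRaise (-k) lam) q) *
        mode l (coreLap (s ^ 2) l mu) q =
      Complex.exp (-(Complex.I * α)) / 2 *
        (mode (k + 2) (coreRaise k lam) q * mode l (coreLap (s ^ 2) l mu) q) +
      Complex.exp (Complex.I * α) / 2 *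
        (mode (k - 2) (coreRaise (-k) lam) q * mode l (coreLap (s ^ 2) l mu) q) := by
    intro q; ring
  simp only [e2]
  rw [integral_add ((hint _ _ (Or.inl rfl)).const_mul _) ((hint _ _ (Or.inr rfl)).const_mul _),
    integral_const_mul, integral_const_mul, integral_mode_mul_mode, integral_mode_mul_mode,
    coreLap_neg]
  have c1 : k + 2 + l = 0 ↔ k + l = -2 := by omega
  have c2 : k - 2 + l = 0 ↔ k + l = 2 := by omega
  simp only [c1, c2]

theorem pair_decay_coreSource {s : ℝ} (hs : 0 < s) {j k : ℤ} (hj : index j = 1 / 2) {lam : ℝ}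
    (hl : 0 < lam) : pair ((memLp_mode_decay j hs).toLp _) (coreSource s (k, ⟨lam, hl⟩)) =
      if k = -j then ((4 * Real.pi : ℝ) : ℂ) else 0 := by
  refine (pair_mode_mode (memLp_mode_decay j hs) (memLp_coreLap (s ^ 2) k hl)).trans ?_
  have c : j + k = 0 ↔ k = -j := by omega
  simp only [c]
  split_ifs with h
  · rw [integral_decay_mul_coreLap hs (by rw [h, index_neg, hj]) hl, mul_one]
  · rfl

/-- The commutator of the resolvent with a constant vector field. On the core both forms are
explicit, and the core is rich enough. -/
theorem commutatorForm_eq_kernelForm {s : ℝ} (hs : 0 < s) (α : ℝ) :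
    commutatorForm s α = kernelForm hs α := by
  refine ContinuousLinearMap.ext_on (dense_span_coreSource s) ?_
  rintro _ ⟨⟨k, lam, hl⟩, rfl⟩
  refine ContinuousLinearMap.ext_on (dense_span_coreSource s) ?_
  rintro _ ⟨⟨l, mu, hm⟩, rfl⟩
  have i1 : index 1 = 1 / 2 := by simp [index]
  have i2 : index (-1) = 1 / 2 := by rw [index_neg, i1]
  rw [commutatorForm_apply, kernelForm_apply, pair_formX_coreSource hs α k l hl hm,
    pair_formX_coreSource hs α l k hm hl, pair_decay_coreSource hs i1 hl,
    pair_decay_coreSource hs i2 hl, pair_decay_coreSource hs i1 hm,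
    pair_decay_coreSource hs i2 hm, add_comm l k]
  have hpi : (Real.pi : ℂ) ≠ 0 := by exact_mod_cast Real.pi_ne_zero
  by_cases h1 : k + l = -2
  · have h2 : k + l ≠ 2 := by omega
    have h3 := integral_coreRaise_add (s ^ 2) h1 hl hm
    have h4 : ¬ (k = 1 ∧ l = 1) := by omega
    simp only [if_pos h1, if_neg h2, mul_zero, add_zero]
    rw [← mul_add, ← Complex.ofReal_add, ← mul_add, h3]
    by_cases hk : k = -1
    · have hl' : l = -1 := by omega
      subst hk hl'
      norm_num
      field_simp
      norm_num
    · have hl' : l ≠ -1 := by omega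
      rw [if_neg hk, if_neg hk]
      by_cases hk1 : k = 1
      · have : l ≠ 1 := by omega
        simp [this]
      · simp [hk1]
  · by_cases h2 : k + l = 2
    · have h3 := integral_coreRaise_add (s ^ 2) (k := -k) (l := -l) (by omega) hl hm
      simp only [if_pos h2, if_neg h1, mul_zero, zero_add]
      rw [← mul_add, ← Complex.ofReal_add, ← mul_add, h3]
      by_cases hk : k = 1
      · have hl' : l = 1 := by omega
        subst hk hl'
        norm_num
        field_simp
        norm_num
      · have hl' : l ≠ 1 := by omega
        have hk' : -k ≠ -1 := by omega
        rw [if_neg hk']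
        by_cases hk1 : k = -1
        · have : l ≠ -1 := by omega
          simp [this, hk]
        · simp [hk1, hk]
    · simp only [if_neg h1, if_neg h2, mul_zero, add_zero]
      by_cases hk : k = -1
      · have : l ≠ -1 := by omega
        subst hk
        simp [this]
      · by_cases hk1 : k = 1
        · have : l ≠ 1 := by omega
          subst hk1
          simp [this]
        · simp [hk, hk1]

/-- The Schwartz kernel of `[X, (s² + Δ)⁻¹]`. -/
theorem resolvent_commutator {s : ℝ} (hs : 0 < s) (α : ℝ) {φ ψ : Cone → ℂ} (hφ : IsTest φ)
    (hψ : IsTest ψ) :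
    -pair (resolvent s hψ.toL2) (hφ.X α).toL2 - pair (resolvent s (hψ.X α).toL2) hφ.toL2 =
      kernelForm hs α hψ.toL2 hφ.toL2 := by
  rw [← commutatorForm_eq_kernelForm, commutatorForm_apply, pair_formX, pair_formX,
    formInclusion_formResolvent hs, formInclusion_formResolvent hs,
    pair_resolvent hs hφ.toL2]
  ring

/-! ### The wave propagator and its Laplace transform -/

section Propagator

variable {H : Type*} [NormedAddCommGroup H] [InnerProductSpace ℂ H] [CompleteSpace H]

theorem norm_functionalCalculus_sineSymbol_sub_le {T : H →L[ℂ] H}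
    (hT : spectrum ℝ T ⊆ Icc 0 1) (t t' : ℝ) :
    ‖functionalCalculus (sineSymbol t) T - functionalCalculus (sineSymbol t') T‖ ≤ |t - t'| := by
  change ‖cfc (sineSymbol t) T - cfc (sineSymbol t') T‖ ≤ _
  rw [← cfc_sub _ _ T ((continuousOn_sineSymbol t).mono hT) ((continuousOn_sineSymbol t').mono hT)]
  exact norm_cfc_le (abs_nonneg _) fun x _ => abs_sineSymbol_sub_le t t' x

theorem functionalCalculus_sineSymbol_zero (T : H →L[ℂ] H) :
    functionalCalculus (sineSymbol 0) T = 0 := by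
  have : sineSymbol 0 = fun _ => 0 := by funext x; simp [sineSymbol]
  rw [this]
  exact cfc_const_zero ℝ T

theorem continuous_functionalCalculus_sineSymbol {T : H →L[ℂ] H}
    (hT : spectrum ℝ T ⊆ Icc 0 1) :
    Continuous fun t => functionalCalculus (sineSymbol t) T := by
  refine LipschitzWith.continuous (K := 1) (LipschitzWith.of_dist_le_mul fun t t' => ?_)
  rw [dist_eq_norm, NNReal.coe_one, one_mul, Real.dist_eq]
  exact norm_functionalCalculus_sineSymbol_sub_le hT t t'

/-- The Laplace transform of `W(t)` is the resolvent, tested against a continuous functional `L`.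
Here `T` stands for `(1 + Δ)⁻¹`. -/
theorem integral_exp_smul_functionalCalculus {T : H →L[ℂ] H} (ha : IsSelfAdjoint T)
    (hT : spectrum ℝ T ⊆ Icc 0 1) {s : ℝ} (hs : 0 < s) (L : (H →L[ℂ] H) →L[ℂ] ℂ) :
    ∫ t in Ioi (0 : ℝ), (Real.exp (-(s * t)) : ℂ) * L (functionalCalculus (sineSymbol t) T) =
      L (functionalCalculus (fun x => x / (1 + (s ^ 2 - 1) * x)) T) := by
  have hE : IntegrableOn (fun t : ℝ => Real.exp (-(s * t)) * |t|) (Ioi 0) := by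
    have := integrableOn_rpow_mul_exp_neg_mul_rpow (s := 1) (p := 1) (b := s) (by norm_num)
      (by norm_num) hs
    refine this.congr_fun (fun t ht => ?_) measurableSet_Ioi
    have ht' : (0 : ℝ) < t := ht
    simp only [Real.rpow_one, abs_of_pos ht']
    rw [mul_comm, neg_mul]
  have hc : ContinuousOn (Function.uncurry fun t x : ℝ => Real.exp (-(s * t)) * sineSymbol t x)
      (univ ×ˢ spectrum ℝ T) := by
    have h1 : ContinuousOn (Function.uncurry sineSymbol) (univ ×ˢ spectrum ℝ T) := by
      refine continuousOn_prod_of_continuousOn_lipschitzOnWith _ 1 (fun t _ =>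
        (continuousOn_sineSymbol t).mono hT) fun x _ => ?_
      refine LipschitzOnWith.of_dist_le_mul fun t _ t' _ => ?_
      rw [NNReal.coe_one, one_mul, Real.dist_eq, Real.dist_eq]
      exact abs_sineSymbol_sub_le t t' x
    have h2 : ContinuousOn (fun p : ℝ × ℝ => Real.exp (-(s * p.1))) (univ ×ˢ spectrum ℝ T) := by
      fun_prop
    exact h2.mul h1
  have h1 := cfc_integral (μ := volume.restrict (Ioi (0 : ℝ)))
    (fun t x : ℝ => Real.exp (-(s * t)) * sineSymbol t x)
    (fun t => Real.exp (-(s * t)) * |t|) T hc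
    (Filter.Eventually.of_forall fun t x _ => by
      rw [norm_mul, Real.norm_eq_abs, Real.abs_exp]
      exact mul_le_mul_of_nonneg_left (abs_sineSymbol_le t x) (Real.exp_pos _).le)
    hE.2 ha
  have h2 : cfc (fun x => ∫ t in Ioi (0 : ℝ), Real.exp (-(s * t)) * sineSymbol t x) T =
      functionalCalculus (fun x => x / (1 + (s ^ 2 - 1) * x)) T :=
    cfc_congr fun x hx => integral_exp_mul_sineSymbol hs (hT hx)
  have h3 : ∀ t : ℝ, cfc (fun x => Real.exp (-(s * t)) * sineSymbol t x) T =
      (Real.exp (-(s * t)) : ℂ) • functionalCalculus (sineSymbol t) T := by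
    intro t
    rw [cfc_const_mul _ _ T ((continuousOn_sineSymbol t).mono hT), Complex.coe_smul]
    rfl
  rw [h2] at h1
  simp only [h3] at h1
  have hi : IntegrableOn (fun t : ℝ =>
      (Real.exp (-(s * t)) : ℂ) • functionalCalculus (sineSymbol t) T) (Ioi 0) := by
    refine Integrable.mono' hE (Continuous.aestronglyMeasurable ?_)
      (Filter.Eventually.of_forall fun t => ?_)
    · exact (Complex.continuous_ofReal.comp (by fun_prop)).smul
        (continuous_functionalCalculus_sineSymbol hT)
    · rw [norm_smul, Complex.norm_real, Real.norm_eq_abs, Real.abs_exp]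
      refine mul_le_mul_of_nonneg_left ?_ (Real.exp_pos _).le
      have := norm_functionalCalculus_sineSymbol_sub_le hT t 0
      rwa [functionalCalculus_sineSymbol_zero, sub_zero, sub_zero] at this
  rw [h1, ← L.integral_comp_comm hi]
  simp only [map_smul, smul_eq_mul]

end Propagator

/-! ### The distribution on the diffracted front -/

/-- The product measure `dθ₁ dθ₂ dr` on which `deltaFront t` integrates. -/
def frontMeasure (t : ℝ) : Measure (Angle × Angle × ℝ) :=
  (volume : Measure Angle).prod ((volume : Measure Angle).prod (volume.restrict (Ioc 0 t)))

instance (t : ℝ) : IsFiniteMeasure (frontMeasure t) := by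
  unfold frontMeasure
  infer_instance

theorem ae_frontMeasure_mem (t : ℝ) : ∀ᵐ p ∂frontMeasure t, p.2.2 ∈ Ioc 0 t :=
  (Measure.quasiMeasurePreserving_snd.comp Measure.quasiMeasurePreserving_snd).ae
    (ae_restrict_mem (μ := volume) measurableSet_Ioc)

theorem integrable_frontMeasure {t : ℝ} {F : Angle × Angle × ℝ → ℂ} (hF : Continuous F) :
    Integrable F (frontMeasure t) := by
  have hK : IsCompact ((univ : Set Angle) ×ˢ (univ : Set Angle) ×ˢ Icc (0 : ℝ) t) :=
    isCompact_univ.prod (isCompact_univ.prod isCompact_Icc)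
  obtain ⟨M, hM⟩ := hK.exists_bound_of_continuousOn hF.continuousOn
  refine Integrable.of_bound hF.aestronglyMeasurable M ?_
  filter_upwards [ae_frontMeasure_mem t] with p hp
  exact hM p ⟨mem_univ _, mem_univ _, Ioc_subset_Icc_self hp⟩

theorem integral_frontMeasure {t : ℝ} (ht : 0 < t) {F : Angle × Angle × ℝ → ℂ}
    (hF : Continuous F) : ∫ p, F p ∂frontMeasure t =
      ∫ θ₁ : Angle, ∫ θ₂ : Angle, ∫ r in (0 : ℝ)..t, F (θ₁, θ₂, r) := by
  refine (integral_prod F (integrable_frontMeasure hF)).trans ?_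
  refine integral_congr_ae (Filter.Eventually.of_forall fun θ₁ => ?_)
  have hi : Integrable (fun p : Angle × ℝ => F (θ₁, p))
      ((volume : Measure Angle).prod (volume.restrict (Ioc 0 t))) := by
    have hK : IsCompact ((univ : Set Angle) ×ˢ Icc (0 : ℝ) t) := isCompact_univ.prod isCompact_Icc
    have hc : Continuous fun p : Angle × ℝ => F (θ₁, p) := by fun_prop
    obtain ⟨M, hM⟩ := hK.exists_bound_of_continuousOn hc.continuousOn
    refine Integrable.of_bound hc.aestronglyMeasurable M ?_
    filter_upwards [Measure.quasiMeasurePreserving_snd.ae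
      (ae_restrict_mem (μ := volume) measurableSet_Ioc)] with p hp
    exact hM p ⟨mem_univ _, Ioc_subset_Icc_self hp⟩
  refine (integral_prod _ hi).trans ?_
  refine integral_congr_ae (Filter.Eventually.of_forall fun θ₂ => ?_)
  simp only
  rw [intervalIntegral.integral_of_le ht.le]

/-- The point `((r, θ₁), (t - r, θ₂))` of the front. -/
def frontPoint (t : ℝ) (p : Angle × Angle × ℝ) : Cone × Cone :=
  ((p.2.2, p.1), (t - p.2.2, p.2.1))

/-- The density of the front distribution, with the factor `r (t - r)` of the area measures
included. -/
def frontDensity (α t : ℝ) (p : Angle × Angle × ℝ) : ℂ :=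
  (Real.sqrt (p.2.2 * (t - p.2.2)) / (4 * Real.pi) : ℝ) * (cosHalfAngle α (p.1 + p.2.1) : ℂ)

theorem continuous_cosHalfAngle (α : ℝ) : Continuous fun θ => (cosHalfAngle α θ : ℂ) := by
  simp only [cosHalfAngle_eq]
  fun_prop

theorem continuous_frontPoint (t : ℝ) : Continuous (frontPoint t) := by
  unfold frontPoint
  fun_prop

theorem continuous_frontDensity (α t : ℝ) : Continuous (frontDensity α t) := by
  unfold frontDensity
  have h := continuous_cosHalfAngle α
  have h2 : Continuous fun p : Angle × Angle × ℝ => p.1 + p.2.1 := by fun_prop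
  exact (Complex.continuous_ofReal.comp (by fun_prop)).mul (h.comp h2)

/-- At the endpoints `r = 0` and `r = t` the singular factor `(r (t - r))^{-1/2}` is compensated by
the factor `r (t - r)` of the area measures. -/
theorem deltaFront_eq {α t : ℝ} (ht : 0 < t) {Ψ : Cone × Cone → ℂ} (hΨ : Continuous Ψ) :
    deltaFront t (amplitude α) Ψ =
      ∫ p, frontDensity α t p * Ψ (frontPoint t p) ∂frontMeasure t := by
  have hc : Continuous fun p => frontDensity α t p * Ψ (frontPoint t p) :=
    (continuous_frontDensity α t).mul (hΨ.comp (continuous_frontPoint t))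
  rw [integral_frontMeasure ht hc]
  refine integral_congr_ae (Filter.Eventually.of_forall fun θ₁ => ?_)
  refine integral_congr_ae (Filter.Eventually.of_forall fun θ₂ => ?_)
  refine intervalIntegral.integral_congr fun r hr => ?_
  rw [uIcc_of_le ht.le] at hr
  have h0 : 0 ≤ r * (t - r) := mul_nonneg hr.1 (by linarith [hr.2])
  have h1 : 1 / (4 * Real.pi * Real.sqrt (r * (t - r))) * (r * (t - r)) =
      Real.sqrt (r * (t - r)) / (4 * Real.pi) := by
    nth_rw 2 [← Real.mul_self_sqrt h0]
    rcases eq_or_ne (Real.sqrt (r * (t - r))) 0 with h | h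
    · rw [h]; simp
    · have := Real.pi_ne_zero
      field_simp
  simp only [amplitude, frontDensity, frontPoint]
  rw [← h1]
  push_cast
  ring

theorem IsTest₂.continuous {Ψ : Cone × Cone → ℂ} (hΨ : IsTest₂ Ψ) : Continuous Ψ :=
  (isOpenQuotientMap_coords.prodMap isOpenQuotientMap_coords).isQuotientMap.continuous_iff.2
    hΨ.smooth.continuous

theorem isDistribution₂_deltaFront (α : ℝ) {t : ℝ} (ht : 0 < t) :
    IsDistribution₂ (deltaFront t (amplitude α)) := by
  have hi : ∀ {Ψ : Cone × Cone → ℂ}, Continuous Ψ →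
      Integrable (fun p => frontDensity α t p * Ψ (frontPoint t p)) (frontMeasure t) := fun hΨ =>
    integrable_frontMeasure
      ((continuous_frontDensity α t).mul (hΨ.comp (continuous_frontPoint t)))
  refine ⟨fun Φ Ψ hΦ hΨ => ?_, fun c Ψ hΨ => ?_, fun S _ _ => ?_⟩
  · rw [deltaFront_eq ht (hΦ.continuous.add hΨ.continuous), deltaFront_eq ht hΦ.continuous,
      deltaFront_eq ht hΨ.continuous, ← integral_add (hi hΦ.continuous) (hi hΨ.continuous)]
    simp only [Pi.add_apply, mul_add]
  · rw [deltaFront_eq ht (hΨ.continuous.const_smul c), deltaFront_eq ht hΨ.continuous,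
      ← integral_const_mul]
    refine integral_congr_ae (Filter.Eventually.of_forall fun p => ?_)
    simp only [Pi.smul_apply, smul_eq_mul]
    ring
  · refine ⟨∫ p, ‖frontDensity α t p‖ ∂frontMeasure t, 0, fun Ψ hΨ _ B hB => ?_⟩
    have hsup : ∀ q, ‖Ψ q‖ ≤ B := by
      intro q
      obtain ⟨p, rfl⟩ :=
        (isOpenQuotientMap_coords.prodMap isOpenQuotientMap_coords).surjective q
      have := hB 0 le_rfl p
      rwa [norm_iteratedFDeriv_zero] at this
    have hd : Integrable (fun p => ‖frontDensity α t p‖) (frontMeasure t) :=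
      (integrable_frontMeasure (continuous_frontDensity α t)).norm
    rw [deltaFront_eq ht hΨ.continuous, ← integral_mul_const]
    refine norm_integral_le_of_norm_le (hd.mul_const B)
      (Filter.Eventually.of_forall fun p => ?_)
    rw [norm_mul]
    exact mul_le_mul_of_nonneg_left (hsup _) (norm_nonneg _)

/-! ### The front distribution on products -/

/-- The function `√r ∫ f(r, θ) e^{ikθ/2} dθ` of the radius; `√r` is the product of `r^{-1/2}` and
the factor `r` of the area measure. -/
def halfMode (k : ℤ) (f : Cone → ℂ) (r : ℝ) : ℂ :=
  (Real.sqrt r : ℂ) * ∫ θ : Angle, fourier k θ * f (r, θ)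

theorem continuous_halfMode (k : ℤ) {f : Cone → ℂ} (hf : IsTest f) :
    Continuous (halfMode k f) := by
  have h1 : Continuous fun r : ℝ => ∫ θ : Angle, fourier k θ * f (r, θ) := by
    have hc := hf.continuous
    have h2 : Continuous (Function.uncurry fun (r : ℝ) (θ : Angle) => fourier k θ * f (r, θ)) := by
      unfold Function.uncurry
      fun_prop
    have := continuousOn_integral_of_compact_support (μ := (volume : Measure Angle))
      (s := (univ : Set ℝ)) isCompact_univ h2.continuousOn (fun _ x _ hx => absurd (mem_univ x) hx)
    exact continuousOn_univ.1 this
  exact (Complex.continuous_ofReal.comp Real.continuous_sqrt).mul h1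

theorem exists_norm_halfMode_le (k : ℤ) {f : Cone → ℂ} (hf : IsTest f) :
    ∃ M : ℝ, 0 ≤ M ∧ ∀ r, ‖halfMode k f r‖ ≤ M := by
  have hs : HasCompactSupport (halfMode k f) := by
    refine HasCompactSupport.intro (hf.compact.image continuous_fst) fun r hr => ?_
    have : ∀ θ : Angle, f (r, θ) = 0 := fun θ =>
      image_eq_zero_of_notMem_tsupport fun h => hr ⟨_, h, rfl⟩
    simp [halfMode, this]
  obtain ⟨M, hM⟩ := hs.exists_bound_of_continuous (continuous_halfMode k hf)
  exact ⟨M, (norm_nonneg _).trans (hM 0), hM⟩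

/-- The Laplace transform of `halfMode`. -/
theorem integral_exp_mul_halfMode (k : ℤ) {f : Cone → ℂ} (hf : IsTest f) {s : ℝ} (hs : 0 < s) :
    ∫ r in Ioi (0 : ℝ), (Real.exp (-(s * r)) : ℂ) * halfMode k f r =
      pair ((memLp_mode_decay k hs).toLp _) hf.toL2 := by
  have e : hf.toL2 =ᵐ[area] f := hf.memLp.coeFn_toLp
  have hI : Integrable (fun q => mode k (decay s) q * f q) area :=
    (memLp_mode_decay k hs).integrable_mul hf.memLp
  rw [pair_eq_of_ae (memLp_mode_decay k hs).coeFn_toLp e, integral_area_symm hI,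
    integral_radialMeasure]
  refine setIntegral_congr_fun measurableSet_Ioi fun r hr => ?_
  have hr' : (0 : ℝ) < r := hr
  have e1 : Real.sqrt r = r * r ^ (-(1 / 2) : ℝ) := by
    rw [Real.sqrt_eq_rpow, mul_comm, ← Real.rpow_add_one hr'.ne']
    norm_num
  have e2 : ∀ θ : Angle, mode k (decay s) (r, θ) * f (r, θ) =
      (decay s r : ℂ) * (fourier k θ * f (r, θ)) := by
    intro θ
    rw [mode, mul_assoc]
  simp only [e2, integral_const_mul, halfMode, e1, decay, Complex.real_smul]
  push_cast
  ring

/-- The convolution of the radial functions `halfMode k φ` and `halfMode k ψ` on the half-line. -/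
def frontConv (k : ℤ) (φ ψ : Cone → ℂ) (t : ℝ) : ℂ :=
  ∫ r in (0 : ℝ)..t, halfMode k φ r * halfMode k ψ (t - r)

theorem continuous_frontConv (k : ℤ) {φ ψ : Cone → ℂ} (hφ : IsTest φ) (hψ : IsTest ψ) :
    Continuous (frontConv k φ ψ) := by
  have h1 := continuous_halfMode k hφ
  have h2 := continuous_halfMode k hψ
  exact intervalIntegral.continuous_parametric_intervalIntegral_of_continuous
    (f := fun t r => halfMode k φ r * halfMode k ψ (t - r)) (s := fun t => t)
    (by unfold Function.uncurry; fun_prop) continuous_id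

theorem exists_norm_frontConv_le (k : ℤ) {φ ψ : Cone → ℂ} (hφ : IsTest φ) (hψ : IsTest ψ) :
    ∃ C : ℝ, ∀ t, 0 < t → ‖frontConv k φ ψ t‖ ≤ C * (1 + t) := by
  obtain ⟨M, hM0, hM⟩ := exists_norm_halfMode_le k hφ
  obtain ⟨N, hN0, hN⟩ := exists_norm_halfMode_le k hψ
  refine ⟨M * N, fun t ht => ?_⟩
  have h := intervalIntegral.norm_integral_le_of_norm_le_const (a := 0) (b := t) (C := M * N)
    (f := fun r => halfMode k φ r * halfMode k ψ (t - r)) (fun r _ => by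
      rw [norm_mul]
      exact mul_le_mul (hM _) (hN _) (norm_nonneg _) hM0)
  rw [sub_zero, abs_of_pos ht] at h
  refine h.trans ?_
  exact mul_le_mul_of_nonneg_left (by linarith) (mul_nonneg hM0 hN0)

theorem integral_exp_mul_frontConv (k : ℤ) {φ ψ : Cone → ℂ} (hφ : IsTest φ) (hψ : IsTest ψ)
    {s : ℝ} (hs : 0 < s) :
    ∫ t in Ioi (0 : ℝ), (Real.exp (-(s * t)) : ℂ) * frontConv k φ ψ t =
      pair ((memLp_mode_decay k hs).toLp _) hφ.toL2 *
        pair ((memLp_mode_decay k hs).toLp _) hψ.toL2 := by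
  rw [← integral_exp_mul_halfMode k hφ hs, ← integral_exp_mul_halfMode k hψ hs]
  have hi : ∀ {f : Cone → ℂ}, IsTest f →
      IntegrableOn (fun r => (Real.exp (-(s * r)) : ℂ) * halfMode k f r) (Ioi 0) := by
    intro f hf
    obtain ⟨M, hM0, hM⟩ := exists_norm_halfMode_le k hf
    refine integrableOn_exp_mul_of_linear_growth (continuous_halfMode k hf) (C := M)
      (fun t ht => (hM t).trans ?_) hs
    nlinarith
  have h := integral_posConvolution (hi hφ) (hi hψ) (ContinuousLinearMap.mul ℝ ℂ)
  simp only [ContinuousLinearMap.mul_apply'] at h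
  rw [← h]
  refine setIntegral_congr_fun measurableSet_Ioi fun t _ => ?_
  simp only [frontConv]
  rw [← intervalIntegral.integral_const_mul]
  refine intervalIntegral.integral_congr fun r _ => ?_
  have e : Real.exp (-(s * t)) = Real.exp (-(s * r)) * Real.exp (-(s * (t - r))) := by
    rw [← Real.exp_add]
    congr 1
    ring
  simp only [e]
  push_cast
  ring

theorem integral_front_mul {t : ℝ} (ht : 0 < t) (k : ℤ) {φ ψ : Cone → ℂ} (hφ : IsTest φ)
    (hψ : IsTest ψ) :
    ∫ p, ((Real.sqrt p.2.2 : ℂ) * (fourier k p.1 * φ (p.2.2, p.1))) *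
      ((Real.sqrt (t - p.2.2) : ℂ) * (fourier k p.2.1 * ψ (t - p.2.2, p.2.1))) ∂frontMeasure t =
      frontConv k φ ψ t := by
  have hcφ := hφ.continuous
  have hcψ := hψ.continuous
  have hc : Continuous fun p : Angle × Angle × ℝ =>
      ((Real.sqrt p.2.2 : ℂ) * (fourier k p.1 * φ (p.2.2, p.1))) *
      ((Real.sqrt (t - p.2.2) : ℂ) * (fourier k p.2.1 * ψ (t - p.2.2, p.2.1))) := by fun_prop
  have hi := integrable_frontMeasure (t := t) hc
  refine (integral_prod_symm _ hi).trans ?_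
  have hi2 := Integrable.integral_prod_right (μ := (volume : Measure Angle)) hi
  refine (integral_prod_symm _ hi2).trans ?_
  rw [frontConv, intervalIntegral.integral_of_le ht.le]
  refine integral_congr_ae (Filter.Eventually.of_forall fun r => ?_)
  simp only [halfMode, integral_mul_const, integral_const_mul]

/-- The addition formula for `cos ((θ₁ + θ₂) / 2 - α)` makes the front distribution a sum of two
convolutions on products. -/
theorem deltaFront_mul {t : ℝ} (ht : 0 < t) (α : ℝ) {φ ψ : Cone → ℂ} (hφ : IsTest φ)
    (hψ : IsTest ψ) :
    deltaFront t (amplitude α) (fun q => φ q.1 * ψ q.2) =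
      Complex.exp (-(Complex.I * α)) / (8 * Real.pi) * frontConv 1 φ ψ t +
      Complex.exp (Complex.I * α) / (8 * Real.pi) * frontConv (-1) φ ψ t := by
  have hcφ := hφ.continuous
  have hcψ := hψ.continuous
  have hi : ∀ k : ℤ, Integrable (fun p : Angle × Angle × ℝ =>
      ((Real.sqrt p.2.2 : ℂ) * (fourier k p.1 * φ (p.2.2, p.1))) *
      ((Real.sqrt (t - p.2.2) : ℂ) * (fourier k p.2.1 * ψ (t - p.2.2, p.2.1))))
      (frontMeasure t) := fun k => integrable_frontMeasure (by fun_prop)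
  rw [deltaFront_eq ht (by fun_prop), ← integral_front_mul ht 1 hφ hψ,
    ← integral_front_mul ht (-1) hφ hψ, ← integral_const_mul, ← integral_const_mul,
    ← integral_add ((hi 1).const_mul _) ((hi (-1)).const_mul _)]
  refine integral_congr_ae ?_
  filter_upwards [ae_frontMeasure_mem t] with p hp
  have e : ∀ k : ℤ, fourier k (p.1 + p.2.1) = fourier k p.1 * fourier k p.2.1 := by
    intro k
    simp only [fourier_apply, zsmul_add, AddCircle.toCircle_add, Circle.coe_mul]
  rw [frontDensity, frontPoint, cosHalfAngle_eq, Real.sqrt_mul hp.1.le, e, e]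
  push_cast
  have hpi : (Real.pi : ℂ) ≠ 0 := by exact_mod_cast Real.pi_ne_zero
  field_simp
  ring

/-! ### The commutator with the propagator -/

theorem toDistribution_eq (u : L2) {φ : Cone → ℂ} (hφ : IsTest φ) :
    toDistribution u φ = pair u hφ.toL2 := by
  have e : hφ.toL2 =ᵐ[area] φ := hφ.memLp.coeFn_toLp
  rw [pair_eq_of_ae (Filter.EventuallyEq.refl _ u) e]
  rfl

/-- The matrix element `A ↦ ⟨[X, A] ψ, φ⟩`, as a continuous functional of a bounded operator. -/
def commutatorFunctional (α : ℝ) {φ ψ : Cone → ℂ} (hφ : IsTest φ) (hψ : IsTest ψ) :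
    (L2 →L[ℂ] L2) →L[ℂ] ℂ :=
  -((pair.flip (hφ.X α).toL2) ∘L ContinuousLinearMap.apply ℂ L2 hψ.toL2) -
    (pair.flip hφ.toL2) ∘L ContinuousLinearMap.apply ℂ L2 (hψ.X α).toL2

theorem commutatorFunctional_apply (α : ℝ) {φ ψ : Cone → ℂ} (hφ : IsTest φ) (hψ : IsTest ψ)
    (A : L2 →L[ℂ] L2) : commutatorFunctional α hφ hψ A =
      -pair (A hψ.toL2) (hφ.X α).toL2 - pair (A (hψ.X α).toL2) hφ.toL2 := rfl

theorem commutator_eq (α t : ℝ) {φ ψ : Cone → ℂ} (hφ : IsTest φ) (hψ : IsTest ψ) :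
    commutator α t ⟨ψ, hψ⟩ φ = commutatorFunctional α hφ hψ (W t) := by
  rw [commutatorFunctional_apply, commutator, distX, toDistribution_eq _ (hφ.X α),
    toDistribution_eq _ hφ]

/-- The commutator and the front distribution have the same Laplace transform in `t`, hence
coincide. -/
theorem commutator_eq_deltaFront (α : ℝ) {t : ℝ} (ht : 0 < t) {φ ψ : Cone → ℂ} (hφ : IsTest φ)
    (hψ : IsTest ψ) :
    deltaFront t (amplitude α) (fun q => φ q.1 * ψ q.2) = commutator α t ⟨ψ, hψ⟩ φ := by
  set L := commutatorFunctional α hφ hψ with hL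
  set K : ℝ → ℂ := fun t =>
    Complex.exp (-(Complex.I * α)) / (8 * Real.pi) * frontConv 1 φ ψ t +
      Complex.exp (Complex.I * α) / (8 * Real.pi) * frontConv (-1) φ ψ t with hK
  have hWc : Continuous fun t => L (W t) := L.continuous.comp
    (continuous_functionalCalculus_sineSymbol spectrum_resolventOne)
  have hc1 := continuous_frontConv 1 hφ hψ
  have hc2 := continuous_frontConv (-1) hφ hψ
  obtain ⟨C1, hC1⟩ := exists_norm_frontConv_le 1 hφ hψ
  obtain ⟨C2, hC2⟩ := exists_norm_frontConv_le (-1) hφ hψ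
  have hWb : ∀ t, 0 < t → ‖L (W t)‖ ≤ ‖L‖ * (1 + t) := by
    intro t ht
    refine (L.le_opNorm _).trans (mul_le_mul_of_nonneg_left ?_ (norm_nonneg _))
    have h := norm_functionalCalculus_sineSymbol_sub_le spectrum_resolventOne t 0
    rw [functionalCalculus_sineSymbol_zero, sub_zero, sub_zero, abs_of_pos ht] at h
    exact h.trans (by linarith)
  set c1 := Complex.exp (-(Complex.I * α)) / (8 * Real.pi)
  set c2 := Complex.exp (Complex.I * α) / (8 * Real.pi)
  have hD : ∀ t, 0 < t → ‖K t - L (W t)‖ ≤ (‖c1‖ * C1 + ‖c2‖ * C2 + ‖L‖) * (1 + t) := by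
    intro t ht
    refine (norm_sub_le _ _).trans ?_
    have h1 : ‖K t‖ ≤ ‖c1‖ * (C1 * (1 + t)) + ‖c2‖ * (C2 * (1 + t)) := by
      refine (norm_add_le _ _).trans ?_
      rw [norm_mul, norm_mul]
      exact add_le_add (mul_le_mul_of_nonneg_left (hC1 t ht) (norm_nonneg _))
        (mul_le_mul_of_nonneg_left (hC2 t ht) (norm_nonneg _))
    linarith [hWb t ht]
  have hKc : Continuous K := (continuous_const.mul hc1).add (continuous_const.mul hc2)
  have h0 := eq_zero_of_laplace_eq_zero (D := fun t => K t - L (W t)) (hKc.sub hWc) hD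
    (fun s hs => by
      have i1 := integrableOn_exp_mul_of_linear_growth hc1 hC1 hs
      have i2 := integrableOn_exp_mul_of_linear_growth hc2 hC2 hs
      have i3 := integrableOn_exp_mul_of_linear_growth hWc hWb hs
      have e : ∀ t : ℝ, (Real.exp (-(s * t)) : ℂ) * (K t - L (W t)) =
          (c1 * ((Real.exp (-(s * t)) : ℂ) * frontConv 1 φ ψ t) +
            c2 * ((Real.exp (-(s * t)) : ℂ) * frontConv (-1) φ ψ t)) -
          (Real.exp (-(s * t)) : ℂ) * L (W t) := by
        intro t
        simp only [hK]
        ring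
      have hW : ∫ t in Ioi (0 : ℝ), (Real.exp (-(s * t)) : ℂ) * L (W t) = L (resolvent s) :=
        integral_exp_smul_functionalCalculus isSelfAdjoint_resolventOne spectrum_resolventOne hs L
      simp only [e]
      rw [integral_sub ((i1.const_mul c1).fun_add (i2.const_mul c2)) i3,
        integral_add (i1.const_mul c1) (i2.const_mul c2), integral_const_mul, integral_const_mul,
        integral_exp_mul_frontConv 1 hφ hψ hs, integral_exp_mul_frontConv (-1) hφ hψ hs, hW, hL,
        commutatorFunctional_apply, resolvent_commutator hs α hφ hψ, kernelForm_apply]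
      ring) ht
  rw [deltaFront_mul ht α hφ hψ, commutator_eq α t hφ hψ]
  exact sub_eq_zero.1 h0

end ConeWave

end

theorem mainTheorem7 (t : ℝ) (ht : 0 < t) (α : ℝ) :
    ConeWave.IsSchwartzKernel (ConeWave.deltaFront t (ConeWave.amplitude α))
      (ConeWave.commutator α t) :=
  ⟨ConeWave.isDistribution₂_deltaFront α ht, fun φ ψ =>
    ConeWave.commutator_eq_deltaFront α ht φ.2 ψ.2⟩
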